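/- Let $n\ge 3$, $\mathbb R^n_+=\{x=(x',x_n)\in\mathbb R^{n-1}\times\mathbb R:\ x_n>0\}$, identify $\partial\mathbb R^n_+$ with $\mathbb R^{n-1}$, and for $x\in\mathbb R^n_+$, $y\in\partial\mathbb R^n_+$ put $$P_\lambda(x,y,\mu)=\frac{x_n^{\lambda}}{(|x'-y|^2+x_n^2)^{\mu/2}} .$$ Let $\lambda\ge 0$, $0<\alpha,\beta<n$, $0<\mu<n-2\lambda$, $p_0,q_0>1$, with $$\frac{n-1}{n}\,\frac1{p_0+1}+\frac1{q_0+1}=\frac{\alpha+\beta+\mu-\lambda}{n}.$$ Let $(u,v)\in L^{p_0+1}(\partial\mathbb R^n_+)\times L^{q_0+1}(\mathbb R^n_+)$ be a pair of (finite) positive solutions of $$u(y)=\int_{\mathbb R^n_+}|x|^{-\beta}P_\lambda(x,y,\mu)\,v^{q_0}(x)\,|y|^{-\alpha}\,dx\quad (y\in\partial\mathbb R^n_+\setminus\{0\}),$$ $$v(x)=\int_{\partial\mathbb R^n_+}|y|^{-\alpha}P_\lambda(x,y,\mu)\,u^{p_0}(y)\,|x|^{-\beta}\,dy\quad (x\in\mathbb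 R^n_+).$$ Integrals of nonnegative functions and the limits below are taken in $[0,\infty]$. 1. If $\frac1{q_0}-\frac{\mu+\beta-\lambda}{q_0 n}>\frac{\beta-1}{n}$, then $$\lim_{y\to0,\;y\in\partial\mathbb R^n_+\setminus\{0\}}u(y)|y|^{\alpha}=\int_{\mathbb R^n_+}\frac{x_n^{\lambda}v^{q_0}(x)}{|x|^{\mu+\beta}}\,dx ,$$ and this value is finite whenever $\beta(q_0+1)<n-\mu+\lambda(q_0+1)$ (in particular whenever $\lambda\ge1$). 2. If $\frac1{p_0}-\frac{\mu+\alpha-\lambda+1}{p_0(n-1)}>\frac{\alpha}{n-1}$, then $$\lim_{x\to0,\;x\in\mathbb R^n_+}\frac{v(x)|x|^{\beta}}{x_n^{\lambda}}=\int_{\partial\mathbb R^n_+}\frac{u^{p_0}(y)}{|y|^{\alpha+\mu}}\,dy ,$$ and this value is finite whenever $\alpha(p_0+1)<n-1-\mu$ (in particular whenever $\lambda\le1$). -/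

import Mathlib

open MeasureTheory Filter Topology

noncomputable section

/-- The boundary of the half space of dimension `n = m + 1`, identified with `ℝ^(n-1)`. -/
abbrev Bdry (m : ℕ) : Type := EuclideanSpace ℝ (Fin m)

/-- The ambient Euclidean space `ℝ^n`, `n = m + 1`. -/
abbrev Amb (m : ℕ) : Type := EuclideanSpace ℝ (Fin (m + 1))

/-- The last coordinate `x_n` of `x = (x', x_n)`. -/
def lastCoord {m : ℕ} (x : Amb m) : ℝ := x (Fin.last m)

/-- The first `n - 1` coordinates `x'` of `x = (x', x_n)`. -/
def tangential {m : ℕ} (x : Amb m) : Bdry m := WithLp.toLp 2 (fun i : Fin m => x i.castSucc)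

/-- The open upper half space `{x : x_n > 0}`. -/
def halfSpace (m : ℕ) : Set (Amb m) := {x | 0 < lastCoord x}

/-- The kernel `P_lam(x, y, μ) = x_n ^ lam / (|x' - y|^2 + x_n^2) ^ (μ / 2)`. -/
def kernelP {m : ℕ} (lam μ : ℝ) (x : Amb m) (y : Bdry m) : ℝ :=
  lastCoord x ^ lam / (‖tangential x - y‖ ^ 2 + lastCoord x ^ 2) ^ (μ / 2)

/-- `(u, v)` is a pair of (finite) positive solutions of the doubly weighted integral system.
The factor `|y| ^ (-α)` is infinite at the boundary point `y = 0`, so the first equation is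
required at all `y ≠ 0`. The integrals are those of nonnegative functions, with values in `[0, ∞]`;
the equations say in particular that they are finite. -/
structure IsPositiveSolution {m : ℕ} (lam μ α β p₀ q₀ : ℝ) (u : Bdry m → ℝ) (v : Amb m → ℝ) :
    Prop where
  u_pos : ∀ y : Bdry m, y ≠ 0 → 0 < u y
  v_pos : ∀ x ∈ halfSpace m, 0 < v x
  u_eq : ∀ y : Bdry m, y ≠ 0 →
    ENNReal.ofReal (u y) =
      ∫⁻ x in halfSpace m,
        ENNReal.ofReal (‖x‖ ^ (-β) * kernelP lam μ x y * v x ^ q₀ * ‖y‖ ^ (-α))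
  v_eq : ∀ x ∈ halfSpace m,
    ENNReal.ofReal (v x) =
      ∫⁻ y : Bdry m,
        ENNReal.ofReal (‖y‖ ^ (-α) * kernelP lam μ x y * u y ^ p₀ * ‖x‖ ^ (-β))

/-- `∫ x_n ^ lam * v(x) ^ q₀ / |x| ^ (μ + β) dx` over the half space, in `[0, ∞]`. -/
def limitU {m : ℕ} (lam μ β q₀ : ℝ) (v : Amb m → ℝ) : ENNReal :=
  ∫⁻ x in halfSpace m, ENNReal.ofReal (lastCoord x ^ lam * v x ^ q₀ / ‖x‖ ^ (μ + β))

/-- `∫ u(y) ^ p₀ / |y| ^ (α + μ) dy` over the boundary, in `[0, ∞]`. -/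
def limitV {m : ℕ} (μ α p₀ : ℝ) (u : Bdry m → ℝ) : ENNReal :=
  ∫⁻ y : Bdry m, ENNReal.ofReal (u y ^ p₀ / ‖y‖ ^ (α + μ))

end

/-! Multiplied by |y|^α, respectively by |x|^β x_n^(-λ), each equation exhibits the unknown as a
potential ∫ f(x)|x-y|^(-μ) of a positive density, and the claim is continuity of this potential at
the origin, with values in [0, ∞]. If the potential at the origin is infinite, Fatou's lemma
suffices (`tendsto_lintegral_potential_top`). If it is finite, dominated convergence settles the
points with |x-y| ≥ |x|/2, and it remains to see that the part with |x-y| < |x|/2 tends to 0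
(`tendsto_lintegral_potential`).

The estimate of this near part is scale invariant. Put n = m+1, dσ = |y|^(-m)dy and Φ =
|y|^(m/(p+1)) u, so that Φ lies in L^(p+1)(σ). The kernels become homogeneous of degree 0, with
exponents a = m/(p+1) - α and b = (m+1)/(q+1) - (β-λ), and the balance of exponents says a + b = μ.
A potential of a positive density is bounded below near 0, so u ≥ c|y|^(-α) and v ≥ c x_n^λ |x|^(-β)
there; integrability of u and v then forces a, b > 0. The same lower bounds make the limit of the
first component infinite when qb ≤ a, and that of the second when pa ≤ b.

The interior variable is eliminated by comparing x with the boundary points z in its `shadow`. Split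
μ = κ + ρ: the factor |x-y|^(-κ) is estimated at the cost of (x_n/|x|)^(-κ), while |x-y|^(-ρ)
becomes |z-y|^(-ρ). The bound κ < λ + 1/(q+1) keeps integrals in the normal direction finite, and ρ
< m/(p+1) + m/(q+1) makes the resulting boundary system strictly subcritical; positivity of α + β
leaves room for both (`IsSystem.exists_isSplitSystem`). Thus Φ and its boundary potential H form an
`IsSubcriticalPair`.

For such a pair a weight |y|^(-θ) with θ < min(a, b) can be carried through the kernel. As p, q > 1,
the surplus powers of Φ and H have small norm near 0, so Young's inequality yields a contraction for
the weighted norms (`exists_conicNorm_truncWeight_le`); the subcritical margin then bootstraps them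
to all higher exponents (`weighted_norm_div_ne_top`). By Hölder's inequality the kernel integral of
H^q over a ball of radius R is O(R^(θq)). Finiteness of the limit forces a < qb, so θ can be chosen
with θq > a, and the near part is O(|y|^(θq-a)). The second component is treated alike. -/

theorem ofReal_norm_smul_rpow {E : Type*} [NormedAddCommGroup E] [NormedSpace ℝ E] {R : ℝ}
    (hR : 0 < R) (s : ℝ) (x : E) :
    ENNReal.ofReal (‖R • x‖ ^ s) = ENNReal.ofReal (R ^ s) * ENNReal.ofReal (‖x‖ ^ s) := by
  rw [norm_smul, Real.norm_of_nonneg hR.le, Real.mul_rpow hR.le (norm_nonneg _),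
    ENNReal.ofReal_mul (by positivity)]

/-! ### Power integrals under dilation. -/

section Scaling

variable {E : Type*} [NormedAddCommGroup E] [NormedSpace ℝ E] [MeasurableSpace E] [BorelSpace E]
  [FiniteDimensional ℝ E] (μ : Measure E) [μ.IsAddHaarMeasure]

theorem lintegral_eq_mul_lintegral_comp_smul (f : E → ENNReal) {R : ℝ} (hR : 0 < R) :
    ∫⁻ x, f x ∂μ = ENNReal.ofReal (R ^ Module.finrank ℝ E) * ∫⁻ x, f (R • x) ∂μ := by
  have h := (Homeomorph.smulOfNeZero R hR.ne' : E ≃ₜ E).toMeasurableEquiv.measurableEmbedding.lintegral_map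
    (μ := μ) f
  have h2 : (Measure.map (⇑(Homeomorph.smulOfNeZero R hR.ne' : E ≃ₜ E).toMeasurableEquiv) μ) =
      Measure.map (R • ·) μ := rfl
  rw [h2, Measure.map_addHaar_smul μ hR.ne', lintegral_smul_measure] at h
  have h3 : ∫⁻ x, f (R • x) ∂μ =
      ENNReal.ofReal |(R ^ Module.finrank ℝ E)⁻¹| • ∫⁻ x, f x ∂μ := h.symm
  have hp : 0 < R ^ Module.finrank ℝ E := by positivity
  rw [h3, abs_of_pos (by positivity), smul_eq_mul, ← mul_assoc, ← ENNReal.ofReal_mul hp.le,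
    mul_inv_cancel₀ hp.ne', ENNReal.ofReal_one, one_mul]

/-- Both power bounds below reduce through this homogeneity to finiteness at radius 1. -/
theorem lintegral_norm_rpow_scaling (s : ℝ) {R : ℝ} (hR : 0 < R) (S : ℝ → Set E)
    (hS : ∀ R, MeasurableSet (S R)) (hS' : ∀ x, R • x ∈ S R ↔ x ∈ S 1) :
    ∫⁻ x in S R, ENNReal.ofReal (‖x‖ ^ (-s)) ∂μ =
      (∫⁻ x in S 1, ENNReal.ofReal (‖x‖ ^ (-s)) ∂μ) *
        ENNReal.ofReal (R ^ ((Module.finrank ℝ E : ℝ) - s)) := by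
  rw [← lintegral_indicator (hS R), lintegral_eq_mul_lintegral_comp_smul μ _ hR,
    ← lintegral_indicator (hS 1)]
  have : ∀ x : E, (S R).indicator (fun x => ENNReal.ofReal (‖x‖ ^ (-s))) (R • x) =
      ENNReal.ofReal (R ^ (-s)) * (S 1).indicator (fun x => ENNReal.ofReal (‖x‖ ^ (-s))) x := by
    intro x
    by_cases hx : x ∈ S 1
    · rw [Set.indicator_of_mem hx, Set.indicator_of_mem ((hS' x).2 hx), ofReal_norm_smul_rpow hR]
    · rw [Set.indicator_of_notMem hx, Set.indicator_of_notMem (fun h => hx ((hS' x).1 h)), mul_zero]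
  simp_rw [this]
  rw [lintegral_const_mul' _ _ ENNReal.ofReal_ne_top, ← mul_assoc, mul_comm,
    ← ENNReal.ofReal_mul (by positivity), ← Real.rpow_natCast, ← Real.rpow_add hR, sub_eq_add_neg]

theorem exists_setLIntegral_ball_norm_rpow_le [Nontrivial E] {s : ℝ}
    (hs : s < Module.finrank ℝ E) :
    ∃ C : ENNReal, C ≠ ⊤ ∧ ∀ R : ℝ, 0 < R →
      ∫⁻ x in {x : E | ‖x‖ < R}, ENNReal.ofReal (‖x‖ ^ (-s)) ∂μ ≤
        C * ENNReal.ofReal (R ^ ((Module.finrank ℝ E : ℝ) - s)) := by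
  have hms : ∀ R : ℝ, MeasurableSet {x : E | ‖x‖ < R} := fun R =>
    measurableSet_lt measurable_norm measurable_const
  refine ⟨_, ?_, fun R hR => (lintegral_norm_rpow_scaling μ s hR (fun R => {x : E | ‖x‖ < R})
    hms (fun x => ?_)).le⟩
  · have hd : 1 ≤ Module.finrank ℝ E := Module.finrank_pos
    have h : IntegrableOn (fun x : E => (fun r : ℝ => r ^ (-s)) ‖x‖) (Metric.ball (0 : E) 1) μ := by
      refine (integrableOn_fun_norm_addHaar μ (f := fun r : ℝ => r ^ (-s))).2 ?_
      have h1 : IntegrableOn (fun y : ℝ => y ^ ((Module.finrank ℝ E : ℝ) - 1 - s))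
          (Set.Ioo 0 1) := by
        rw [intervalIntegral.integrableOn_Ioo_rpow_iff one_pos]; linarith
      refine h1.congr_fun (fun y hy => ?_) measurableSet_Ioo
      rw [smul_eq_mul, ← Real.rpow_natCast, ← Real.rpow_add hy.1, Nat.cast_sub hd, Nat.cast_one,
        sub_eq_add_neg _ s]
    have h2 := h.2
    rw [hasFiniteIntegral_iff_ofReal (ae_of_all _ fun x => by positivity)] at h2
    have : {x : E | ‖x‖ < 1} = Metric.ball (0 : E) 1 := by ext; simp
    rw [this]
    exact h2.ne
  · simp only [Set.mem_ofPred_eq, norm_smul, Real.norm_of_nonneg hR.le]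
    constructor <;> intro h <;> nlinarith

theorem exists_setLIntegral_norm_ge_norm_rpow_le [Nontrivial E] {s : ℝ}
    (hs : Module.finrank ℝ E < s) :
    ∃ C : ENNReal, C ≠ ⊤ ∧ ∀ R : ℝ, 0 < R →
      ∫⁻ x in {x : E | R ≤ ‖x‖}, ENNReal.ofReal (‖x‖ ^ (-s)) ∂μ ≤
        C * ENNReal.ofReal (R ^ ((Module.finrank ℝ E : ℝ) - s)) := by
  have hms : ∀ R : ℝ, MeasurableSet {x : E | R ≤ ‖x‖} := fun R =>
    measurableSet_le measurable_const measurable_norm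
  refine ⟨_, ?_, fun R hR => (lintegral_norm_rpow_scaling μ s hR (fun R => {x : E | R ≤ ‖x‖})
    hms (fun x => ?_)).le⟩
  · have h := finite_integral_one_add_norm (E := E) (μ := μ) hs
    have hs0 : 0 < s := lt_of_le_of_lt (by positivity) hs
    have h2 : ∫⁻ x in {x : E | 1 ≤ ‖x‖}, ENNReal.ofReal (‖x‖ ^ (-s)) ∂μ ≤
        ∫⁻ x, ENNReal.ofReal (2 ^ s) * ENNReal.ofReal ((1 + ‖x‖) ^ (-s)) ∂μ := by
      refine (setLIntegral_mono' (hms 1) fun x hx => ?_).trans (setLIntegral_le_lintegral _ _)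
      rw [← ENNReal.ofReal_mul (by positivity)]
      apply ENNReal.ofReal_le_ofReal
      have hx : 1 ≤ ‖x‖ := hx
      have h3 : (2 * ‖x‖) ^ (-s) ≤ (1 + ‖x‖) ^ (-s) :=
        Real.rpow_le_rpow_of_nonpos (by positivity) (by linarith) (by linarith)
      rw [Real.mul_rpow (by norm_num) (by positivity)] at h3
      calc ‖x‖ ^ (-s) = 2 ^ s * (2 ^ (-s) * ‖x‖ ^ (-s)) := by
            rw [← mul_assoc, ← Real.rpow_add two_pos]; simp
        _ ≤ _ := by gcongr
    refine (h2.trans_lt ?_).ne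
    rw [lintegral_const_mul' _ _ ENNReal.ofReal_ne_top]
    exact ENNReal.mul_lt_top ENNReal.ofReal_lt_top h
  · simp only [Set.mem_ofPred_eq, norm_smul, Real.norm_of_nonneg hR.le]
    constructor <;> intro h <;> nlinarith

/-- A function that at least compensates the contraction of volume under dilation by `1/2` cannot
have a finite nonzero integral on the unit ball. -/
theorem setLIntegral_shell_eq_zero_of_scaling {g : E → ENNReal}
    (hscale : ∀ x : E, g ((2 : ℝ) • x) ≤ ENNReal.ofReal (2 ^ (-(Module.finrank ℝ E : ℝ))) * g x)
    (hfin : ∫⁻ x in {x : E | ‖x‖ < 1}, g x ∂μ ≠ ⊤) :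
    ∫⁻ x in {x : E | 1 / 2 ≤ ‖x‖ ∧ ‖x‖ < 1}, g x ∂μ = 0 := by
  have hm1 : MeasurableSet {x : E | ‖x‖ < 1} := measurableSet_lt measurable_norm measurable_const
  have hm2 : MeasurableSet {x : E | ‖x‖ < 1 / 2} :=
    measurableSet_lt measurable_norm measurable_const
  have hm3 : MeasurableSet {x : E | 1 / 2 ≤ ‖x‖ ∧ ‖x‖ < 1} :=
    (measurableSet_le measurable_const measurable_norm).inter hm1
  have hunion : {x : E | ‖x‖ < 1} = {x : E | ‖x‖ < 1 / 2} ∪ {x : E | 1 / 2 ≤ ‖x‖ ∧ ‖x‖ < 1} := by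
    ext x
    simp only [Set.mem_ofPred_eq, Set.mem_union]
    constructor
    · intro h
      rcases lt_or_ge ‖x‖ (1 / 2) with h' | h'
      · exact Or.inl h'
      · exact Or.inr ⟨h', h⟩
    · rintro (h | h)
      · linarith
      · exact h.2
  have hdisj : Disjoint {x : E | ‖x‖ < 1 / 2} {x : E | 1 / 2 ≤ ‖x‖ ∧ ‖x‖ < 1} := by
    rw [Set.disjoint_left]
    intro x hx hx'
    exact absurd hx (not_lt.2 hx'.1)
  have hsplit := lintegral_union (μ := μ) (f := g) hm3 hdisj
  rw [← hunion] at hsplit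
  -- The substitution x ↦ 2x maps the half ball onto the unit ball, and its Jacobian is exactly
  -- compensated by `hscale`. The shell therefore adds nothing to a finite integral.
  have hle : ∫⁻ x in {x : E | ‖x‖ < 1}, g x ∂μ ≤ ∫⁻ x in {x : E | ‖x‖ < 1 / 2}, g x ∂μ := by
    rw [← lintegral_indicator hm1, ← lintegral_indicator hm2,
      lintegral_eq_mul_lintegral_comp_smul μ _ two_pos,
      ← lintegral_const_mul' _ _ ENNReal.ofReal_ne_top]
    refine lintegral_mono fun x => ?_
    by_cases hx : ‖x‖ < 1 / 2
    · rw [Set.indicator_of_mem (s := {x : E | ‖x‖ < 1 / 2}) hx, Set.indicator_of_mem]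
      · calc _ ≤ ENNReal.ofReal (2 ^ Module.finrank ℝ E) *
            (ENNReal.ofReal (2 ^ (-(Module.finrank ℝ E : ℝ))) * g x) := by gcongr; exact hscale x
          _ = g x := by
            rw [← mul_assoc, ← ENNReal.ofReal_mul (by positivity), ← Real.rpow_natCast,
              ← Real.rpow_add two_pos]
            simp
      · simp only [Set.mem_ofPred_eq, norm_smul, Real.norm_ofNat]; linarith
    · rw [Set.indicator_of_notMem]
      · simp
      · simp only [Set.mem_ofPred_eq, norm_smul, Real.norm_ofNat]; linarith
  rw [hsplit] at hle hfin
  have hf2 : ∫⁻ x in {x : E | ‖x‖ < 1 / 2}, g x ∂μ ≠ ⊤ := fun h => hfin (by rw [h, top_add])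
  have := ENNReal.le_of_add_le_add_left hf2 (hle.trans (add_zero _).ge)
  exact le_antisymm this zero_le

end Scaling

/-! ### Young's inequality from moments of the kernel. -/

section Young

variable {Y Z : Type*} [MeasurableSpace Y] [MeasurableSpace Z]

theorem lintegral_mul_rpow_three_le {σ : Measure Y} {f g h : Y → ENNReal} (hf : Measurable f)
    (hg : Measurable g) (hh : Measurable h) {p q r : ℝ} (hp : 0 ≤ p) (hq : 0 ≤ q) (hr : 0 ≤ r)
    (hpqr : p + q + r = 1) :
    ∫⁻ a, f a ^ p * g a ^ q * h a ^ r ∂σ ≤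
      (∫⁻ a, f a ∂σ) ^ p * (∫⁻ a, g a ∂σ) ^ q * (∫⁻ a, h a ∂σ) ^ r := by
  have := ENNReal.lintegral_prod_norm_pow_le (μ := σ) Finset.univ (f := ![f, g, h])
    (p := ![p, q, r]) (by intro i _; fin_cases i <;> simp <;> fun_prop)
    (by simp [Fin.sum_univ_three, hpqr]) (by intro i _; fin_cases i <;> simpa)
  simpa [Fin.prod_univ_three] using this

/-- Young's inequality for an integral operator whose kernel has bounded `t`-th moments in both
variables. -/
theorem lintegral_kernel_rpow_le {σ : Measure Y} {τ : Measure Z} [SFinite σ] [SFinite τ]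
    {K : Z → Y → ENNReal} (hK : Measurable (Function.uncurry K)) {f : Y → ENNReal}
    (hf : Measurable f) {p r t : ℝ} (hr : 1 < r) (hrp : r ≤ p)
    (ht : t * (1 - 1 / r + 1 / p) = 1) {C : ENNReal}
    (h1 : ∀ z, ∫⁻ y, K z y ^ t ∂σ ≤ C) (h2 : ∀ y, ∫⁻ z, K z y ^ t ∂τ ≤ C) :
    (∫⁻ z, (∫⁻ y, K z y * f y ∂σ) ^ p ∂τ) ^ (1 / p) ≤
      C ^ (1 / t) * (∫⁻ y, f y ^ r ∂σ) ^ (1 / r) := by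
  have hr0 : 0 < r := by linarith
  have hp0 : 0 < p := by linarith
  have hr1 : 1 / r < 1 := by rw [div_lt_one hr0]; exact hr
  have hpr : 1 / p ≤ 1 / r := one_div_le_one_div_of_le hr0 hrp
  have hp1 : 0 < 1 / p := by positivity
  have ht0 : 0 < t := by
    by_contra h
    have : t * (1 - 1 / r + 1 / p) ≤ 0 := mul_nonpos_of_nonpos_of_nonneg (not_lt.1 h) (by linarith)
    linarith
  have hKz : ∀ z, Measurable (K z) := fun z => hK.of_uncurry_left
  set N := ∫⁻ y, f y ^ r ∂σ with hN
  have hpt : ∀ z, (∫⁻ y, K z y * f y ∂σ) ^ p ≤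
      (∫⁻ y, K z y ^ t * f y ^ r ∂σ) * (N ^ (p / r - 1) * C ^ (p * (1 - 1 / r))) := by
    intro z
    -- Write K f = (K^t f^r)^(1/p) (f^r)^(1/r-1/p) (K^t)^(1-1/r). The three outer exponents sum to
    -- 1, and the relation defining t restores the power of K.
    have h3 : ∫⁻ y, K z y * f y ∂σ ≤ (∫⁻ y, K z y ^ t * f y ^ r ∂σ) ^ (1 / p) *
        N ^ (1 / r - 1 / p) * (∫⁻ y, K z y ^ t ∂σ) ^ (1 - 1 / r) := by
      refine le_trans (le_of_eq ?_) (lintegral_mul_rpow_three_le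
        (((hKz z).pow_const t).mul (hf.pow_const r)) (hf.pow_const r) ((hKz z).pow_const t)
        hp1.le (by linarith) (by linarith) (by ring))
      refine lintegral_congr fun y => ?_
      rw [Pi.mul_apply, ENNReal.mul_rpow_of_nonneg _ _ hp1.le, ← ENNReal.rpow_mul, ← ENNReal.rpow_mul,
        ← ENNReal.rpow_mul, ← ENNReal.rpow_mul]
      calc K z y * f y = K z y ^ (t * (1 / p) + t * (1 - 1 / r)) *
            f y ^ (r * (1 / p) + r * (1 / r - 1 / p)) := by
            rw [← mul_add, ← mul_add]
            have e1 : t * (1 / p + (1 - 1 / r)) = 1 := by linear_combination ht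
            have e2 : r * (1 / p + (1 / r - 1 / p)) = 1 := by field_simp; ring
            rw [e1, e2, ENNReal.rpow_one, ENNReal.rpow_one]
        _ = _ := by
            rw [ENNReal.rpow_add_of_nonneg _ _ (by positivity)
                (mul_nonneg ht0.le (by linarith)),
              ENNReal.rpow_add_of_nonneg _ _ (by positivity)
                (mul_nonneg hr0.le (by linarith))]
            ring
    calc (∫⁻ y, K z y * f y ∂σ) ^ p ≤ ((∫⁻ y, K z y ^ t * f y ^ r ∂σ) ^ (1 / p) *
        N ^ (1 / r - 1 / p) * C ^ (1 - 1 / r)) ^ p := by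
          refine ENNReal.rpow_le_rpow (h3.trans ?_) hp0.le
          exact mul_le_mul_right (ENNReal.rpow_le_rpow (h1 z) (by linarith)) _
      _ = _ := by
        rw [ENNReal.mul_rpow_of_nonneg _ _ hp0.le, ENNReal.mul_rpow_of_nonneg _ _ hp0.le,
          ← ENNReal.rpow_mul, ← ENNReal.rpow_mul, ← ENNReal.rpow_mul, mul_assoc]
        congr 2
        · rw [one_div_mul_cancel hp0.ne', ENNReal.rpow_one]
        · congr 2
          field_simp
        · rw [mul_comm p]
  have hmeas : Measurable (fun z => ∫⁻ y, K z y ^ t * f y ^ r ∂σ) :=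
    Measurable.lintegral_prod_right' (f := fun w : Z × Y => K w.1 w.2 ^ t * f w.2 ^ r)
      ((hK.pow_const t).mul ((hf.comp measurable_snd).pow_const r))
  have hsum : ∫⁻ z, (∫⁻ y, K z y * f y ∂σ) ^ p ∂τ ≤
      C * N * (N ^ (p / r - 1) * C ^ (p * (1 - 1 / r))) := by
    calc _ ≤ ∫⁻ z, (∫⁻ y, K z y ^ t * f y ^ r ∂σ) *
          (N ^ (p / r - 1) * C ^ (p * (1 - 1 / r))) ∂τ := lintegral_mono hpt
      _ = (∫⁻ z, (∫⁻ y, K z y ^ t * f y ^ r ∂σ) ∂τ) *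
          (N ^ (p / r - 1) * C ^ (p * (1 - 1 / r))) := lintegral_mul_const _ hmeas
      _ ≤ _ := by
        gcongr
        rw [lintegral_lintegral_swap
          ((hK.pow_const t).mul ((hf.comp measurable_snd).pow_const r)).aemeasurable]
        rw [hN, ← lintegral_const_mul _ (hf.pow_const r)]
        refine lintegral_mono fun y => ?_
        rw [lintegral_mul_const _ (hK.of_uncurry_right.pow_const t)]
        gcongr
        exact h2 y
  calc _ ≤ (C * N * (N ^ (p / r - 1) * C ^ (p * (1 - 1 / r)))) ^ (1 / p) := by gcongr
    _ = ((C ^ (1 / t)) ^ p * (N ^ (1 / r)) ^ p) ^ (1 / p) := by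
      congr 1
      rw [← ENNReal.rpow_mul, ← ENNReal.rpow_mul]
      have e1 : 1 / t * p = 1 + p * (1 - 1 / r) := by
        have : 1 / t = 1 - 1 / r + 1 / p := by
          field_simp at ht ⊢; linarith
        rw [this]; field_simp; ring
      have e2 : 1 / r * p = 1 + (p / r - 1) := by ring
      have hpr1 : 1 ≤ p / r := by rwa [one_le_div hr0]
      rw [e1, e2, ENNReal.rpow_add_of_nonneg _ _ zero_le_one (mul_nonneg hp0.le (by linarith)),
        ENNReal.rpow_add_of_nonneg _ _ zero_le_one (by linarith), ENNReal.rpow_one,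
        ENNReal.rpow_one]
      ring
    _ = _ := by
      rw [← ENNReal.mul_rpow_of_nonneg _ _ hp0.le, ← ENNReal.rpow_mul, mul_one_div_cancel hp0.ne',
        ENNReal.rpow_one]

end Young

/-! ### The dilation invariant measure and the homogeneous boundary kernel. -/

noncomputable section

/-- The dilation invariant measure `|y|^(-m) dy` on the boundary. -/
def conicMeasure (m : ℕ) : Measure (Bdry m) :=
  volume.withDensity fun y => ENNReal.ofReal (‖y‖ ^ (-(m : ℝ)))

instance (m : ℕ) : SFinite (conicMeasure m) := by unfold conicMeasure; infer_instance

/-- A kernel on the boundary, homogeneous of degree `0` when `a + b = κ + ρ`. -/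
def bdryKernel {m : ℕ} (a b κ ρ : ℝ) (z y : Bdry m) : ℝ :=
  ‖z‖ ^ b * ‖y‖ ^ a / (max ‖z‖ ‖y‖ ^ κ * ‖z - y‖ ^ ρ)

/-- The kernel `bdryKernel` with the loss caused by power weights of order at most `θ`. -/
def weightedKernel {m : ℕ} (a b κ ρ θ : ℝ) (z y : Bdry m) : ℝ :=
  bdryKernel a b κ ρ z y * (1 + (‖z‖ / ‖y‖) ^ θ + (‖y‖ / ‖z‖) ^ θ)

end

section Kernel

theorem lintegral_conicMeasure {m : ℕ} {f : Bdry m → ENNReal} (hf : Measurable f) :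
    ∫⁻ y, f y ∂conicMeasure m = ∫⁻ y, ENNReal.ofReal (‖y‖ ^ (-(m : ℝ))) * f y := by
  rw [conicMeasure, lintegral_withDensity_eq_lintegral_mul _ (by fun_prop) hf]
  rfl

theorem conicMeasure_absolutelyContinuous (m : ℕ) : conicMeasure m ≪ volume :=
  withDensity_absolutelyContinuous _ _

variable {m : ℕ} {a b κ ρ θ : ℝ}

theorem bdryKernel_nonneg (z y : Bdry m) : 0 ≤ bdryKernel a b κ ρ z y := by
  unfold bdryKernel; positivity

theorem bdryKernel_swap (z y : Bdry m) : bdryKernel a b κ ρ z y = bdryKernel b a κ ρ y z := by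
  unfold bdryKernel
  rw [mul_comm (‖z‖ ^ b), max_comm, norm_sub_rev]

theorem weightedKernel_nonneg (z y : Bdry m) : 0 ≤ weightedKernel a b κ ρ θ z y :=
  mul_nonneg (bdryKernel_nonneg z y) (by positivity)

theorem weightedKernel_swap (z y : Bdry m) :
    weightedKernel a b κ ρ θ z y = weightedKernel b a κ ρ θ y z := by
  unfold weightedKernel
  rw [bdryKernel_swap]; ring

theorem bdryKernel_le_weightedKernel (z y : Bdry m) :
    bdryKernel a b κ ρ z y ≤ weightedKernel a b κ ρ θ z y := by
  refine le_mul_of_one_le_right (bdryKernel_nonneg z y) ?_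
  have h1 : 0 ≤ (‖z‖ / ‖y‖) ^ θ := by positivity
  have h2 : 0 ≤ (‖y‖ / ‖z‖) ^ θ := by positivity
  linarith

theorem bdryKernel_zero_left (hb : b ≠ 0) (y : Bdry m) : bdryKernel a b κ ρ 0 y = 0 := by
  simp [bdryKernel, Real.zero_rpow hb]

theorem bdryKernel_zero_right (ha : a ≠ 0) (z : Bdry m) : bdryKernel a b κ ρ z 0 = 0 := by
  simp [bdryKernel, Real.zero_rpow ha]

theorem weightedKernel_zero_left (hb : b ≠ 0) (y : Bdry m) : weightedKernel a b κ ρ θ 0 y = 0 := by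
  simp [weightedKernel, bdryKernel_zero_left hb]

theorem weightedKernel_zero_right (ha : a ≠ 0) (z : Bdry m) :
    weightedKernel a b κ ρ θ z 0 = 0 := by
  simp [weightedKernel, bdryKernel_zero_right ha]

@[fun_prop]
theorem measurable_bdryKernel : Measurable (fun w : Bdry m × Bdry m => bdryKernel a b κ ρ w.1 w.2) := by
  unfold bdryKernel; fun_prop

@[fun_prop]
theorem measurable_weightedKernel :
    Measurable (fun w : Bdry m × Bdry m => weightedKernel a b κ ρ θ w.1 w.2) := by
  unfold weightedKernel; fun_prop

theorem measurable_weightedKernel_right (z : Bdry m) :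
    Measurable (fun y : Bdry m => weightedKernel a b κ ρ θ z y) := by
  unfold weightedKernel bdryKernel; fun_prop

theorem measurable_bdryKernel_right (z : Bdry m) :
    Measurable (fun y : Bdry m => bdryKernel a b κ ρ z y) := by
  unfold bdryKernel; fun_prop

/-- For |y| ≤ |z|/2 both |z-y| and the maximum are comparable to |z|, so homogeneity leaves only a
power of r = |y|/|z|: the kernel gives r^a and the weight costs at most r^(-θ). Since r ≤ 1, any
smaller exponent c is allowed, so that one c can serve near 0 and near infinity. -/
theorem weightedKernel_le_of_norm_le_half (hρ : 0 ≤ ρ) (hθ : 0 ≤ θ)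
    (hab : a + b = κ + ρ) {c : ℝ} (hc : c ≤ a - θ) {z y : Bdry m} (hz : z ≠ 0) (hy : y ≠ 0)
    (hyz : ‖y‖ ≤ ‖z‖ / 2) :
    weightedKernel a b κ ρ θ z y ≤ 3 * 2 ^ ρ * (‖y‖ / ‖z‖) ^ c := by
  have hA : 0 < ‖z‖ := norm_pos_iff.2 hz
  have hB : 0 < ‖y‖ := norm_pos_iff.2 hy
  have hD : ‖z‖ / 2 ≤ ‖z - y‖ := by have := norm_sub_norm_le z y; linarith
  have hD0 : 0 < ‖z - y‖ := by linarith
  set r := ‖y‖ / ‖z‖ with hr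
  have hr0 : 0 < r := by positivity
  have hr1 : r ≤ 1 := by rw [hr, div_le_one hA]; linarith
  have hyr : ‖y‖ = r * ‖z‖ := by rw [hr]; field_simp
  have h1 : bdryKernel a b κ ρ z y ≤ 2 ^ ρ * r ^ a := by
    unfold bdryKernel
    rw [max_eq_left (by linarith), div_le_iff₀ (by positivity)]
    have h2 : (‖z‖ / 2) ^ ρ ≤ ‖z - y‖ ^ ρ := Real.rpow_le_rpow (by positivity) hD hρ
    calc ‖z‖ ^ b * ‖y‖ ^ a = r ^ a * (‖z‖ ^ κ * ‖z‖ ^ ρ) := by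
          rw [← Real.rpow_add hA, ← hab, Real.rpow_add hA, hyr, Real.mul_rpow hr0.le hA.le]; ring
      _ = 2 ^ ρ * r ^ a * (‖z‖ ^ κ * (‖z‖ / 2) ^ ρ) := by
          rw [Real.div_rpow hA.le two_pos.le]; field_simp
      _ ≤ _ := by gcongr
  have h3 : 1 + (‖z‖ / ‖y‖) ^ θ + r ^ θ ≤ 3 * r ^ (-θ) := by
    have e1 : ‖z‖ / ‖y‖ = r⁻¹ := by rw [hr, inv_div]
    have e2 : 1 ≤ r ^ (-θ) := Real.one_le_rpow_of_pos_of_le_one_of_nonpos hr0 hr1 (by linarith)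
    have e3 : r ^ θ ≤ 1 := Real.rpow_le_one hr0.le hr1 hθ
    rw [e1, Real.inv_rpow hr0.le, ← Real.rpow_neg hr0.le]
    linarith
  calc weightedKernel a b κ ρ θ z y ≤ 2 ^ ρ * r ^ a * (3 * r ^ (-θ)) := by
        unfold weightedKernel; gcongr
    _ = 3 * 2 ^ ρ * r ^ (a - θ) := by rw [sub_eq_add_neg, Real.rpow_add hr0]; ring
    _ ≤ _ := by
        gcongr 3 * 2 ^ ρ * ?_
        exact Real.rpow_le_rpow_of_exponent_ge hr0 hr1 hc

/-- When |y| and |z| are comparable the weight is bounded, and the singularity on the diagonal is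
all that is left. -/
theorem weightedKernel_le_of_comparable (ha : 0 ≤ a) (hκ : 0 ≤ κ) (hθ : 0 ≤ θ)
    (hab : a + b = κ + ρ) {z y : Bdry m} (hz : z ≠ 0) (hy : y ≠ 0) (h1 : ‖z‖ / 2 ≤ ‖y‖)
    (h2 : ‖y‖ ≤ 2 * ‖z‖) :
    weightedKernel a b κ ρ θ z y ≤ 3 * 2 ^ (a + θ) * (‖z‖ ^ ρ * ‖z - y‖ ^ (-ρ)) := by
  have hA : 0 < ‖z‖ := norm_pos_iff.2 hz
  have hB : 0 < ‖y‖ := norm_pos_iff.2 hy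
  have h3 : bdryKernel a b κ ρ z y ≤ 2 ^ a * (‖z‖ ^ ρ * ‖z - y‖ ^ (-ρ)) := by
    unfold bdryKernel
    rw [Real.rpow_neg (norm_nonneg _), ← div_div, div_eq_mul_inv _ (‖z - y‖ ^ ρ), ← mul_assoc]
    gcongr
    rw [div_le_iff₀ (by positivity)]
    calc ‖z‖ ^ b * ‖y‖ ^ a ≤ ‖z‖ ^ b * (2 * ‖z‖) ^ a := by gcongr
      _ = 2 ^ a * (‖z‖ ^ ρ * ‖z‖ ^ κ) := by
          rw [← Real.rpow_add hA, add_comm ρ, ← hab, Real.rpow_add hA,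
            Real.mul_rpow two_pos.le hA.le]; ring
      _ ≤ _ := by
          rw [← mul_assoc]
          gcongr
          exact le_max_left _ _
  have h4 : (‖z‖ / ‖y‖) ^ θ ≤ 2 ^ θ :=
    Real.rpow_le_rpow (by positivity) (by rw [div_le_iff₀ hB]; linarith) hθ
  have h5 : (‖y‖ / ‖z‖) ^ θ ≤ 2 ^ θ :=
    Real.rpow_le_rpow (by positivity) (by rw [div_le_iff₀ hA]; linarith) hθ
  have h6 : (1 : ℝ) ≤ 2 ^ θ := Real.one_le_rpow one_le_two hθ
  calc weightedKernel a b κ ρ θ z y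
      ≤ 2 ^ a * (‖z‖ ^ ρ * ‖z - y‖ ^ (-ρ)) * (3 * 2 ^ θ) := by
        unfold weightedKernel
        gcongr
        linarith
    _ = _ := by rw [Real.rpow_add two_pos]; ring

theorem norm_rpow_mul_weightedKernel_rpow_le_near_zero (hρ : 0 ≤ ρ) (hθ : 0 ≤ θ)
    (hab : a + b = κ + ρ) {c t d : ℝ} (hc : c ≤ a - θ) (ht : 0 ≤ t) {z y : Bdry m} (hz : z ≠ 0)
    (hy : y ≠ 0) (hyz : ‖y‖ ≤ ‖z‖ / 2) :
    ‖y‖ ^ (-d) * weightedKernel a b κ ρ θ z y ^ t ≤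
      (3 * 2 ^ ρ) ^ t * ‖z‖ ^ (-(c * t)) * ‖y‖ ^ (-(d - c * t)) := by
  have hA : 0 < ‖z‖ := norm_pos_iff.2 hz
  have hB : 0 < ‖y‖ := norm_pos_iff.2 hy
  have := Real.rpow_le_rpow (weightedKernel_nonneg z y)
    (weightedKernel_le_of_norm_le_half hρ hθ hab hc hz hy hyz) ht
  calc ‖y‖ ^ (-d) * weightedKernel a b κ ρ θ z y ^ t
      ≤ ‖y‖ ^ (-d) * (3 * 2 ^ ρ * (‖y‖ / ‖z‖) ^ c) ^ t := by gcongr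
    _ = (3 * 2 ^ ρ) ^ t * ‖z‖ ^ (-(c * t)) * (‖y‖ ^ (-d) * ‖y‖ ^ (c * t)) := by
      rw [Real.mul_rpow (by positivity) (by positivity), ← Real.rpow_mul (by positivity),
        Real.div_rpow hB.le hA.le, Real.rpow_neg hA.le]
      ring
    _ = _ := by rw [← Real.rpow_add hB]; congr 2; ring

theorem norm_rpow_mul_weightedKernel_rpow_le_near_infty (hρ : 0 ≤ ρ) (hθ : 0 ≤ θ)
    (hab : a + b = κ + ρ) {c t d : ℝ} (hc : c ≤ b - θ) (ht : 0 ≤ t) {z y : Bdry m} (hz : z ≠ 0)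
    (hy : y ≠ 0) (hyz : 2 * ‖z‖ ≤ ‖y‖) :
    ‖y‖ ^ (-d) * weightedKernel a b κ ρ θ z y ^ t ≤
      (3 * 2 ^ ρ) ^ t * ‖z‖ ^ (c * t) * ‖y‖ ^ (-(d + c * t)) := by
  have hA : 0 < ‖z‖ := norm_pos_iff.2 hz
  have hB : 0 < ‖y‖ := norm_pos_iff.2 hy
  have := Real.rpow_le_rpow (weightedKernel_nonneg z y) ((weightedKernel_swap z y).le.trans
    (weightedKernel_le_of_norm_le_half (a := b) (b := a) (κ := κ) hρ hθ (by linarith) hc hy hz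
      (by linarith))) ht
  calc ‖y‖ ^ (-d) * weightedKernel a b κ ρ θ z y ^ t
      ≤ ‖y‖ ^ (-d) * (3 * 2 ^ ρ * (‖z‖ / ‖y‖) ^ c) ^ t := by gcongr
    _ = (3 * 2 ^ ρ) ^ t * ‖z‖ ^ (c * t) * (‖y‖ ^ (-d) * ‖y‖ ^ (-(c * t))) := by
      rw [Real.mul_rpow (by positivity) (by positivity), ← Real.rpow_mul (by positivity),
        Real.div_rpow hA.le hB.le, Real.rpow_neg hB.le (c * t)]
      ring
    _ = _ := by rw [← Real.rpow_add hB]; congr 2; ring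

theorem norm_rpow_mul_weightedKernel_rpow_le_comparable (ha : 0 ≤ a) (hκ : 0 ≤ κ) (hθ : 0 ≤ θ)
    (hab : a + b = κ + ρ) {t d : ℝ} (ht : 0 ≤ t) (hd : 0 ≤ d) {z y : Bdry m} (hz : z ≠ 0)
    (hy : y ≠ 0) (h1 : ‖z‖ / 2 ≤ ‖y‖) (h2 : ‖y‖ ≤ 2 * ‖z‖) :
    ‖y‖ ^ (-d) * weightedKernel a b κ ρ θ z y ^ t ≤
      (3 * 2 ^ (a + θ)) ^ t * 2 ^ d * ‖z‖ ^ (ρ * t - d) * ‖z - y‖ ^ (-(ρ * t)) := by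
  have hA : 0 < ‖z‖ := norm_pos_iff.2 hz
  have := Real.rpow_le_rpow (weightedKernel_nonneg z y)
    (weightedKernel_le_of_comparable ha hκ hθ hab hz hy h1 h2) ht
  have hBm : ‖y‖ ^ (-d) ≤ (‖z‖ / 2) ^ (-d) :=
    Real.rpow_le_rpow_of_nonpos (by positivity) h1 (by linarith)
  have hK0 := weightedKernel_nonneg (a := a) (b := b) (κ := κ) (ρ := ρ) (θ := θ) z y
  calc ‖y‖ ^ (-d) * weightedKernel a b κ ρ θ z y ^ t
      ≤ (‖z‖ / 2) ^ (-d) * (3 * 2 ^ (a + θ) * (‖z‖ ^ ρ * ‖z - y‖ ^ (-ρ))) ^ t := by gcongr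
    _ = (3 * 2 ^ (a + θ)) ^ t * 2 ^ d * (‖z‖ ^ (ρ * t) * ‖z‖ ^ (-d)) * ‖z - y‖ ^ (-(ρ * t)) := by
      rw [Real.mul_rpow (x := 3 * 2 ^ (a + θ)) (by positivity) (by positivity),
        Real.mul_rpow (x := ‖z‖ ^ ρ) (by positivity) (by positivity),
        ← Real.rpow_mul (by positivity),
        ← Real.rpow_mul (by positivity), Real.div_rpow hA.le two_pos.le,
        Real.rpow_neg two_pos.le, neg_mul, div_inv_eq_mul]
      ring
    _ = _ := by rw [← Real.rpow_add hA, ← sub_eq_add_neg (ρ * t)]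

/-- On |y| ≤ |z|/2, |y| ~ |z| and |y| > 2|z| the integrand is dominated by multiples of
|y|^(-(m-ct)), |z-y|^(-ρt) and |y|^(-(m+ct)). These are integrable on the respective ranges because
ct > 0 and ρt < m, and by homogeneity of degree 0 all powers of |z| cancel, so the bound is uniform
in z. -/
theorem exists_lintegral_weightedKernel_rpow_le (hm : 0 < m) (ha : 0 < a) (hb : 0 < b)
    (hκ : 0 ≤ κ) (hρ : 0 ≤ ρ) (hθ : 0 ≤ θ) (hab : a + b = κ + ρ) (hθa : θ < a) (hθb : θ < b)
    {t : ℝ} (ht : 0 < t) (hρt : ρ * t < m) :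
    ∃ C : ENNReal, C ≠ ⊤ ∧ ∀ z : Bdry m,
      ∫⁻ y, ENNReal.ofReal (weightedKernel a b κ ρ θ z y) ^ t ∂conicMeasure m ≤ C := by
  have hne : Nonempty (Fin m) := ⟨⟨0, hm⟩⟩
  obtain ⟨c, hc0, hca, hcb⟩ : ∃ c : ℝ, 0 < c ∧ c ≤ a - θ ∧ c ≤ b - θ :=
    ⟨min (a - θ) (b - θ), lt_min (by linarith) (by linarith), min_le_left _ _, min_le_right _ _⟩
  have hct : 0 < c * t := mul_pos hc0 ht
  have hfr : (Module.finrank ℝ (Bdry m) : ℝ) = m := by simp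
  obtain ⟨C1, hC1, h1⟩ := exists_setLIntegral_ball_norm_rpow_le (volume : Measure (Bdry m))
    (s := m - c * t) (by rw [hfr]; linarith)
  obtain ⟨C2, hC2, h2⟩ := exists_setLIntegral_norm_ge_norm_rpow_le (volume : Measure (Bdry m))
    (s := m + c * t) (by rw [hfr]; linarith)
  obtain ⟨C3, hC3, h3⟩ := exists_setLIntegral_ball_norm_rpow_le (volume : Measure (Bdry m))
    (s := ρ * t) (by rw [hfr]; linarith)
  rw [hfr] at h1 h2 h3
  obtain ⟨k1, hk1⟩ : ∃ k : ℝ, k = (3 * 2 ^ ρ) ^ t := ⟨_, rfl⟩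
  obtain ⟨k3, hk3⟩ : ∃ k : ℝ, k = (3 * 2 ^ (a + θ)) ^ t * 2 ^ (m : ℝ) := ⟨_, rfl⟩
  have hk1' : 0 ≤ k1 := by rw [hk1]; positivity
  have hk3' : 0 ≤ k3 := by rw [hk3]; positivity
  refine ⟨ENNReal.ofReal k1 * C1 + ENNReal.ofReal k1 * C2 +
    ENNReal.ofReal (k3 * 4 ^ ((m : ℝ) - ρ * t)) * C3, by finiteness, fun z => ?_⟩
  rcases eq_or_ne z 0 with rfl | hz
  -- With b ≠ 0 the factor 0^b vanishes, so z = 0 needs no estimate.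
  · simp [weightedKernel_zero_left hb.ne', ENNReal.zero_rpow_of_pos ht]
  have hA : 0 < ‖z‖ := norm_pos_iff.2 hz
  have hmK : Measurable fun y => ENNReal.ofReal (weightedKernel a b κ ρ θ z y) :=
    (measurable_weightedKernel_right z).ennreal_ofReal
  rw [lintegral_conicMeasure (hmK.pow_const t)]
  have hmB : MeasurableSet {y : Bdry m | ‖y‖ < ‖z‖} :=
    measurableSet_lt measurable_norm measurable_const
  have hmC : MeasurableSet {y : Bdry m | ‖z‖ ≤ ‖y‖} :=
    measurableSet_le measurable_const measurable_norm
  have hmD : MeasurableSet {y : Bdry m | ‖y‖ < 4 * ‖z‖} :=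
    measurableSet_lt measurable_norm measurable_const
  set F1 : Bdry m → ENNReal := {y : Bdry m | ‖y‖ < ‖z‖}.indicator
    fun y => ENNReal.ofReal (‖y‖ ^ (-((m : ℝ) - c * t))) with hF1
  set F2 : Bdry m → ENNReal := {y : Bdry m | ‖z‖ ≤ ‖y‖}.indicator
    fun y => ENNReal.ofReal (‖y‖ ^ (-((m : ℝ) + c * t))) with hF2
  set F3 : Bdry m → ENNReal := {y : Bdry m | ‖y‖ < 4 * ‖z‖}.indicator
    fun y => ENNReal.ofReal (‖y‖ ^ (-(ρ * t))) with hF3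
  have hF1m : Measurable F1 := Measurable.indicator (by fun_prop) hmB
  have hF2m : Measurable F2 := Measurable.indicator (by fun_prop) hmC
  have hF3m : Measurable F3 := Measurable.indicator (by fun_prop) hmD
  have hpt : ∀ y : Bdry m, ENNReal.ofReal (‖y‖ ^ (-(m : ℝ))) *
      ENNReal.ofReal (weightedKernel a b κ ρ θ z y) ^ t ≤
      ENNReal.ofReal (k1 * ‖z‖ ^ (-(c * t))) * F1 y +
      ENNReal.ofReal (k1 * ‖z‖ ^ (c * t)) * F2 y +
      ENNReal.ofReal (k3 * ‖z‖ ^ (ρ * t - m)) * F3 (z - y) := by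
    intro y
    rcases eq_or_ne y 0 with rfl | hy
    · simp [weightedKernel_zero_right ha.ne', ENNReal.zero_rpow_of_pos ht]
    have hB : 0 < ‖y‖ := norm_pos_iff.2 hy
    have hK0 := weightedKernel_nonneg (a := a) (b := b) (κ := κ) (ρ := ρ) (θ := θ) z y
    rw [ENNReal.ofReal_rpow_of_nonneg hK0 ht.le, ← ENNReal.ofReal_mul (by positivity)]
    rcases le_or_gt ‖y‖ (‖z‖ / 2) with h | h
    · refine le_add_right (le_add_right ?_)
      rw [hF1, Set.indicator_of_mem (show y ∈ {y : Bdry m | ‖y‖ < ‖z‖} by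
        simp only [Set.mem_ofPred_eq]; linarith), ← ENNReal.ofReal_mul (by positivity)]
      apply ENNReal.ofReal_le_ofReal
      rw [hk1]
      exact norm_rpow_mul_weightedKernel_rpow_le_near_zero hρ hθ hab hca ht.le hz hy h
    rcases le_or_gt ‖y‖ (2 * ‖z‖) with h' | h'
    · refine le_add_left ?_
      have hD : ‖z - y‖ < 4 * ‖z‖ := by have := norm_sub_le z y; linarith
      rw [hF3, Set.indicator_of_mem (show z - y ∈ {y : Bdry m | ‖y‖ < 4 * ‖z‖} from hD),
        ← ENNReal.ofReal_mul (by positivity)]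
      apply ENNReal.ofReal_le_ofReal
      rw [hk3]
      exact norm_rpow_mul_weightedKernel_rpow_le_comparable ha.le hκ hθ hab ht.le
        (Nat.cast_nonneg m) hz hy h.le h'
    · refine le_add_right (le_add_left ?_)
      rw [hF2, Set.indicator_of_mem (show y ∈ {y : Bdry m | ‖z‖ ≤ ‖y‖} by
        simp only [Set.mem_ofPred_eq]; linarith), ← ENNReal.ofReal_mul (by positivity)]
      apply ENNReal.ofReal_le_ofReal
      rw [hk1]
      exact norm_rpow_mul_weightedKernel_rpow_le_near_infty hρ hθ hab hcb ht.le hz hy h'.le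
  have hkey : ∀ (s r : ℝ) (k : ℝ) (C : ENNReal), 0 ≤ k → r + s = 0 →
      ENNReal.ofReal (k * ‖z‖ ^ s) * (C * ENNReal.ofReal (‖z‖ ^ r)) = ENNReal.ofReal k * C := by
    intro s r k C hk hrs
    rw [ENNReal.ofReal_mul hk]
    calc _ = ENNReal.ofReal k * C * (ENNReal.ofReal (‖z‖ ^ r) * ENNReal.ofReal (‖z‖ ^ s)) := by
          ring
      _ = _ := by
        rw [← ENNReal.ofReal_mul (by positivity), ← Real.rpow_add hA, hrs]; simp
  refine (lintegral_mono hpt).trans ?_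
  rw [lintegral_add_left (by fun_prop), lintegral_add_left (by fun_prop),
    lintegral_const_mul _ hF1m, lintegral_const_mul _ hF2m,
    lintegral_const_mul _ (by fun_prop), lintegral_sub_left_eq_self F3 z]
  gcongr ?_ + ?_ + ?_
  · rw [lintegral_indicator hmB]
    refine (mul_le_mul_right (h1 ‖z‖ hA) _).trans (hkey _ _ _ _ hk1' (by ring)).le
  · rw [lintegral_indicator hmC]
    refine (mul_le_mul_right (h2 ‖z‖ hA) _).trans (hkey _ _ _ _ hk1' (by ring)).le
  · rw [lintegral_indicator hmD]
    refine (mul_le_mul_right (h3 (4 * ‖z‖) (by positivity)) _).trans ?_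
    rw [Real.mul_rpow (by norm_num) hA.le,
      ENNReal.ofReal_mul (p := 4 ^ ((m : ℝ) - ρ * t)) (by positivity)]
    refine le_of_eq ?_
    calc _ = ENNReal.ofReal (k3 * ‖z‖ ^ (ρ * t - m)) *
          (C3 * ENNReal.ofReal (‖z‖ ^ ((m : ℝ) - ρ * t))) *
            ENNReal.ofReal (4 ^ ((m : ℝ) - ρ * t)) := by ring
      _ = _ := by
        rw [hkey _ _ _ _ hk3' (by ring), ENNReal.ofReal_mul hk3']
        ring

end Kernel

/-! ### Norms and operator bounds for the invariant measure. -/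

noncomputable section

/-- The `L^p` size of a nonnegative function with respect to `conicMeasure`. -/
def conicNorm {m : ℕ} (f : Bdry m → ENNReal) (p : ℝ) : ENNReal :=
  (∫⁻ y, f y ^ p ∂conicMeasure m) ^ (1 / p)

/-- The weight `|y|^(-θ)`, truncated to be constant for `|y| ≥ 1` and for `|y| ≤ ε`. -/
def truncWeight {m : ℕ} (θ ε : ℝ) (y : Bdry m) : ℝ := (max ε (min 1 ‖y‖)) ^ (-θ)

end

section ConicNorm

variable {m : ℕ}

theorem conicNorm_mono {f g : Bdry m → ENNReal} {p : ℝ} (hp : 0 ≤ p) (h : ∀ y, f y ≤ g y) :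
    conicNorm f p ≤ conicNorm g p :=
  ENNReal.rpow_le_rpow (lintegral_mono fun y => ENNReal.rpow_le_rpow (h y) hp) (by positivity)

theorem conicNorm_const_mul {f : Bdry m → ENNReal} {p : ℝ} (hp : 0 < p) {C : ENNReal}
    (hC : C ≠ ⊤) : conicNorm (fun y => C * f y) p = C * conicNorm f p := by
  unfold conicNorm
  simp_rw [ENNReal.mul_rpow_of_nonneg _ _ hp.le]
  rw [lintegral_const_mul' _ _ (ENNReal.rpow_ne_top_of_nonneg hp.le hC),
    ENNReal.mul_rpow_of_nonneg _ _ (by positivity), ← ENNReal.rpow_mul, mul_one_div_cancel hp.ne',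
    ENNReal.rpow_one]

theorem conicNorm_rpow {f : Bdry m → ENNReal} {p q : ℝ} (hq : 0 < q) :
    conicNorm (fun y => f y ^ q) (p / q) = conicNorm f p ^ q := by
  unfold conicNorm
  simp_rw [← ENNReal.rpow_mul]
  rw [mul_div_cancel₀ _ hq.ne']
  congr 1
  field_simp

theorem conicNorm_ne_top {f : Bdry m → ENNReal} {p : ℝ} (hp : 0 < p) :
    conicNorm f p ≠ ⊤ ↔ ∫⁻ y, f y ^ p ∂conicMeasure m ≠ ⊤ := by
  unfold conicNorm
  rw [Ne, ENNReal.rpow_eq_top_iff_of_pos (by positivity)]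

/-- Young's inequality with 1/t = 1 - 1/r + 1/p; the strict bound on ρ is precisely ρt < m, which
makes the t-th moments finite in either variable. -/
theorem exists_conicNorm_kernel_le (hm : 0 < m) {a b κ ρ θ : ℝ} (ha : 0 < a) (hb : 0 < b)
    (hκ : 0 ≤ κ) (hρ : 0 ≤ ρ) (hθ : 0 ≤ θ) (hab : a + b = κ + ρ) (hθa : θ < a) (hθb : θ < b)
    {p r : ℝ} (hr : 1 < r) (hrp : r ≤ p) (hρm : ρ < m * (1 - 1 / r + 1 / p)) :
    ∃ C : ENNReal, C ≠ ⊤ ∧ ∀ f : Bdry m → ENNReal, Measurable f →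
      conicNorm (fun z => ∫⁻ y, ENNReal.ofReal (weightedKernel a b κ ρ θ z y) * f y
        ∂conicMeasure m) p ≤ C * conicNorm f r := by
  have hp : 0 < p := by linarith
  have hr1 : 1 / r < 1 := by rw [div_lt_one (by linarith)]; exact hr
  have hp1 : 0 < 1 / p := by positivity
  set w := 1 - 1 / r + 1 / p with hw
  have hw0 : 0 < w := by linarith
  have ht : 0 < 1 / w := by positivity
  have hρt : ρ * (1 / w) < m := by rw [mul_one_div, div_lt_iff₀ hw0]; exact hρm
  obtain ⟨C1, hC1, h1⟩ := exists_lintegral_weightedKernel_rpow_le hm ha hb hκ hρ hθ hab hθa hθb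
    ht hρt
  obtain ⟨C2, hC2, h2⟩ := exists_lintegral_weightedKernel_rpow_le (a := b) (b := a) hm hb ha hκ hρ
    hθ (by linarith) hθb hθa ht hρt
  refine ⟨max C1 C2 ^ (1 / (1 / w)), ENNReal.rpow_ne_top_of_nonneg (by positivity)
    (max_lt hC1.lt_top hC2.lt_top).ne, fun f hf => ?_⟩
  refine lintegral_kernel_rpow_le (t := 1 / w) (by
    exact measurable_weightedKernel.ennreal_ofReal) hf hr hrp
    (one_div_mul_cancel hw0.ne') (fun z => (h1 z).trans (le_max_left _ _)) (fun y => ?_)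
  simp_rw [weightedKernel_swap _ y]
  exact (h2 y).trans (le_max_right _ _)

/-- This is the source of smallness in the contraction. Balls about 0 have infinite `conicMeasure`,
so the density |y|^(-m) is moved into the integrand and absolute continuity is used with respect to
Lebesgue measure. -/
theorem tendsto_setLIntegral_conicMeasure_zero (hm : 0 < m) {f : Bdry m → ENNReal}
    (hf : Measurable f) (hfin : ∫⁻ y, f y ∂conicMeasure m ≠ ⊤) :
    Tendsto (fun δ : ℝ => ∫⁻ y in {y : Bdry m | ‖y‖ < δ}, f y ∂conicMeasure m) (𝓝[>] 0) (𝓝 0) := by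
  have hne : Nonempty (Fin m) := ⟨⟨0, hm⟩⟩
  have hms : ∀ R : ℝ, MeasurableSet {x : Bdry m | ‖x‖ < R} := fun R =>
    measurableSet_lt measurable_norm measurable_const
  have h1 : ∀ δ : ℝ, ∫⁻ y in {y : Bdry m | ‖y‖ < δ}, f y ∂conicMeasure m =
      ∫⁻ y in {y : Bdry m | ‖y‖ < δ}, ENNReal.ofReal (‖y‖ ^ (-(m : ℝ))) * f y := by
    intro δ
    rw [← lintegral_indicator (hms δ), lintegral_conicMeasure (hf.indicator (hms δ)),
      ← lintegral_indicator (hms δ)]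
    refine lintegral_congr fun y => ?_
    by_cases hy : ‖y‖ < δ <;> simp [hy]
  simp_rw [h1]
  rw [lintegral_conicMeasure hf] at hfin
  refine tendsto_setLIntegral_zero hfin ?_
  have h2 : ∀ δ : ℝ, {y : Bdry m | ‖y‖ < δ} = Metric.ball 0 δ := fun δ => by ext; simp
  have h3 : Tendsto (fun δ : ℝ => ENNReal.ofReal (δ ^ m) * volume (Metric.ball (0 : Bdry m) 1))
      (𝓝[>] 0) (𝓝 0) := by
    have : Tendsto (fun δ : ℝ => δ ^ m) (𝓝[>] 0) (𝓝 (0 ^ m)) :=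
      ((continuous_pow m).tendsto 0).mono_left nhdsWithin_le_nhds
    rw [zero_pow hm.ne'] at this
    have h4 := ENNReal.Tendsto.mul_const (b := volume (Metric.ball (0 : Bdry m) 1))
      (ENNReal.tendsto_ofReal this) (Or.inr measure_ball_lt_top.ne)
    simpa using h4
  refine h3.congr' ?_
  filter_upwards [self_mem_nhdsWithin] with δ (hδ : 0 < δ)
  rw [Function.comp_apply, h2, Measure.addHaar_ball _ _ hδ.le]
  simp

end ConicNorm

/-! ### The truncated weight and its passage through the kernel. -/

section Weight

variable {m : ℕ} {θ ε : ℝ}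

theorem truncWeight_nonneg (hε : 0 ≤ ε) (y : Bdry m) : 0 ≤ truncWeight θ ε y := by
  unfold truncWeight
  exact Real.rpow_nonneg (le_max_of_le_left hε) _

@[fun_prop]
theorem measurable_truncWeight : Measurable (truncWeight (m := m) θ ε) := by
  unfold truncWeight; fun_prop

theorem truncWeight_le (hε : 0 < ε) (hθ : 0 ≤ θ) (y : Bdry m) : truncWeight θ ε y ≤ ε ^ (-θ) :=
  Real.rpow_le_rpow_of_nonpos hε (le_max_left _ _) (by linarith)

theorem truncWeight_le_of_le (hθ : 0 ≤ θ) {δ : ℝ} (hδ : 0 < δ) (hδ1 : δ ≤ 1) {y : Bdry m}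
    (hy : δ ≤ ‖y‖) : truncWeight θ ε y ≤ δ ^ (-θ) :=
  Real.rpow_le_rpow_of_nonpos hδ (le_max_of_le_right (le_min hδ1 hy)) (by linarith)

theorem truncWeight_zero_of_norm_le_one {y : Bdry m} (hy : ‖y‖ ≤ 1) :
    truncWeight θ 0 y = ‖y‖ ^ (-θ) := by
  unfold truncWeight
  rw [min_eq_right hy, max_eq_right (norm_nonneg y)]

theorem truncWeight_eq_of_le {y : Bdry m} (hε1 : ε ≤ 1) (hy : ε ≤ ‖y‖) :
    truncWeight θ ε y = truncWeight θ 0 y := by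
  unfold truncWeight
  rw [max_eq_right (le_min hε1 hy), max_eq_right (le_min zero_le_one (norm_nonneg y))]

theorem one_le_truncWeight (hθ : 0 ≤ θ) {y : Bdry m} (hy : y ≠ 0) : 1 ≤ truncWeight θ 0 y := by
  have : 0 < ‖y‖ := norm_pos_iff.2 hy
  unfold truncWeight
  refine Real.one_le_rpow_of_pos_of_le_one_of_nonpos ?_ ?_ (by linarith)
  · exact lt_max_of_lt_right (lt_min one_pos this)
  · exact max_le zero_le_one (min_le_left _ _)

/-- Truncation can only reduce the ratio of two weights. The bound is uniform in ε, which is what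
permits the later limit ε → 0. -/
theorem truncWeight_le_mul (hθ : 0 ≤ θ) {y z : Bdry m} (hy : y ≠ 0) (hz : z ≠ 0) :
    truncWeight θ ε y ≤ (1 + (‖z‖ / ‖y‖) ^ θ) * truncWeight θ ε z := by
  have hA : 0 < ‖z‖ := norm_pos_iff.2 hz
  have hB : 0 < ‖y‖ := norm_pos_iff.2 hy
  have hNz : 0 < max ε (min 1 ‖z‖) := lt_max_of_lt_right (lt_min one_pos hA)
  have hNy : 0 < max ε (min 1 ‖y‖) := lt_max_of_lt_right (lt_min one_pos hB)
  have hM1 : 1 ≤ max 1 (‖z‖ / ‖y‖) := le_max_left _ _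
  have hN : max ε (min 1 ‖z‖) ≤ max ε (min 1 ‖y‖) * max 1 (‖z‖ / ‖y‖) := by
    refine max_le ?_ ?_
    · exact (le_max_left ε _).trans (le_mul_of_one_le_right hNy.le hM1)
    · refine le_trans ?_ (mul_le_mul_of_nonneg_right (le_max_right ε _) (by positivity))
      rcases le_total 1 ‖y‖ with h | h
      · rw [min_eq_left h, one_mul]; exact (min_le_left _ _).trans hM1
      · rw [min_eq_right h]
        calc min 1 ‖z‖ ≤ ‖y‖ * (‖z‖ / ‖y‖) := by
              rw [mul_div_cancel₀ _ hB.ne']; exact min_le_right _ _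
          _ ≤ _ := by gcongr; exact le_max_right _ _
  have h1 : (max ε (min 1 ‖y‖) * max 1 (‖z‖ / ‖y‖)) ^ (-θ) ≤ max ε (min 1 ‖z‖) ^ (-θ) :=
    Real.rpow_le_rpow_of_nonpos hNz hN (by linarith)
  rw [Real.mul_rpow hNy.le (by positivity)] at h1
  have h2 : max 1 (‖z‖ / ‖y‖) ^ θ ≤ 1 + (‖z‖ / ‖y‖) ^ θ := by
    have : 0 ≤ (‖z‖ / ‖y‖) ^ θ := by positivity
    rcases max_choice 1 (‖z‖ / ‖y‖) with h | h <;> rw [h]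
    · rw [Real.one_rpow]; linarith
    · linarith
  have hM0 : 0 < max 1 (‖z‖ / ‖y‖) := by positivity
  unfold truncWeight
  calc max ε (min 1 ‖y‖) ^ (-θ)
      = max 1 (‖z‖ / ‖y‖) ^ θ * (max ε (min 1 ‖y‖) ^ (-θ) * max 1 (‖z‖ / ‖y‖) ^ (-θ)) := by
        rw [mul_comm (max ε (min 1 ‖y‖) ^ (-θ)), ← mul_assoc, ← Real.rpow_add hM0]; simp
    _ ≤ _ := by gcongr

/-- Only one of the two ratios in `weightedKernel` is needed; the other keeps that kernel symmetric
under exchange of its arguments together with a and b. -/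
theorem truncWeight_mul_bdryKernel_le {a b κ ρ : ℝ} (ha : a ≠ 0) (hb : b ≠ 0) (hθ : 0 ≤ θ)
    (hε : 0 ≤ ε) (y z : Bdry m) :
    truncWeight θ ε y * bdryKernel a b κ ρ z y ≤
      weightedKernel a b κ ρ θ z y * truncWeight θ ε z := by
  rcases eq_or_ne z 0 with rfl | hz
  · rw [bdryKernel_zero_left hb, weightedKernel_zero_left hb]; simp
  rcases eq_or_ne y 0 with rfl | hy
  · rw [bdryKernel_zero_right ha, weightedKernel_zero_right ha]; simp
  have h0 : 0 ≤ (‖y‖ / ‖z‖) ^ θ := by positivity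
  have h1 := bdryKernel_nonneg (a := a) (b := b) (κ := κ) (ρ := ρ) z y
  have h2 := truncWeight_nonneg (θ := θ) hε z
  calc truncWeight θ ε y * bdryKernel a b κ ρ z y
      ≤ (1 + (‖z‖ / ‖y‖) ^ θ) * truncWeight θ ε z * bdryKernel a b κ ρ z y := by
        gcongr; exact truncWeight_le_mul hθ hy hz
    _ ≤ (1 + (‖z‖ / ‖y‖) ^ θ + (‖y‖ / ‖z‖) ^ θ) * truncWeight θ ε z * bdryKernel a b κ ρ z y := by
        exact mul_le_mul_of_nonneg_right (mul_le_mul_of_nonneg_right (by linarith) h2) h1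
    _ = _ := by unfold weightedKernel; ring

/-- A bound for a function by a kernel operator persists under multiplication by the weight. -/
theorem truncWeight_mul_le_lintegral {a b κ ρ : ℝ} (ha : a ≠ 0) (hb : b ≠ 0) (hθ : 0 ≤ θ)
    (hε : 0 ≤ ε) {C : ENNReal} {g G : Bdry m → ENNReal} {p : ℝ} (z : Bdry m)
    (h : G z ≤ C * ∫⁻ y, ENNReal.ofReal (bdryKernel a b κ ρ z y) * g y ^ p ∂conicMeasure m) :
    ENNReal.ofReal (truncWeight θ ε z) * G z ≤
      C * ∫⁻ y, ENNReal.ofReal (weightedKernel a b κ ρ θ z y) *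
        (ENNReal.ofReal (truncWeight θ ε y) * g y ^ p) ∂conicMeasure m := by
  calc _ ≤ ENNReal.ofReal (truncWeight θ ε z) *
        (C * ∫⁻ y, ENNReal.ofReal (bdryKernel a b κ ρ z y) * g y ^ p ∂conicMeasure m) := by gcongr
    _ = C * ∫⁻ y, ENNReal.ofReal (truncWeight θ ε z) *
        (ENNReal.ofReal (bdryKernel a b κ ρ z y) * g y ^ p) ∂conicMeasure m := by
      rw [lintegral_const_mul' _ _ ENNReal.ofReal_ne_top]; ring
    _ ≤ _ := by
      gcongr C * ?_
      refine lintegral_mono fun y => ?_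
      rw [← mul_assoc, ← mul_assoc, ← ENNReal.ofReal_mul (truncWeight_nonneg hε z),
        ← ENNReal.ofReal_mul (weightedKernel_nonneg z y)]
      gcongr ENNReal.ofReal ?_ * _
      rw [bdryKernel_swap, weightedKernel_swap]
      exact truncWeight_mul_bdryKernel_le hb ha hθ hε z y

/-- The weight is attached to one factor of g^p only. Inside the ball of radius δ, Hölder's
inequality separates the remaining g^(p-1), whose norm is small with δ; outside it the weight is at
most δ^(-θ). -/
theorem conicNorm_truncWeight_mul_rpow_le (hθ : 0 ≤ θ) {g : Bdry m → ENNReal}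
    (hg : Measurable g) {p P δ : ℝ} (hp : 1 < p) (hP : p ≤ P) (hδ : 0 < δ) (hδ1 : δ ≤ 1) :
    conicNorm (fun y => ENNReal.ofReal (truncWeight θ ε y) * g y ^ p) (P / p) ≤
      (∫⁻ y in {y : Bdry m | ‖y‖ < δ}, g y ^ P ∂conicMeasure m) ^ ((p - 1) / P) *
        conicNorm (fun y => ENNReal.ofReal (truncWeight θ ε y) * g y) P +
      ENNReal.ofReal (δ ^ (-θ)) * conicNorm g P ^ p := by
  have hp0 : 0 < p := by linarith
  have hP0 : 0 < P := by linarith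
  have hms : MeasurableSet {x : Bdry m | ‖x‖ < δ} := measurableSet_lt measurable_norm measurable_const
  have hwm : Measurable fun y : Bdry m => ENNReal.ofReal (truncWeight θ ε y) := by fun_prop
  have hin : ∫⁻ y in {y : Bdry m | ‖y‖ < δ},
      (ENNReal.ofReal (truncWeight θ ε y) * g y ^ p) ^ (P / p) ∂conicMeasure m ≤
      (∫⁻ y, (ENNReal.ofReal (truncWeight θ ε y) * g y) ^ P ∂conicMeasure m) ^ (1 / p) *
      (∫⁻ y in {y : Bdry m | ‖y‖ < δ}, g y ^ P ∂conicMeasure m) ^ (1 - 1 / p) := by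
    have h1p : 1 / p ≤ 1 := by rw [div_le_one hp0]; exact hp.le
    calc _ = ∫⁻ y in {y : Bdry m | ‖y‖ < δ},
          ((ENNReal.ofReal (truncWeight θ ε y) * g y) ^ P) ^ (1 / p) * (g y ^ P) ^ (1 - 1 / p)
            ∂conicMeasure m := by
          refine lintegral_congr fun y => ?_
          rw [ENNReal.mul_rpow_of_nonneg _ _ hP0.le, ENNReal.mul_rpow_of_nonneg _ _ (by positivity),
            ENNReal.mul_rpow_of_nonneg _ _ (by positivity), ← ENNReal.rpow_mul, ← ENNReal.rpow_mul,
            ← ENNReal.rpow_mul, ← ENNReal.rpow_mul, mul_assoc, ← ENNReal.rpow_add_of_nonneg _ _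
              (by positivity) (mul_nonneg hP0.le (by linarith))]
          congr 2
          · ring
          · field_simp; ring
      _ ≤ _ := ENNReal.lintegral_mul_norm_pow_le (by fun_prop) (by fun_prop) (by positivity)
          (by linarith) (by ring)
      _ ≤ _ := by gcongr; exact Measure.restrict_le_self
  have hout : ∫⁻ y in {y : Bdry m | ‖y‖ < δ}ᶜ,
      (ENNReal.ofReal (truncWeight θ ε y) * g y ^ p) ^ (P / p) ∂conicMeasure m ≤
      ENNReal.ofReal (δ ^ (-θ)) ^ (P / p) * ∫⁻ y, g y ^ P ∂conicMeasure m := by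
    rw [← lintegral_const_mul _ (hg.pow_const P)]
    refine (setLIntegral_mono' hms.compl fun y hy => ?_).trans (setLIntegral_le_lintegral _ _)
    have hy : δ ≤ ‖y‖ := not_lt.1 hy
    rw [ENNReal.mul_rpow_of_nonneg _ _ (by positivity), ← ENNReal.rpow_mul,
      mul_div_cancel₀ _ hp0.ne']
    gcongr
    exact truncWeight_le_of_le hθ hδ hδ1 hy
  have hpP : 1 / (P / p) = p / P := by field_simp
  unfold conicNorm
  rw [← lintegral_add_compl _ hms, hpP]
  calc _ ≤ ((∫⁻ y, (ENNReal.ofReal (truncWeight θ ε y) * g y) ^ P ∂conicMeasure m) ^ (1 / p) *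
      (∫⁻ y in {y : Bdry m | ‖y‖ < δ}, g y ^ P ∂conicMeasure m) ^ (1 - 1 / p) +
      ENNReal.ofReal (δ ^ (-θ)) ^ (P / p) * ∫⁻ y, g y ^ P ∂conicMeasure m) ^ (p / P) := by gcongr
    _ ≤ _ := ENNReal.rpow_add_le_add_rpow _ _ (by positivity) (by rw [div_le_one hP0]; exact hP)
    _ = _ := by
      rw [ENNReal.mul_rpow_of_nonneg _ _ (by positivity),
        ENNReal.mul_rpow_of_nonneg _ _ (by positivity), ← ENNReal.rpow_mul, ← ENNReal.rpow_mul,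
        ← ENNReal.rpow_mul, ← ENNReal.rpow_mul]
      have e1 : 1 / p * (p / P) = 1 / P := by field_simp
      have e2 : (1 - 1 / p) * (p / P) = (p - 1) / P := by field_simp
      have e3 : P / p * (p / P) = 1 := by field_simp
      have e4 : 1 / P * p = p / P := by ring
      rw [e1, e2, e3, e4, ENNReal.rpow_one, mul_comm (_ ^ (1 / P))]

end Weight

/-! ### Contraction and bootstrap for subcritical pairs. -/

section System

variable {m : ℕ} {a b κ ρ θ p₀ q₀ : ℝ}

/-- One half of the contraction: the weighted norm of `G` is bounded by a small multiple of the
weighted norm of `g`, when `G` is dominated by the kernel operator applied to `g ^ p`. -/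
theorem exists_conicNorm_truncWeight_le (hm : 0 < m) (ha : 0 < a) (hb : 0 < b)
    (hκ : 0 ≤ κ) (hρ : 0 ≤ ρ) (hθ : 0 ≤ θ) (hab : a + b = κ + ρ) (hθa : θ < a) (hθb : θ < b)
    {p P Q : ℝ} (hp : 1 < p) (hpP : p < P) (hPQ : P / p ≤ Q)
    (hρm : ρ < m * (1 - p / P + 1 / Q)) {C : ENNReal} (hC : C ≠ ⊤) {g G : Bdry m → ENNReal}
    (hg : Measurable g) (hgP : conicNorm g P ≠ ⊤)
    (h : ∀ z, G z ≤ C * ∫⁻ y, ENNReal.ofReal (bdryKernel a b κ ρ z y) * g y ^ p ∂conicMeasure m) :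
    conicNorm G Q ≠ ⊤ ∧ ∃ M : ENNReal, M ≠ ⊤ ∧ ∀ ε : ℝ, 0 ≤ ε →
      conicNorm (fun z => ENNReal.ofReal (truncWeight θ ε z) * G z) Q ≤
        conicNorm (fun y => ENNReal.ofReal (truncWeight θ ε y) * g y) P / 2 + M := by
  have hp0 : 0 < p := by linarith
  have hP0 : 0 < P := by linarith
  have hr : 1 < P / p := by rw [one_lt_div hp0]; exact hpP
  have hQ0 : 0 < Q := by linarith
  obtain ⟨C1, hC1, h1⟩ := exists_conicNorm_kernel_le hm ha hb hκ hρ hθ hab hθa hθb hr hPQ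
    (by rwa [one_div_div])
  have hCC : C * C1 ≠ ⊤ := ENNReal.mul_ne_top hC hC1
  constructor
  · have h2 : conicNorm G Q ≤ C * (C1 * conicNorm (fun y => g y ^ p) (P / p)) := by
      refine le_trans ?_ (mul_le_mul_right (h1 _ (hg.pow_const p)) C)
      rw [← conicNorm_const_mul hQ0 hC]
      refine conicNorm_mono hQ0.le fun z => (h z).trans ?_
      gcongr
      exact bdryKernel_le_weightedKernel _ _
    rw [conicNorm_rpow hp0] at h2
    refine ne_top_of_le_ne_top ?_ h2
    rw [← mul_assoc]
    exact ENNReal.mul_ne_top hCC (ENNReal.rpow_ne_top_of_nonneg hp0.le hgP)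
  · have hlim : Tendsto (fun δ : ℝ => C * C1 *
        (∫⁻ y in {y : Bdry m | ‖y‖ < δ}, g y ^ P ∂conicMeasure m) ^ ((p - 1) / P))
        (𝓝[>] 0) (𝓝 0) := by
      have h3 := tendsto_setLIntegral_conicMeasure_zero hm (hg.pow_const P)
        ((conicNorm_ne_top hP0).1 hgP)
      have he : 0 < (p - 1) / P := div_pos (by linarith) hP0
      have h4 := (ENNReal.continuous_rpow_const (y := (p - 1) / P)).tendsto 0 |>.comp h3
      rw [ENNReal.zero_rpow_of_pos he] at h4
      have h5 := ENNReal.Tendsto.const_mul (a := C * C1) h4 (Or.inr hCC)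
      rwa [mul_zero] at h5
    -- The radius δ is fixed so that the coefficient of the weighted norm drops below 1/2. The
    -- choice depends on g but not on ε.
    have hhalf : ∀ᶠ δ in 𝓝[>] (0 : ℝ), C * C1 *
        (∫⁻ y in {y : Bdry m | ‖y‖ < δ}, g y ^ P ∂conicMeasure m) ^ ((p - 1) / P) < 2⁻¹ :=
      hlim.eventually (gt_mem_nhds (by simp))
    have hle1 : ∀ᶠ δ in 𝓝[>] (0 : ℝ), δ ≤ 1 :=
      nhdsWithin_le_nhds (Iic_mem_nhds one_pos)
    obtain ⟨δ, ⟨hδ, hδ1⟩, hδ0 : 0 < δ⟩ := ((hhalf.and hle1).and self_mem_nhdsWithin).exists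
    refine ⟨C * C1 * (ENNReal.ofReal (δ ^ (-θ)) * conicNorm g P ^ p),
      ENNReal.mul_ne_top hCC (ENNReal.mul_ne_top ENNReal.ofReal_ne_top
        (ENNReal.rpow_ne_top_of_nonneg hp0.le hgP)), fun ε hε => ?_⟩
    have h6 : conicNorm (fun z => ENNReal.ofReal (truncWeight θ ε z) * G z) Q ≤
        C * (C1 * conicNorm (fun y => ENNReal.ofReal (truncWeight θ ε y) * g y ^ p) (P / p)) := by
      refine le_trans ?_ (mul_le_mul_right (h1 _ (by fun_prop)) C)
      rw [← conicNorm_const_mul hQ0 hC]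
      exact conicNorm_mono hQ0.le fun z =>
        truncWeight_mul_le_lintegral ha.ne' hb.ne' hθ hε z (h z)
    refine h6.trans ?_
    rw [← mul_assoc]
    refine (mul_le_mul_right
      (conicNorm_truncWeight_mul_rpow_le hθ hg hp hpP.le hδ0 hδ1) _).trans ?_
    rw [mul_add, ← mul_assoc]
    gcongr
    rw [ENNReal.div_eq_inv_mul]
    gcongr

/-- Absorption requires x to be finite beforehand, which is the reason for truncating the weight at
ε > 0. -/
theorem ENNReal.le_of_le_half_add {x y M N : ENNReal} (hx : x ≠ ⊤) (hxy : x ≤ y / 2 + M)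
    (hyx : y ≤ x / 2 + N) : x ≤ 2 * (N + M) := by
  have h1 : x ≤ x / 2 + (N + M) := by
    calc x ≤ (x / 2 + N) / 2 + M := hxy.trans (by gcongr)
      _ ≤ (x / 2 + N) + M := by gcongr; exact ENNReal.half_le_self
      _ = _ := by rw [add_assoc]
  have h2 : x / 2 + x / 2 ≤ x / 2 + (N + M) := by rwa [ENNReal.add_halves]
  have h3 := ENNReal.le_of_add_le_add_left (ENNReal.div_ne_top hx two_ne_zero) h2
  rwa [ENNReal.div_le_iff two_ne_zero ENNReal.ofNat_ne_top, mul_comm] at h3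

theorem conicNorm_truncWeight_ne_top (hθ : 0 ≤ θ) {ε : ℝ} (hε : 0 < ε) {g : Bdry m → ENNReal}
    {P : ℝ} (hP : 0 < P) (hg : conicNorm g P ≠ ⊤) :
    conicNorm (fun z => ENNReal.ofReal (truncWeight θ ε z) * g z) P ≠ ⊤ := by
  refine ne_top_of_le_ne_top (ENNReal.mul_ne_top (ENNReal.ofReal_ne_top (r := ε ^ (-θ))) hg) ?_
  rw [← conicNorm_const_mul hP ENNReal.ofReal_ne_top]
  refine conicNorm_mono hP.le fun z => ?_
  gcongr
  exact truncWeight_le hε hθ z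

theorem conicMeasure_singleton_zero (hm : 0 < m) : conicMeasure m {0} = 0 := by
  have hne : Nonempty (Fin m) := ⟨⟨0, hm⟩⟩
  exact conicMeasure_absolutelyContinuous m (measure_singleton 0)

theorem ae_conicMeasure_ne_zero (hm : 0 < m) : ∀ᵐ y ∂conicMeasure m, y ≠ 0 := by
  rw [ae_iff]
  simpa using conicMeasure_singleton_zero hm

/-- Fatou's lemma along ε = 1/(k+1): away from the origin the truncated weight is eventually equal
to the full one. -/
theorem conicNorm_truncWeight_zero_ne_top (hm : 0 < m) {g : Bdry m → ENNReal}
    (hg : Measurable g) {P : ℝ} (hP : 0 < P) {M : ENNReal} (hM : M ≠ ⊤)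
    (h : ∀ ε : ℝ, 0 < ε → conicNorm (fun z => ENNReal.ofReal (truncWeight θ ε z) * g z) P ≤ M) :
    conicNorm (fun z => ENNReal.ofReal (truncWeight θ 0 z) * g z) P ≠ ⊤ := by
  rw [conicNorm_ne_top hP]
  refine ne_top_of_le_ne_top (ENNReal.rpow_ne_top_of_nonneg hP.le hM) ?_
  have h1 : ∀ k : ℕ, ∫⁻ z, (ENNReal.ofReal (truncWeight θ (1 / ((k : ℝ) + 1)) z) * g z) ^ P
      ∂conicMeasure m ≤ M ^ P := by
    intro k
    have := ENNReal.rpow_le_rpow (h (1 / ((k : ℝ) + 1)) (by positivity)) hP.le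
    unfold conicNorm at this
    rwa [← ENNReal.rpow_mul, one_div_mul_cancel hP.ne', ENNReal.rpow_one] at this
  calc _ ≤ ∫⁻ z, liminf (fun k : ℕ =>
        (ENNReal.ofReal (truncWeight θ (1 / ((k : ℝ) + 1)) z) * g z) ^ P) atTop
          ∂conicMeasure m := by
        refine lintegral_mono_ae ?_
        filter_upwards [ae_conicMeasure_ne_zero hm] with z hz
        refine le_liminf_of_le (by isBoundedDefault) ?_
        have hlim := tendsto_one_div_add_atTop_nhds_zero_nat (𝕜 := ℝ)
        filter_upwards [hlim.eventually (gt_mem_nhds one_pos),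
          hlim.eventually (gt_mem_nhds (norm_pos_iff.2 hz))] with k hk1 hk2
        rw [truncWeight_eq_of_le hk1.le hk2.le]
    _ ≤ liminf (fun k : ℕ => ∫⁻ z, (ENNReal.ofReal (truncWeight θ (1 / ((k : ℝ) + 1)) z) * g z) ^ P
          ∂conicMeasure m) atTop := lintegral_liminf_le fun k => by fun_prop
    _ ≤ M ^ P := by
        refine liminf_le_of_le (by isBoundedDefault) fun c hc => ?_
        obtain ⟨k, hk⟩ := hc.exists
        exact hk.trans (h1 k)

/-- The gain of integrability of the weighted functions in one step of the bootstrap. -/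
theorem conicNorm_truncWeight_gain (hm : 0 < m) (ha : 0 < a) (hb : 0 < b)
    (hκ : 0 ≤ κ) (hρ : 0 ≤ ρ) (hθ : 0 ≤ θ) (hab : a + b = κ + ρ) (hθa : θ < a) (hθb : θ < b)
    {p P Q : ℝ} (hp : 1 < p) (hpP : p < P) (hPQ : P / p ≤ Q)
    (hρm : ρ < m * (1 - p / P + 1 / Q)) {C : ENNReal} (hC : C ≠ ⊤) {g G : Bdry m → ENNReal}
    (hg : Measurable g) (hgP : conicNorm (fun y => ENNReal.ofReal (truncWeight θ 0 y) * g y) P ≠ ⊤)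
    (h : ∀ z, G z ≤ C * ∫⁻ y, ENNReal.ofReal (bdryKernel a b κ ρ z y) * g y ^ p ∂conicMeasure m) :
    conicNorm (fun z => ENNReal.ofReal (truncWeight θ 0 z) * G z) Q ≠ ⊤ := by
  have hp0 : 0 < p := by linarith
  have hr : 1 < P / p := by rw [one_lt_div hp0]; exact hpP
  have hQ0 : 0 < Q := by linarith
  obtain ⟨C1, hC1, h1⟩ := exists_conicNorm_kernel_le hm ha hb hκ hρ hθ hab hθa hθb hr hPQ
    (by rwa [one_div_div])
  have h2 : conicNorm (fun z => ENNReal.ofReal (truncWeight θ 0 z) * G z) Q ≤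
      C * (C1 * conicNorm (fun y => (ENNReal.ofReal (truncWeight θ 0 y) * g y) ^ p) (P / p)) := by
    refine le_trans ?_ (mul_le_mul_right (h1 _ (by fun_prop)) C)
    rw [← conicNorm_const_mul hQ0 hC]
    refine conicNorm_mono hQ0.le fun z =>
      (truncWeight_mul_le_lintegral ha.ne' hb.ne' hθ le_rfl z (h z)).trans ?_
    gcongr C * ?_
    refine lintegral_mono fun y => ?_
    rcases eq_or_ne y 0 with rfl | hy
    · rw [weightedKernel_zero_right ha.ne']; simp
    · gcongr
      rw [ENNReal.mul_rpow_of_nonneg _ _ hp0.le]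
      -- The untruncated weight is at least 1, so it is bounded by its p-th power; this allows the
      -- weighted function itself to enter with power p.
      gcongr
      have h3 : 1 ≤ ENNReal.ofReal (truncWeight θ 0 y) := by
        rw [ENNReal.one_le_ofReal]; exact one_le_truncWeight hθ hy
      calc ENNReal.ofReal (truncWeight θ 0 y) = ENNReal.ofReal (truncWeight θ 0 y) ^ (1 : ℝ) := by
            rw [ENNReal.rpow_one]
        _ ≤ _ := ENNReal.rpow_le_rpow_of_exponent_le h3 hp.le
  rw [conicNorm_rpow hp0] at h2
  refine ne_top_of_le_ne_top ?_ h2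
  exact ENNReal.mul_ne_top hC (ENNReal.mul_ne_top hC1 (ENNReal.rpow_ne_top_of_nonneg hp0.le hgP))

/-- A pair of functions on the boundary, each dominated by a homogeneous kernel operator applied to
a power of the other, in the subcritical range of exponents. -/
structure IsSubcriticalPair (a b κ ρ p₀ q₀ : ℝ) (C : ENNReal) (Φ H : Bdry m → ENNReal) :
    Prop where
  dim_pos : 0 < m
  a_pos : 0 < a
  b_pos : 0 < b
  κ_nonneg : 0 ≤ κ
  ρ_nonneg : 0 ≤ ρ
  homogeneous : a + b = κ + ρ
  one_lt_p : 1 < p₀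
  one_lt_q : 1 < q₀
  ρ_lt : ρ < m / (p₀ + 1) + m / (q₀ + 1)
  C_ne_top : C ≠ ⊤
  measurable_fst : Measurable Φ
  measurable_snd : Measurable H
  norm_ne_top : conicNorm Φ (p₀ + 1) ≠ ⊤
  snd_le : ∀ z, H z ≤ C * ∫⁻ y, ENNReal.ofReal (bdryKernel a b κ ρ z y) * Φ y ^ p₀ ∂conicMeasure m
  fst_le : ∀ y, Φ y ≤ C * ∫⁻ z, ENNReal.ofReal (bdryKernel a b κ ρ z y) * H z ^ q₀ ∂conicMeasure m

namespace IsSubcriticalPair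

variable {C : ENNReal} {Φ H : Bdry m → ENNReal}

theorem snd_norm_ne_top (h : IsSubcriticalPair a b κ ρ p₀ q₀ C Φ H) :
    conicNorm H (q₀ + 1) ≠ ⊤ := by
  have hp := h.one_lt_p
  have hq := h.one_lt_q
  refine (exists_conicNorm_truncWeight_le (θ := 0) h.dim_pos h.a_pos h.b_pos h.κ_nonneg
    h.ρ_nonneg le_rfl h.homogeneous h.a_pos h.b_pos hp (lt_add_one p₀) (Q := q₀ + 1) ?_ ?_ h.C_ne_top
    h.measurable_fst h.norm_ne_top h.snd_le).1
  · rw [div_le_iff₀ (by linarith)]; nlinarith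
  · refine h.ρ_lt.trans_eq ?_
    field_simp; ring

theorem weighted_norm_ne_top (h : IsSubcriticalPair a b κ ρ p₀ q₀ C Φ H) (hθ : 0 ≤ θ)
    (hθa : θ < a) (hθb : θ < b) :
    conicNorm (fun y => ENNReal.ofReal (truncWeight θ 0 y) * Φ y) (p₀ + 1) ≠ ⊤ ∧
      conicNorm (fun y => ENNReal.ofReal (truncWeight θ 0 y) * H y) (q₀ + 1) ≠ ⊤ := by
  have hp := h.one_lt_p
  have hq := h.one_lt_q
  have hH := h.snd_norm_ne_top
  -- The two one-sided bounds, the second with a and b exchanged, have additive constants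
  -- independent of ε. Each is inserted into the other and absorbed.
  have h1 := (exists_conicNorm_truncWeight_le h.dim_pos h.a_pos h.b_pos h.κ_nonneg
    h.ρ_nonneg hθ h.homogeneous hθa hθb hp (lt_add_one p₀) (Q := q₀ + 1)
    (by rw [div_le_iff₀ (by linarith)]; nlinarith)
    (h.ρ_lt.trans_eq (by field_simp; ring)) h.C_ne_top h.measurable_fst h.norm_ne_top h.snd_le).2
  have h2 := (exists_conicNorm_truncWeight_le (a := b) (b := a) h.dim_pos h.b_pos h.a_pos h.κ_nonneg
    h.ρ_nonneg hθ (by linarith [h.homogeneous]) hθb hθa hq (lt_add_one q₀) (Q := p₀ + 1)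
    (by rw [div_le_iff₀ (by linarith)]; nlinarith)
    (h.ρ_lt.trans_eq (by field_simp; ring)) h.C_ne_top h.measurable_snd hH
    (fun y => (h.fst_le y).trans (by simp_rw [bdryKernel_swap _ y]; rfl))).2
  obtain ⟨M, hM, h3⟩ := h1
  obtain ⟨N, hN, h4⟩ := h2
  have hMN : 2 * (N + M) ≠ ⊤ := by finiteness
  have hNM : 2 * (M + N) ≠ ⊤ := by finiteness
  constructor
  · refine conicNorm_truncWeight_zero_ne_top h.dim_pos h.measurable_fst (by linarith) hNM
      fun ε hε => ?_
    exact ENNReal.le_of_le_half_add (conicNorm_truncWeight_ne_top hθ hε (by linarith) h.norm_ne_top)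
      (h4 ε hε.le) (h3 ε hε.le)
  · refine conicNorm_truncWeight_zero_ne_top h.dim_pos h.measurable_snd (by linarith) hMN
      fun ε hε => ?_
    exact ENNReal.le_of_le_half_add (conicNorm_truncWeight_ne_top hθ hε (by linarith) hH)
      (h3 ε hε.le) (h4 ε hε.le)

/-- The weighted functions belong to all spaces of higher integrability. -/
theorem weighted_norm_div_ne_top (h : IsSubcriticalPair a b κ ρ p₀ q₀ C Φ H) (hθ : 0 ≤ θ)
    (hθa : θ < a) (hθb : θ < b) {s : ℝ} (hs : 0 < s) (hs1 : s ≤ 1) :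
    conicNorm (fun y => ENNReal.ofReal (truncWeight θ 0 y) * Φ y) ((p₀ + 1) / s) ≠ ⊤ ∧
      conicNorm (fun y => ENNReal.ofReal (truncWeight θ 0 y) * H y) ((q₀ + 1) / s) ≠ ⊤ := by
  have hp := h.one_lt_p
  have hq := h.one_lt_q
  have hm : (0 : ℝ) < m := Nat.cast_pos.2 h.dim_pos
  set δ := (m : ℝ) / (p₀ + 1) + m / (q₀ + 1) - ρ with hδ
  have hδ0 : 0 < δ := by have := h.ρ_lt; linarith
  have hξ : (m : ℝ) / (p₀ + 1) < m / 2 := by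
    apply div_lt_div_of_pos_left hm two_pos; linarith
  have hη : (m : ℝ) / (q₀ + 1) < m / 2 := by
    apply div_lt_div_of_pos_left hm two_pos; linarith
  -- One step lowers s by at most c, so finitely many steps reach any s > 0. The loss in Young's
  -- condition is at most c·m/2 = δ/2, less than the subcritical margin δ.
  set c := δ / m with hc
  have hc0 : 0 < c := by positivity
  have hcm : c * m = δ := by rw [hc]; field_simp
  suffices H : ∀ k : ℕ, ∀ s : ℝ, 0 < s → s ≤ 1 → 1 - k * c ≤ s →
      conicNorm (fun y => ENNReal.ofReal (truncWeight θ 0 y) * Φ y) ((p₀ + 1) / s) ≠ ⊤ ∧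
      conicNorm (fun y => ENNReal.ofReal (truncWeight θ 0 y) * H y) ((q₀ + 1) / s) ≠ ⊤ by
    obtain ⟨k, hk⟩ := exists_nat_gt (1 / c)
    rw [div_lt_iff₀ hc0] at hk
    exact H k s hs hs1 (by linarith)
  intro k
  induction k with
  | zero =>
    intro s hs hs1 hsk
    have : s = 1 := by simp at hsk; linarith
    rw [this, div_one, div_one]
    exact h.weighted_norm_ne_top hθ hθa hθb
  | succ k ih =>
    intro s hs hs1 hsk
    push_cast at hsk
    obtain ⟨s', hs', hs'1, hss', hsc, hsk'⟩ : ∃ s' : ℝ, 0 < s' ∧ s' ≤ 1 ∧ s ≤ s' ∧ s' - s ≤ c ∧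
        1 - k * c ≤ s' := by
      refine ⟨min 1 (s + c), lt_min one_pos (by linarith), min_le_left _ _,
        le_min hs1 (by linarith), by linarith [min_le_right 1 (s + c)], le_min ?_ (by linarith)⟩
      have : (0 : ℝ) ≤ k * c := by positivity
      linarith
    obtain ⟨ihΦ, ihH⟩ := ih s' hs' hs'1 hsk'
    have key : ∀ P Q : ℝ, 1 < P → 1 < Q → ρ + δ = m / (P + 1) + m / (Q + 1) →
        ρ < m * (1 - P / ((P + 1) / s') + 1 / ((Q + 1) / s)) := by
      intro P Q hP hQ hPQ
      have hQ2 : (m : ℝ) / (Q + 1) < m / 2 := by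
        apply div_lt_div_of_pos_left hm two_pos; linarith
      have hP2 : (m : ℝ) / (P + 1) < m / 2 := by
        apply div_lt_div_of_pos_left hm two_pos; linarith
      have e : m * (1 - P / ((P + 1) / s') + 1 / ((Q + 1) / s)) =
          m * (1 - s') + s' * (ρ + δ) - (s' - s) * (m / (Q + 1)) := by
        rw [hPQ]; field_simp; ring
      have hQ0 : 0 < (m : ℝ) / (Q + 1) := by positivity
      have e2 : (s' - s) * (m / (Q + 1)) ≤ c * (m / 2) := by
        apply mul_le_mul hsc hQ2.le hQ0.le hc0.le
      -- Here ρ + δ = m/(P+1) + m/(Q+1) < m because P, Q > 1, so passing from exponent 1 to s' does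
      -- not reduce the margin.
      have e3 : 0 ≤ (1 - s') * (m - ρ - δ) := mul_nonneg (by linarith) (by linarith)
      rw [e]
      nlinarith
    constructor
    · refine conicNorm_truncWeight_gain (a := b) (b := a) h.dim_pos h.b_pos h.a_pos h.κ_nonneg
        h.ρ_nonneg hθ (by linarith [h.homogeneous]) hθb hθa hq ?_ ?_ (key q₀ p₀ hq hp (by rw [hδ]; ring))
        h.C_ne_top h.measurable_snd ihH
        (fun y => (h.fst_le y).trans (by simp_rw [bdryKernel_swap _ y]; rfl))
      · rw [lt_div_iff₀ hs']; nlinarith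
      · rw [div_div, div_le_div_iff₀ (by positivity) hs]
        have : s * q₀ ≤ s' * q₀ := by gcongr
        nlinarith [mul_pos hs' (by linarith : 0 < q₀ - 1), mul_pos hs' (by linarith : 0 < p₀ - 1),
          mul_pos (mul_pos hs' (by linarith : 0 < q₀)) (by linarith : 0 < p₀ - 1)]
    · refine conicNorm_truncWeight_gain h.dim_pos h.a_pos h.b_pos h.κ_nonneg
        h.ρ_nonneg hθ h.homogeneous hθa hθb hp ?_ ?_ (key p₀ q₀ hp hq (by rw [hδ]; ring))
        h.C_ne_top h.measurable_fst ihΦ h.snd_le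
      · rw [lt_div_iff₀ hs']; nlinarith
      · rw [div_div, div_le_div_iff₀ (by positivity) hs]
        have : s * p₀ ≤ s' * p₀ := by gcongr
        nlinarith [mul_pos hs' (by linarith : 0 < q₀ - 1), mul_pos hs' (by linarith : 0 < p₀ - 1),
          mul_pos (mul_pos hs' (by linarith : 0 < p₀)) (by linarith : 0 < q₀ - 1)]

end IsSubcriticalPair

end System

/-! ### Geometry of the half space and reduction to the boundary. -/

noncomputable section

/-- The inclusion `y ↦ (y, 0)` of the boundary into the ambient space. -/
def bdryEmb {m : ℕ} (y : Bdry m) : Amb m := WithLp.toLp 2 (Fin.snoc (fun i => y i) 0)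

/-- The boundary points `z` at distance less than `x_n` from the foot `x'` of `x` whose norm is
comparable to that of `x`. -/
def shadow {m : ℕ} (x : Amb m) : Set (Bdry m) :=
  {z | ‖z - tangential x‖ < lastCoord x ∧ ‖x‖ ≤ 4 * ‖z‖}

end

section Geometry

variable {m : ℕ}

theorem norm_sq_eq_tangential_add (x : Amb m) :
    ‖x‖ ^ 2 = ‖tangential x‖ ^ 2 + lastCoord x ^ 2 := by
  rw [EuclideanSpace.norm_sq_eq, EuclideanSpace.norm_sq_eq, Fin.sum_univ_castSucc]
  simp [tangential, lastCoord]

theorem tangential_sub_bdryEmb (x : Amb m) (y : Bdry m) :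
    tangential (x - bdryEmb y) = tangential x - y := by
  ext i
  simp [tangential, bdryEmb]

theorem lastCoord_sub_bdryEmb (x : Amb m) (y : Bdry m) :
    lastCoord (x - bdryEmb y) = lastCoord x := by
  simp [lastCoord, bdryEmb]

theorem norm_sub_bdryEmb_sq (x : Amb m) (y : Bdry m) :
    ‖x - bdryEmb y‖ ^ 2 = ‖tangential x - y‖ ^ 2 + lastCoord x ^ 2 := by
  rw [norm_sq_eq_tangential_add, tangential_sub_bdryEmb, lastCoord_sub_bdryEmb]

theorem bdryEmb_sub (y z : Bdry m) : bdryEmb y - bdryEmb z = bdryEmb (y - z) := by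
  ext i
  refine Fin.lastCases ?_ (fun i => ?_) i <;> simp [bdryEmb]

theorem norm_bdryEmb (y : Bdry m) : ‖bdryEmb y‖ = ‖y‖ := by
  have h := norm_sq_eq_tangential_add (bdryEmb y)
  have h1 : tangential (bdryEmb y) = y := by ext i; simp [tangential, bdryEmb]
  have h2 : lastCoord (bdryEmb y) = 0 := by simp [lastCoord, bdryEmb]
  rw [h1, h2] at h
  simpa using h

theorem bdryEmb_zero : bdryEmb (0 : Bdry m) = 0 := by
  rw [← norm_eq_zero, norm_bdryEmb, norm_zero]

@[fun_prop]
theorem continuous_bdryEmb : Continuous (bdryEmb (m := m)) := by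
  refine (Isometry.of_dist_eq fun y z => ?_).continuous
  rw [dist_eq_norm, dist_eq_norm, bdryEmb_sub, norm_bdryEmb]

@[fun_prop]
theorem continuous_tangential : Continuous (tangential (m := m)) := by
  unfold tangential; fun_prop

@[fun_prop]
theorem continuous_lastCoord : Continuous (lastCoord (m := m)) := by
  unfold lastCoord; fun_prop

@[fun_prop]
theorem measurable_bdryEmb : Measurable (bdryEmb (m := m)) := continuous_bdryEmb.measurable

@[fun_prop]
theorem measurable_tangential : Measurable (tangential (m := m)) := continuous_tangential.measurable

@[fun_prop]
theorem measurable_lastCoord : Measurable (lastCoord (m := m)) := continuous_lastCoord.measurable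

theorem measurableSet_halfSpace : MeasurableSet (halfSpace m) :=
  measurableSet_lt measurable_const measurable_lastCoord

theorem kernelP_eq (lam μ : ℝ) (x : Amb m) (y : Bdry m) :
    kernelP lam μ x y = lastCoord x ^ lam / ‖x - bdryEmb y‖ ^ μ := by
  unfold kernelP
  rw [← norm_sub_bdryEmb_sq, ← Real.rpow_natCast, ← Real.rpow_mul (norm_nonneg _)]
  congr 2
  push_cast; ring

theorem norm_tangential_le (x : Amb m) : ‖tangential x‖ ≤ ‖x‖ :=
  le_of_sq_le_sq (by rw [norm_sq_eq_tangential_add x]; nlinarith [sq_nonneg (lastCoord x)])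
    (norm_nonneg _)

theorem lastCoord_le_norm (x : Amb m) : lastCoord x ≤ ‖x‖ :=
  le_of_sq_le_sq (by rw [norm_sq_eq_tangential_add x]; nlinarith [sq_nonneg ‖tangential x‖])
    (norm_nonneg _)

theorem lastCoord_le_norm_sub (x : Amb m) (y : Bdry m) : lastCoord x ≤ ‖x - bdryEmb y‖ := by
  have := lastCoord_le_norm (x - bdryEmb y)
  rwa [lastCoord_sub_bdryEmb] at this

theorem norm_tangential_sub_le (x : Amb m) (y : Bdry m) :
    ‖tangential x - y‖ ≤ ‖x - bdryEmb y‖ := by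
  have := norm_tangential_le (x - bdryEmb y)
  rwa [tangential_sub_bdryEmb] at this

theorem norm_le_tangential_add {x : Amb m} (hx : x ∈ halfSpace m) :
    ‖x‖ ≤ ‖tangential x‖ + lastCoord x := by
  have hx : 0 < lastCoord x := hx
  refine le_of_sq_le_sq ?_ (by positivity)
  rw [norm_sq_eq_tangential_add x]
  nlinarith [norm_nonneg (tangential x)]

theorem norm_pos_of_mem_halfSpace {x : Amb m} (hx : x ∈ halfSpace m) : 0 < ‖x‖ :=
  lt_of_lt_of_le hx (lastCoord_le_norm x)

theorem norm_sub_bdryEmb_pos {x : Amb m} (hx : x ∈ halfSpace m) (y : Bdry m) :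
    0 < ‖x - bdryEmb y‖ := lt_of_lt_of_le hx (lastCoord_le_norm_sub x y)

theorem norm_le_of_mem_shadow {x : Amb m} {z : Bdry m} (hz : z ∈ shadow x) : ‖z‖ ≤ 2 * ‖x‖ := by
  have h1 := norm_sub_norm_le z (tangential x)
  have h2 := norm_tangential_le x
  have h3 := lastCoord_le_norm x
  have h4 := hz.1
  linarith

theorem norm_sub_le_of_mem_shadow {x : Amb m} {z : Bdry m} (hz : z ∈ shadow x) (y : Bdry m) :
    ‖z - y‖ ≤ 2 * ‖x - bdryEmb y‖ := by
  have h1 : ‖z - y‖ ≤ ‖z - tangential x‖ + ‖tangential x - y‖ := norm_sub_le_norm_sub_add_norm_sub _ _ _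
  have h2 := norm_tangential_sub_le x y
  have h3 := lastCoord_le_norm_sub x y
  have h4 := hz.1
  linarith

/-- The shadow contains the ball of radius x_n/4 centred at x' moved outward by x_n/2. The radial
shift keeps |z| ≥ |x'| + x_n/4 ≥ |x|/4 even when x' is close to 0. -/
theorem exists_mul_le_volume_shadow (hm : 0 < m) :
    ∃ c : ENNReal, c ≠ 0 ∧ c ≠ ⊤ ∧ ∀ x ∈ halfSpace m,
      ENNReal.ofReal (lastCoord x ^ (m : ℝ)) * c ≤ volume (shadow x) := by
  have hne : Nonempty (Fin m) := ⟨⟨0, hm⟩⟩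
  refine ⟨ENNReal.ofReal ((1 / 4) ^ (m : ℝ)) * volume (Metric.ball (0 : Bdry m) 1), ?_, ?_,
    fun x hx => ?_⟩
  · refine mul_ne_zero ?_ (Metric.measure_ball_pos _ _ one_pos).ne'
    simp only [ne_eq, ENNReal.ofReal_eq_zero, not_le]; positivity
  · exact ENNReal.mul_ne_top ENNReal.ofReal_ne_top measure_ball_lt_top.ne
  have hx0 : 0 < lastCoord x := hx
  obtain ⟨e, he, hec⟩ : ∃ e : Bdry m, ‖e‖ = 1 ∧
      ‖tangential x + (lastCoord x / 2) • e‖ = ‖tangential x‖ + lastCoord x / 2 := by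
    rcases eq_or_ne (tangential x) 0 with h | h
    · obtain ⟨e, he⟩ := exists_norm_eq (Bdry m) zero_le_one
      refine ⟨e, he, ?_⟩
      rw [h, zero_add, norm_smul, he, norm_zero, Real.norm_of_nonneg (by positivity)]; ring
    · have hn : 0 < ‖tangential x‖ := norm_pos_iff.2 h
      refine ⟨‖tangential x‖⁻¹ • tangential x, ?_, ?_⟩
      · rw [norm_smul, norm_inv, norm_norm, inv_mul_cancel₀ hn.ne']
      · have : tangential x + (lastCoord x / 2) • ‖tangential x‖⁻¹ • tangential x =
            (1 + lastCoord x / 2 * ‖tangential x‖⁻¹) • tangential x := by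
          rw [add_smul, one_smul, smul_smul]
        rw [this, norm_smul, Real.norm_of_nonneg (by positivity)]
        field_simp
  set c := tangential x + (lastCoord x / 2) • e with hc
  have hsub : Metric.ball c (lastCoord x / 4) ⊆ shadow x := by
    intro z hz
    rw [mem_ball_iff_norm] at hz
    have h1 : ‖c - tangential x‖ = lastCoord x / 2 := by
      rw [hc, add_sub_cancel_left, norm_smul, he, Real.norm_of_nonneg (by positivity), mul_one]
    constructor
    · have := norm_sub_le_norm_sub_add_norm_sub z c (tangential x)
      linarith
    · have h2 := norm_sub_norm_le c z
      rw [norm_sub_rev] at h2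
      have h3 := norm_le_tangential_add hx
      have := norm_nonneg (tangential x)
      linarith
  refine le_trans (le_of_eq ?_) (measure_mono hsub)
  rw [Measure.addHaar_ball _ c (by positivity), ← mul_assoc, ← ENNReal.ofReal_mul (by positivity),
    ← Real.mul_rpow hx0.le (by norm_num), Real.rpow_natCast]
  simp [div_eq_mul_inv]

theorem rpow_le_of_comparable {t D s : ℝ} (ht : 0 < t) (htD : t ≤ D) (hD : D ≤ 2 * t) :
    t ^ s ≤ 2 ^ |s| * D ^ s := by
  have hD0 : 0 < D := by linarith
  rcases le_total 0 s with h | h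
  · have h1 : t ^ s ≤ D ^ s := Real.rpow_le_rpow ht.le htD h
    have h2 : (1 : ℝ) ≤ 2 ^ |s| := Real.one_le_rpow one_le_two (abs_nonneg s)
    have h3 : 0 ≤ D ^ s := by positivity
    nlinarith
  · have h1 : t ^ s ≤ (D / 2) ^ s := Real.rpow_le_rpow_of_nonpos (by positivity) (by linarith) h
    rwa [Real.div_rpow hD0.le two_pos.le, div_eq_inv_mul, ← Real.rpow_neg two_pos.le,
      ← abs_of_nonpos h] at h1

/-- On the shadow x_n ≤ |x-z| ≤ 2x_n and |x| ≥ |z|/2, so x_n may be replaced by |x-z|. The resulting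
power |x-z|^(-(m-s)) is locally integrable in dimension m+1 because s > -1. -/
theorem shadow_density_le {s : ℝ} (hs : -1 < s) {x : Amb m} (hx : x ∈ halfSpace m) {z : Bdry m}
    (hz : z ∈ shadow x) :
    ‖x‖ ^ (-((m : ℝ) + 1)) * (lastCoord x ^ (-(m : ℝ)) * (lastCoord x / ‖x‖) ^ s) ≤
      2 ^ ((m : ℝ) + 1 + s) * 2 ^ |s - m| * ‖z‖ ^ (-((m : ℝ) + 1 + s)) *
        ‖x - bdryEmb z‖ ^ (-((m : ℝ) - s)) := by
  have hx0 : 0 < lastCoord x := hx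
  have hX := norm_pos_of_mem_halfSpace hx
  have hz0 : 0 < ‖z‖ := by have := hz.2; linarith
  have hD : ‖x - bdryEmb z‖ ≤ 2 * lastCoord x := by
    refine le_of_sq_le_sq ?_ (by positivity)
    have h := hz.1
    rw [norm_sub_rev] at h
    rw [norm_sub_bdryEmb_sq]
    nlinarith [norm_nonneg (tangential x - z)]
  have h1 := rpow_le_of_comparable (s := s - m) hx0 (lastCoord_le_norm_sub x z) hD
  have hn : 0 < (m : ℝ) + 1 + s := by have : (0 : ℝ) ≤ m := Nat.cast_nonneg m; linarith
  have h2 : ‖x‖ ^ (-((m : ℝ) + 1 + s)) ≤ (‖z‖ / 2) ^ (-((m : ℝ) + 1 + s)) :=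
    Real.rpow_le_rpow_of_nonpos (by positivity) (by linarith [norm_le_of_mem_shadow hz])
      (by linarith)
  have h3 : (‖z‖ / 2) ^ (-((m : ℝ) + 1 + s)) =
      2 ^ ((m : ℝ) + 1 + s) * ‖z‖ ^ (-((m : ℝ) + 1 + s)) := by
    rw [Real.div_rpow hz0.le two_pos.le, Real.rpow_neg two_pos.le, div_inv_eq_mul, mul_comm]
  calc _ = ‖x‖ ^ (-((m : ℝ) + 1 + s)) * lastCoord x ^ (s - m) := by
        rw [Real.div_rpow hx0.le hX.le, neg_add _ s, Real.rpow_add hX, sub_eq_add_neg s,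
          Real.rpow_add hx0, Real.rpow_neg hX.le s]
        ring
    _ ≤ (2 ^ ((m : ℝ) + 1 + s) * ‖z‖ ^ (-((m : ℝ) + 1 + s))) *
        (2 ^ |s - m| * ‖x - bdryEmb z‖ ^ (s - m)) := by
        rw [← h3]; gcongr
    _ = _ := by rw [neg_sub]; ring

theorem measurableSet_shadow_prod :
    MeasurableSet {w : Amb m × Bdry m | w.2 ∈ shadow w.1} := by
  have h1 : MeasurableSet {w : Amb m × Bdry m | ‖w.2 - tangential w.1‖ < lastCoord w.1} :=
    measurableSet_lt (by fun_prop) (by fun_prop)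
  have h2 : MeasurableSet {w : Amb m × Bdry m | ‖w.1‖ ≤ 4 * ‖w.2‖} :=
    measurableSet_le (by fun_prop) (by fun_prop)
  exact h1.inter h2

/-- Integrals over the half space are controlled by integrals over the boundary, if the integrand at
`x` is controlled by the boundary integrand on the shadow of `x`. -/
theorem exists_setLIntegral_halfSpace_le (hm : 0 < m) {s : ℝ} (hs : -1 < s) :
    ∃ C : ENNReal, C ≠ ⊤ ∧ ∀ (f : Amb m → ENNReal) (g : Bdry m → ENNReal), Measurable g →
      (∀ x ∈ halfSpace m, ∀ᵐ z, z ∈ shadow x →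
        f x ≤ ENNReal.ofReal ((lastCoord x / ‖x‖) ^ s) * g z) →
      ∫⁻ x in halfSpace m, ENNReal.ofReal (‖x‖ ^ (-((m : ℝ) + 1))) * f x ≤
        C * ∫⁻ z, g z ∂conicMeasure m := by
  obtain ⟨c, hc0, hct, hc⟩ := exists_mul_le_volume_shadow hm
  have hfr : (Module.finrank ℝ (Amb m) : ℝ) = m + 1 := by simp
  obtain ⟨C1, hC1, h1⟩ := exists_setLIntegral_ball_norm_rpow_le (volume : Measure (Amb m))
    (s := m - s) (by rw [hfr]; linarith)
  rw [hfr] at h1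
  obtain ⟨k, hk⟩ : ∃ k : ℝ, k = 2 ^ ((m : ℝ) + 1 + s) * 2 ^ |s - m| := ⟨_, rfl⟩
  have hk0 : 0 ≤ k := by rw [hk]; positivity
  set e : ℝ := (m : ℝ) + 1 - (m - s) with he
  refine ⟨c⁻¹ * (ENNReal.ofReal (k * 9 ^ e) * C1), by finiteness, fun f g hg hfg => ?_⟩
  -- The value at x is replaced by an average over its shadow; the factor x_n^(-m) is the inverse of
  -- the shadow's volume, up to a constant.
  set W : Amb m → ℝ := fun x => ‖x‖ ^ (-((m : ℝ) + 1)) *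
    (lastCoord x ^ (-(m : ℝ)) * (lastCoord x / ‖x‖) ^ s) with hW
  have hWm : Measurable W := by rw [hW]; fun_prop
  have hSx : ∀ x : Amb m, MeasurableSet (shadow x) := fun x =>
    measurable_prodMk_left measurableSet_shadow_prod
  have hf : ∀ x ∈ halfSpace m, ENNReal.ofReal (‖x‖ ^ (-((m : ℝ) + 1))) * f x ≤
      c⁻¹ * ∫⁻ z, ENNReal.ofReal (W x) * (shadow x).indicator g z := by
    intro x hx
    have hx0 : 0 < lastCoord x := hx
    have hX := norm_pos_of_mem_halfSpace hx
    have h2 : f x * volume (shadow x) ≤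
        ENNReal.ofReal ((lastCoord x / ‖x‖) ^ s) * ∫⁻ z, (shadow x).indicator g z := by
      rw [← setLIntegral_const, lintegral_indicator (hSx x), ← lintegral_const_mul _ hg]
      exact lintegral_mono_ae ((ae_restrict_iff' (hSx x)).2 (hfg x hx))
    have h3 : f x * (ENNReal.ofReal (lastCoord x ^ (m : ℝ)) * c) ≤
        ENNReal.ofReal ((lastCoord x / ‖x‖) ^ s) * ∫⁻ z, (shadow x).indicator g z :=
      (mul_le_mul_right (hc x hx) _).trans h2
    have h4 : ENNReal.ofReal (lastCoord x ^ (-(m : ℝ))) * ENNReal.ofReal (lastCoord x ^ (m : ℝ)) = 1 := by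
      rw [← ENNReal.ofReal_mul (by positivity), ← Real.rpow_add hx0]; simp
    have h5 : ENNReal.ofReal (W x) = ENNReal.ofReal (‖x‖ ^ (-((m : ℝ) + 1))) *
        (ENNReal.ofReal (lastCoord x ^ (-(m : ℝ))) *
          ENNReal.ofReal ((lastCoord x / ‖x‖) ^ s)) := by
      rw [← ENNReal.ofReal_mul (by positivity), ← ENNReal.ofReal_mul (by positivity)]
    rw [lintegral_const_mul _ (hg.indicator (hSx x)), h5]
    calc ENNReal.ofReal (‖x‖ ^ (-((m : ℝ) + 1))) * f x
        = ENNReal.ofReal (‖x‖ ^ (-((m : ℝ) + 1))) * ((ENNReal.ofReal (lastCoord x ^ (-(m : ℝ))) *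
          ENNReal.ofReal (lastCoord x ^ (m : ℝ))) * (c⁻¹ * c) * f x) := by
          rw [h4, ENNReal.inv_mul_cancel hc0 hct, one_mul, one_mul]
      _ = ENNReal.ofReal (‖x‖ ^ (-((m : ℝ) + 1))) * (ENNReal.ofReal (lastCoord x ^ (-(m : ℝ))) *
          (c⁻¹ * (f x * (ENNReal.ofReal (lastCoord x ^ (m : ℝ)) * c)))) := by ring
      _ ≤ ENNReal.ofReal (‖x‖ ^ (-((m : ℝ) + 1))) * (ENNReal.ofReal (lastCoord x ^ (-(m : ℝ))) *
          (c⁻¹ * (ENNReal.ofReal ((lastCoord x / ‖x‖) ^ s) *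
            ∫⁻ z, (shadow x).indicator g z))) := by gcongr
      _ = _ := by ring
  have hjoint : Measurable (Function.uncurry fun (x : Amb m) (z : Bdry m) =>
      ENNReal.ofReal (W x) * (shadow x).indicator g z) := by
    refine ((hWm.comp measurable_fst).ennreal_ofReal).mul ?_
    have : (fun w : Amb m × Bdry m => (shadow w.1).indicator g w.2) =
        {w : Amb m × Bdry m | w.2 ∈ shadow w.1}.indicator (fun w => g w.2) := by
      ext w
      by_cases h : w.2 ∈ shadow w.1 <;> simp [h]
    rw [this]
    exact (hg.comp measurable_snd).indicator measurableSet_shadow_prod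
  calc _ ≤ ∫⁻ x in halfSpace m, c⁻¹ * ∫⁻ z, ENNReal.ofReal (W x) * (shadow x).indicator g z :=
        setLIntegral_mono' measurableSet_halfSpace hf
    _ = c⁻¹ * ∫⁻ z, ∫⁻ x in halfSpace m, ENNReal.ofReal (W x) * (shadow x).indicator g z := by
        rw [lintegral_const_mul' _ _ (ENNReal.inv_ne_top.2 hc0),
          lintegral_lintegral_swap hjoint.aemeasurable]
    _ ≤ c⁻¹ * ∫⁻ z, (ENNReal.ofReal (k * 9 ^ e) * C1) *
          (ENNReal.ofReal (‖z‖ ^ (-(m : ℝ))) * g z) := by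
        gcongr c⁻¹ * ?_
        refine lintegral_mono fun z => ?_
        rcases eq_or_ne z 0 with rfl | hz
        · refine le_of_eq_of_le ?_ zero_le
          rw [← lintegral_indicator measurableSet_halfSpace]
          refine lintegral_eq_zero_of_ae_eq_zero (ae_of_all _ fun x => ?_)
          by_cases hx : x ∈ halfSpace m
          · rw [Set.indicator_of_mem hx, Set.indicator_of_notMem, mul_zero]; rfl
            intro h
            have h3 := h.2
            have := norm_pos_of_mem_halfSpace hx
            rw [norm_zero] at h3
            linarith
          · rw [Set.indicator_of_notMem hx]; rfl
        have hz0 : 0 < ‖z‖ := norm_pos_iff.2 hz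
        -- After Tonelli, z is fixed. If z lies in the shadow of x then |x-z| ≤ |x| + |z| ≤ 5|z|, so
        -- a ball of radius 9|z| about z suffices.
        have hmD : MeasurableSet {x : Amb m | ‖x‖ < 9 * ‖z‖} :=
          measurableSet_lt measurable_norm measurable_const
        set F : Amb m → ENNReal := {x : Amb m | ‖x‖ < 9 * ‖z‖}.indicator
          fun x => ENNReal.ofReal (‖x‖ ^ (-((m : ℝ) - s))) with hF
        have hFm : Measurable F := Measurable.indicator (by fun_prop) hmD
        calc ∫⁻ x in halfSpace m, ENNReal.ofReal (W x) * (shadow x).indicator g z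
            ≤ ∫⁻ x in halfSpace m, ENNReal.ofReal (k * ‖z‖ ^ (-((m : ℝ) + 1 + s))) * g z *
              F (x - bdryEmb z) := by
              refine setLIntegral_mono' measurableSet_halfSpace fun x hx => ?_
              by_cases hzx : z ∈ shadow x
              · rw [Set.indicator_of_mem hzx, hF, Set.indicator_of_mem, mul_right_comm,
                  ← ENNReal.ofReal_mul (by positivity)]
                · gcongr
                  rw [hk]
                  exact shadow_density_le hs hx hzx
                · have h5 := norm_sub_le x (bdryEmb z)
                  rw [norm_bdryEmb] at h5
                  have := hzx.2
                  simp only [Set.mem_ofPred_eq]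
                  linarith
              · rw [Set.indicator_of_notMem hzx, mul_zero]; exact zero_le
          _ ≤ ∫⁻ x, ENNReal.ofReal (k * ‖z‖ ^ (-((m : ℝ) + 1 + s))) * g z *
              F (x - bdryEmb z) := setLIntegral_le_lintegral _ _
          _ = ENNReal.ofReal (k * ‖z‖ ^ (-((m : ℝ) + 1 + s))) * g z * ∫⁻ x, F x := by
              rw [lintegral_const_mul (f := fun x => F (x - bdryEmb z)) _ (hFm.comp (by fun_prop)),
                lintegral_sub_right_eq_self F (bdryEmb z)]
          _ ≤ ENNReal.ofReal (k * ‖z‖ ^ (-((m : ℝ) + 1 + s))) * g z *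
              (C1 * ENNReal.ofReal ((9 * ‖z‖) ^ e)) := by
              rw [hF, lintegral_indicator hmD]
              gcongr
              exact h1 _ (by positivity)
          _ = _ := by
              rw [Real.mul_rpow (by norm_num) hz0.le, ENNReal.ofReal_mul hk0,
                ENNReal.ofReal_mul hk0, ENNReal.ofReal_mul (by positivity)]
              -- The ball integral contributes |z|^(1+s), which turns |z|^(-(m+1+s)) into the
              -- density of `conicMeasure`.
              have : ENNReal.ofReal (‖z‖ ^ (-(m : ℝ))) =
                  ENNReal.ofReal (‖z‖ ^ (-((m : ℝ) + 1 + s))) * ENNReal.ofReal (‖z‖ ^ e) := by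
                rw [← ENNReal.ofReal_mul (by positivity), ← Real.rpow_add hz0]
                congr 2
                rw [he]; ring
              rw [this]; ring
    _ = _ := by
        rw [lintegral_conicMeasure hg, lintegral_const_mul _ (by fun_prop)]
        ring

/-- For z in the shadow, |z-y| ≤ 2|x-y| handles the ρ part. For the κ part, τ = x_n/|x| satisfies τ
max(|z|,|y|) ≤ 4|x-y|, since τ|x| = x_n ≤ |x-y|. Thus the κ part loses its diagonal singularity and
is paid for in the normal direction. -/
theorem kernel_le_mul_bdryKernel {a b κ ρ : ℝ} (hb : 0 ≤ b) (hκ : 0 ≤ κ) (hρ : 0 ≤ ρ)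
    {x : Amb m} (hx : x ∈ halfSpace m) {y z : Bdry m} (hz : z ∈ shadow x) (hzy : z ≠ y) :
    ‖x‖ ^ b * ‖y‖ ^ a / ‖x - bdryEmb y‖ ^ (κ + ρ) ≤
      4 ^ b * 4 ^ κ * 2 ^ ρ * ((lastCoord x / ‖x‖) ^ (-κ) * bdryKernel a b κ ρ z y) := by
  have hx0 : 0 < lastCoord x := hx
  have hX := norm_pos_of_mem_halfSpace hx
  have hD := norm_sub_bdryEmb_pos hx y
  have hz0 : 0 < ‖z‖ := by have := hz.2; linarith
  have hzy0 : 0 < ‖z - y‖ := norm_pos_iff.2 (sub_ne_zero.2 hzy)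
  set τ := lastCoord x / ‖x‖ with hτ
  have hτ0 : 0 < τ := by positivity
  have hτ1 : τ ≤ 1 := by rw [hτ, div_le_one hX]; exact lastCoord_le_norm x
  have hxτ : lastCoord x = τ * ‖x‖ := by rw [hτ]; field_simp
  have hM : τ * max ‖z‖ ‖y‖ ≤ 4 * ‖x - bdryEmb y‖ := by
    have hxn := lastCoord_le_norm_sub x y
    have hsub := norm_sub_norm_le (bdryEmb y) x
    rw [norm_sub_rev, norm_bdryEmb] at hsub
    rw [mul_max_of_nonneg _ _ hτ0.le]
    refine max_le ?_ ?_
    · have := mul_le_mul_of_nonneg_left (norm_le_of_mem_shadow hz) hτ0.le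
      nlinarith
    · have h1 : τ * ‖y‖ ≤ τ * (‖x‖ + ‖x - bdryEmb y‖) := by gcongr; linarith
      have h2 : τ * ‖x - bdryEmb y‖ ≤ ‖x - bdryEmb y‖ := mul_le_of_le_one_left hD.le hτ1
      nlinarith
  have hM0 : 0 < max ‖z‖ ‖y‖ := lt_max_of_lt_left hz0
  have h1 : (τ * max ‖z‖ ‖y‖) ^ κ ≤ (4 * ‖x - bdryEmb y‖) ^ κ :=
    Real.rpow_le_rpow (by positivity) hM hκ
  have h2 : ‖z - y‖ ^ ρ ≤ (2 * ‖x - bdryEmb y‖) ^ ρ :=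
    Real.rpow_le_rpow hzy0.le (norm_sub_le_of_mem_shadow hz y) hρ
  have h3 : ‖x‖ ^ b ≤ (4 * ‖z‖) ^ b := Real.rpow_le_rpow hX.le hz.2 hb
  rw [Real.mul_rpow (by positivity) (by positivity)] at h1 h2 h3
  rw [Real.mul_rpow (by positivity) (by positivity)] at h1
  rw [Real.rpow_add hD, div_le_iff₀ (by positivity), Real.rpow_neg hτ0.le]
  unfold bdryKernel
  have h4 : ‖x‖ ^ b * (τ ^ κ * max ‖z‖ ‖y‖ ^ κ * ‖z - y‖ ^ ρ) ≤
      4 ^ b * ‖z‖ ^ b * ((4 ^ κ * ‖x - bdryEmb y‖ ^ κ) * (2 ^ ρ * ‖x - bdryEmb y‖ ^ ρ)) := by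
    gcongr
  have h5 : 0 < τ ^ κ * max ‖z‖ ‖y‖ ^ κ * ‖z - y‖ ^ ρ := by positivity
  rw [← le_div_iff₀ h5] at h4
  calc ‖x‖ ^ b * ‖y‖ ^ a ≤ _ := mul_le_mul_of_nonneg_right h4 (by positivity)
    _ = _ := by field_simp

end Geometry

/-! ### Limits of potentials. -/

section Potential

variable {X ι : Type*} [MeasurableSpace X] {ν : Measure X} {l : Filter ι}
  {f : X → ENNReal} {D : ι → X → ℝ} {N : X → ℝ} {μ : ℝ}

theorem tendsto_mul_ofReal_rpow_neg {c : ENNReal} {d : ι → ℝ} {r : ℝ} (hr : 0 < r)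
    (hd : Tendsto d l (𝓝 r)) :
    Tendsto (fun i => c * ENNReal.ofReal (d i ^ (-μ))) l (𝓝 (c * ENNReal.ofReal (r ^ (-μ)))) := by
  refine ENNReal.Tendsto.const_mul (ENNReal.tendsto_ofReal ?_) (Or.inl ?_)
  · exact hd.rpow_const (Or.inl hr.ne')
  · simp only [ne_eq, ENNReal.ofReal_eq_zero, not_le]; positivity

variable [l.IsCountablyGenerated]

theorem tendsto_lintegral_potential_top (hf : Measurable f) (hD : ∀ i, Measurable (D i))
    (hN : ∀ᵐ x ∂ν, 0 < N x) (hDN : ∀ᵐ x ∂ν, Tendsto (fun i => D i x) l (𝓝 (N x)))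
    (htop : ∫⁻ x, f x * ENNReal.ofReal (N x ^ (-μ)) ∂ν = ⊤) :
    Tendsto (fun i => ∫⁻ x, f x * ENNReal.ofReal (D i x ^ (-μ)) ∂ν) l (𝓝 ⊤) := by
  rcases l.eq_or_neBot with rfl | hl
  · exact tendsto_bot
  refine tendsto_of_le_liminf_of_limsup_le ?_ le_top
  rw [← htop]
  refine le_trans (lintegral_mono_ae ?_) (lintegral_liminf_le fun i => by have := hD i; fun_prop)
  filter_upwards [hN, hDN] with x hx hx'
  exact (tendsto_mul_ofReal_rpow_neg hx hx').liminf_eq.ge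

/-- Where D ≥ N/2 the integrand is at most 2^μ times the limit integrand. As D → N > 0, almost every
point eventually belongs to this region, so its contribution carries the whole limit. -/
theorem tendsto_lintegral_potential (hf : Measurable f) (hD : ∀ i, Measurable (D i))
    (hNm : Measurable N) (hμ : 0 ≤ μ) (hN : ∀ᵐ x ∂ν, 0 < N x)
    (hDN : ∀ᵐ x ∂ν, Tendsto (fun i => D i x) l (𝓝 (N x)))
    (hfin : ∫⁻ x, f x * ENNReal.ofReal (N x ^ (-μ)) ∂ν ≠ ⊤)
    (hnear : Tendsto (fun i => ∫⁻ x in {x | D i x < N x / 2},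
      f x * ENNReal.ofReal (D i x ^ (-μ)) ∂ν) l (𝓝 0)) :
    Tendsto (fun i => ∫⁻ x, f x * ENNReal.ofReal (D i x ^ (-μ)) ∂ν) l
      (𝓝 (∫⁻ x, f x * ENNReal.ofReal (N x ^ (-μ)) ∂ν)) := by
  have hms : ∀ i, MeasurableSet {x | D i x < N x / 2} := fun i =>
    measurableSet_lt (hD i) (hNm.div_const 2)
  have hmF : ∀ i, Measurable fun x => f x * ENNReal.ofReal (D i x ^ (-μ)) := fun i => by
    have := hD i; fun_prop
  have hfar : Tendsto (fun i => ∫⁻ x in {x | D i x < N x / 2}ᶜ,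
      f x * ENNReal.ofReal (D i x ^ (-μ)) ∂ν) l
      (𝓝 (∫⁻ x, f x * ENNReal.ofReal (N x ^ (-μ)) ∂ν)) := by
    simp_rw [← fun i => lintegral_indicator (μ := ν) (hms i).compl]
    refine tendsto_lintegral_filter_of_dominated_convergence
      (fun x => ENNReal.ofReal (2 ^ μ) * (f x * ENNReal.ofReal (N x ^ (-μ))))
      (Eventually.of_forall fun i => (hmF i).indicator (hms i).compl)
      (Eventually.of_forall fun i => ?_) ?_ ?_
    · filter_upwards [hN] with x hx
      by_cases h : D i x < N x / 2
      · rw [Set.indicator_of_notMem (by simpa using h)]; exact zero_le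
      · rw [Set.indicator_of_mem (by simpa using h), mul_left_comm,
          ← ENNReal.ofReal_mul (by positivity)]
        gcongr
        have h1 : D i x ^ (-μ) ≤ (N x / 2) ^ (-μ) :=
          Real.rpow_le_rpow_of_nonpos (by positivity) (not_lt.1 h) (by linarith)
        rw [Real.div_rpow hx.le two_pos.le, Real.rpow_neg two_pos.le, div_inv_eq_mul,
          mul_comm] at h1
        exact h1
    · rw [lintegral_const_mul' _ _ ENNReal.ofReal_ne_top]
      exact ENNReal.mul_ne_top ENNReal.ofReal_ne_top hfin
    · filter_upwards [hN, hDN] with x hx hx'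
      refine (tendsto_mul_ofReal_rpow_neg hx hx').congr' ?_
      filter_upwards [hx'.eventually (lt_mem_nhds (half_lt_self hx))] with i hi
      rw [Set.indicator_of_mem (by simpa using hi.le)]
  have := hnear.add hfar
  rw [zero_add] at this
  refine this.congr fun i => ?_
  exact lintegral_add_compl _ (hms i)

end Potential

/-! ### Divergence of power integrals at the origin. -/

section Divergence

theorem setLIntegral_ball_eq_top_of_scaling {E : Type*} [NormedAddCommGroup E] [NormedSpace ℝ E]
    [MeasurableSpace E] [BorelSpace E] [FiniteDimensional ℝ E] (μ : Measure E)
    [μ.IsAddHaarMeasure] {g : E → ENNReal} (hg : Measurable g)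
    (hscale : ∀ x : E, g ((2 : ℝ) • x) ≤ ENNReal.ofReal (2 ^ (-(Module.finrank ℝ E : ℝ))) * g x)
    {O : Set E} (hO : IsOpen O) (hne : O.Nonempty) (hsub : ∀ x ∈ O, 1 / 2 ≤ ‖x‖ ∧ ‖x‖ < 1)
    (hpos : ∀ x ∈ O, g x ≠ 0) : ∫⁻ x in {x : E | ‖x‖ < 1}, g x ∂μ = ⊤ := by
  by_contra hfin
  have h0 := setLIntegral_shell_eq_zero_of_scaling μ hscale hfin
  have h1 : ∫⁻ x in O, g x ∂μ = 0 :=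
    le_antisymm ((lintegral_mono_set hsub).trans h0.le) zero_le
  rw [setLIntegral_eq_zero_iff hO.measurableSet hg] at h1
  have h2 : μ O = 0 := by
    rw [← nonpos_iff_eq_zero]
    refine (measure_mono_null ?_ (ae_iff.1 h1)).le
    intro x hx
    simp only [Set.mem_ofPred_eq, Classical.not_imp]
    exact ⟨hx, hpos x hx⟩
  exact (hO.measure_pos μ hne).ne' h2

theorem setLIntegral_norm_rpow_eq_top {m : ℕ} (hm : 0 < m) {r : ℝ} (hr : m ≤ r) :
    ∫⁻ y in {y : Bdry m | ‖y‖ < 1}, ENNReal.ofReal (‖y‖ ^ (-r)) = ⊤ := by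
  have hne : Nonempty (Fin m) := ⟨⟨0, hm⟩⟩
  refine setLIntegral_ball_eq_top_of_scaling volume (by fun_prop) (fun x => ?_)
    (O := {y : Bdry m | 1 / 2 < ‖y‖ ∧ ‖y‖ < 1}) ?_ ?_ (fun x hx => ⟨hx.1.le, hx.2⟩) ?_
  · rw [ofReal_norm_smul_rpow two_pos]
    gcongr
    · exact one_le_two
    · simpa using hr
  · exact (isOpen_lt continuous_const continuous_norm).inter
      (isOpen_lt continuous_norm continuous_const)
  · obtain ⟨y, hy⟩ := exists_norm_eq (Bdry m) (show (0 : ℝ) ≤ 3 / 4 by norm_num)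
    exact ⟨y, by rw [Set.mem_ofPred_eq, hy]; norm_num⟩
  · intro x hx
    have : 0 < ‖x‖ := by linarith [hx.1]
    simp only [ne_eq, ENNReal.ofReal_eq_zero, not_le]; positivity

theorem lastCoord_smul {m : ℕ} (c : ℝ) (x : Amb m) : lastCoord (c • x) = c * lastCoord x := by
  simp [lastCoord]

/-- The integrand is homogeneous of degree s - r ≤ -(m+1). Cutting it off outside the half ball
respects the scaling inequality, because 2x in the half ball implies x in it. -/
theorem setLIntegral_halfSpace_norm_rpow_eq_top {m : ℕ} {r s : ℝ} (hr : (m : ℝ) + 1 ≤ r - s) :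
    ∫⁻ x in halfSpace m ∩ {x : Amb m | ‖x‖ < 1},
      ENNReal.ofReal (lastCoord x ^ s * ‖x‖ ^ (-r)) = ⊤ := by
  have hm1 : MeasurableSet {x : Amb m | ‖x‖ < 1} := measurableSet_lt measurable_norm measurable_const
  rw [Set.inter_comm, ← Measure.restrict_restrict_of_subset (s := {x : Amb m | ‖x‖ < 1} ∩ halfSpace m)
    (t := {x : Amb m | ‖x‖ < 1}) Set.inter_subset_left,
    ← lintegral_indicator (hm1.inter measurableSet_halfSpace)]
  refine setLIntegral_ball_eq_top_of_scaling volume ?_ (fun x => ?_)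
    (O := halfSpace m ∩ {y : Amb m | 1 / 2 < ‖y‖ ∧ ‖y‖ < 1}) ?_ ?_ (fun x hx => ⟨hx.2.1.le, hx.2.2⟩) ?_
  · exact Measurable.indicator (by fun_prop) (hm1.inter measurableSet_halfSpace)
  · by_cases hx : (2 : ℝ) • x ∈ {x : Amb m | ‖x‖ < 1} ∩ halfSpace m
    · have hx0 : 0 < lastCoord x := by
        have h2 : 0 < lastCoord ((2 : ℝ) • x) := hx.2
        rw [lastCoord_smul] at h2; linarith
      have hx1 : ‖x‖ < 1 := by
        have h2 : ‖(2 : ℝ) • x‖ < 1 := hx.1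
        rw [norm_smul, Real.norm_ofNat] at h2
        linarith [norm_nonneg x]
      have hX := norm_pos_of_mem_halfSpace (x := x) hx0
      have hx' : x ∈ {x : Amb m | ‖x‖ < 1} ∩ halfSpace m := ⟨hx1, hx0⟩
      rw [Set.indicator_of_mem hx, Set.indicator_of_mem hx', ← ENNReal.ofReal_mul (by positivity),
        lastCoord_smul, norm_smul, Real.norm_ofNat, Real.mul_rpow two_pos.le hx0.le,
        Real.mul_rpow two_pos.le hX.le]
      apply ENNReal.ofReal_le_ofReal
      calc _ = (2 : ℝ) ^ (s - r) * (lastCoord x ^ s * ‖x‖ ^ (-r)) := by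
            rw [sub_eq_add_neg, Real.rpow_add two_pos]; ring
        _ ≤ _ := by
            gcongr
            · exact one_le_two
            · simp; linarith
    · rw [Set.indicator_of_notMem hx]; exact zero_le
  · exact (isOpen_lt continuous_const continuous_lastCoord).inter
      ((isOpen_lt continuous_const continuous_norm).inter
      (isOpen_lt continuous_norm continuous_const))
  · refine ⟨EuclideanSpace.single (Fin.last m) (3 / 4), ?_, ?_⟩
    · simp [halfSpace, lastCoord]
    · simp only [Set.mem_ofPred_eq, PiLp.norm_single]; norm_num
  · intro x hx
    have hx0 : 0 < lastCoord x := hx.1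
    have hX := norm_pos_of_mem_halfSpace hx.1
    have hx' : x ∈ {x : Amb m | ‖x‖ < 1} ∩ halfSpace m := ⟨hx.2.2, hx.1⟩
    rw [Set.indicator_of_mem hx']
    simp only [ne_eq, ENNReal.ofReal_eq_zero, not_le]; positivity

end Divergence

/-! ### Boundedness of the kernel operator on highly integrable functions. -/

section Holder

variable {m : ℕ} {a b κ ρ θ : ℝ}

/-- The kernel operator maps powers of functions of arbitrarily high integrability to bounded
functions. -/
theorem exists_lintegral_bdryKernel_mul_rpow_le (hm : 0 < m) (ha : 0 < a) (hb : 0 < b)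
    (hκ : 0 ≤ κ) (hρ : 0 ≤ ρ) (hab : a + b = κ + ρ) (hρm : ρ < m) {p : ℝ} (hp : 1 < p)
    {g : Bdry m → ENNReal} (hg : Measurable g)
    (hfin : ∀ s : ℝ, 0 < s → s ≤ 1 → conicNorm g ((p + 1) / s) ≠ ⊤) :
    ∃ M : ENNReal, M ≠ ⊤ ∧ ∀ z,
      ∫⁻ y, ENNReal.ofReal (bdryKernel a b κ ρ z y) * g y ^ p ∂conicMeasure m ≤ M := by
  have hm0 : (0 : ℝ) < m := Nat.cast_pos.2 hm
  -- A small s makes the exponent t' of g^p large, so its conjugate t is close enough to 1 for ρt <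
  -- m.
  obtain ⟨s, hs, hs1, hsρ⟩ : ∃ s : ℝ, 0 < s ∧ s < 1 ∧ ρ < m * (1 - s) := by
    have h1 : ρ / m < 1 := by rwa [div_lt_one hm0]
    have h2 : 0 ≤ ρ / m := by positivity
    have h3 : ρ / m * m = ρ := by field_simp
    refine ⟨(1 - ρ / m) / 2, by linarith, by linarith, ?_⟩
    nlinarith
  set t' := (p + 1) / s / p with ht'
  have hp0 : 0 < p := by linarith
  have hsp : s * p < p + 1 := by nlinarith
  have ht'1 : 1 < t' := by rw [ht', div_div, one_lt_div (by positivity)]; exact hsp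
  have hinv : 1 / t' < s := by
    rw [ht', one_div_div, div_lt_iff₀ (by positivity)]
    field_simp
    linarith
  have hconj := (Real.HolderConjugate.conjExponent ht'1).symm
  set t := Real.conjExponent t'
  have ht0 : 0 < t := hconj.pos
  have ht : 1 / t = 1 - 1 / t' := by
    have := hconj.inv_add_inv_eq_one
    rw [one_div, one_div]; linarith
  have hρt : ρ * t < m := by
    have : ρ < m * (1 / t) := by rw [ht]; nlinarith
    rwa [mul_one_div, lt_div_iff₀ ht0] at this
  obtain ⟨C, hC, h1⟩ := exists_lintegral_weightedKernel_rpow_le hm ha hb hκ hρ le_rfl hab ha hb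
    ht0 hρt
  refine ⟨C ^ (1 / t) * conicNorm g ((p + 1) / s) ^ p, ENNReal.mul_ne_top
    (ENNReal.rpow_ne_top_of_nonneg (by positivity) hC)
    (ENNReal.rpow_ne_top_of_nonneg hp0.le (hfin s hs hs1.le)), fun z => ?_⟩
  have hmK : Measurable fun y => ENNReal.ofReal (weightedKernel a b κ ρ 0 z y) :=
    (measurable_weightedKernel_right z).ennreal_ofReal
  calc _ ≤ ∫⁻ y, ENNReal.ofReal (weightedKernel a b κ ρ 0 z y) * g y ^ p ∂conicMeasure m := by
        refine lintegral_mono fun y => ?_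
        gcongr
        exact bdryKernel_le_weightedKernel _ _
    _ ≤ _ := ENNReal.lintegral_mul_le_Lp_mul_Lq _ hconj hmK.aemeasurable
        (hg.pow_const p).aemeasurable
    _ ≤ _ := by
        gcongr
        · exact h1 z
        · rw [← conicNorm_rpow hp0]; rfl

end Holder

/-! ### The integral system, lower bounds near the origin and their consequences. -/

noncomputable section

/-- The density on the half space whose potential determines the boundary component. -/
def interiorDensity {m : ℕ} (lam β q : ℝ) (v : Amb m → ENNReal) (x : Amb m) : ENNReal :=
  ENNReal.ofReal (‖x‖ ^ (-β) * lastCoord x ^ lam) * v x ^ q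

/-- The density on the boundary whose potential determines the interior component. -/
def bdryDensity {m : ℕ} (α p : ℝ) (u : Bdry m → ENNReal) (y : Bdry m) : ENNReal :=
  ENNReal.ofReal (‖y‖ ^ (-α)) * u y ^ p

/-- The weighted integral system for measurable functions with values in `[0, ∞]`. -/
structure IsSystem {m : ℕ} (lam μ α β p q : ℝ) (u : Bdry m → ENNReal) (v : Amb m → ENNReal) :
    Prop where
  dim_pos : 0 < m
  lam_nonneg : 0 ≤ lam
  α_pos : 0 < α
  β_pos : 0 < β
  μ_pos : 0 < μ
  one_lt_p : 1 < p
  one_lt_q : 1 < q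
  crit : m / (p + 1) + ((m : ℝ) + 1) / (q + 1) = α + β + μ - lam
  measurable_u : Measurable u
  measurable_v : Measurable v
  u_ne_zero : ∀ y, y ≠ 0 → u y ≠ 0
  v_ne_zero : ∀ x ∈ halfSpace m, v x ≠ 0
  u_eq : ∀ y, y ≠ 0 → ENNReal.ofReal (‖y‖ ^ α) * u y =
    ∫⁻ x in halfSpace m, interiorDensity lam β q v x * ENNReal.ofReal (‖x - bdryEmb y‖ ^ (-μ))
  v_eq : ∀ x ∈ halfSpace m, ENNReal.ofReal (‖x‖ ^ β * lastCoord x ^ (-lam)) * v x =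
    ∫⁻ y, bdryDensity α p u y * ENNReal.ofReal (‖x - bdryEmb y‖ ^ (-μ))
  u_norm : ∫⁻ y, u y ^ (p + 1) ≠ ⊤
  v_norm : ∫⁻ x in halfSpace m, v x ^ (q + 1) ≠ ⊤

end

section

variable {m : ℕ} {lam μ α β p q : ℝ} {u : Bdry m → ENNReal} {v : Amb m → ENNReal}

@[fun_prop]
theorem measurable_interiorDensity (hv : Measurable v) : Measurable (interiorDensity lam β q v) := by
  unfold interiorDensity; fun_prop

@[fun_prop]
theorem measurable_bdryDensity (hu : Measurable u) : Measurable (bdryDensity α p u) := by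
  unfold bdryDensity; fun_prop

theorem ofReal_mul_rpow {r q : ℝ} (hr : 0 ≤ r) (hq : 0 ≤ q) (t : ENNReal) :
    (ENNReal.ofReal r * t) ^ q = ENNReal.ofReal (r ^ q) * t ^ q := by
  rw [ENNReal.mul_rpow_of_nonneg _ _ hq, ENNReal.ofReal_rpow_of_nonneg hr hq]

theorem ae_ne_zero_bdry (hm : 0 < m) : ∀ᵐ y : Bdry m, y ≠ 0 := by
  have hne : Nonempty (Fin m) := ⟨⟨0, hm⟩⟩
  rw [ae_iff]
  simp

theorem ae_ne_bdry (hm : 0 < m) (z : Bdry m) : ∀ᵐ y : Bdry m, y ≠ z := by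
  have hne : Nonempty (Fin m) := ⟨⟨0, hm⟩⟩
  rw [ae_iff]
  simp

/-- A potential of a positive density is bounded below near the origin. -/
theorem exists_le_lintegral_potential {X : Type*} [MeasurableSpace X] {ν : Measure X}
    (hν : ν ≠ 0) {f : X → ENNReal} (hf : Measurable f) (hpos : ∀ᵐ x ∂ν, f x ≠ 0) {N : X → ℝ}
    (hN : Measurable N) (hN0 : ∀ x, 0 ≤ N x) {μ : ℝ} (hμ : 0 ≤ μ) :
    ∃ c : ENNReal, c ≠ 0 ∧ ∀ D : X → ℝ, (∀ᵐ x ∂ν, 0 < D x) → (∀ x, D x ≤ N x + 1) →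
      c ≤ ∫⁻ x, f x * ENNReal.ofReal (D x ^ (-μ)) ∂ν := by
  refine ⟨∫⁻ x, f x * ENNReal.ofReal ((N x + 1) ^ (-μ)) ∂ν, fun h => ?_, fun D hD0 hD => ?_⟩
  · rw [lintegral_eq_zero_iff (by fun_prop)] at h
    have : ∀ᵐ x ∂ν, False := by
      filter_upwards [h, hpos] with x h1 h2
      have h3 : (0 : ℝ) < (N x + 1) ^ (-μ) := by have := hN0 x; positivity
      simp [h2, not_le.2 h3] at h1
    exact hν (by simpa [ae_iff] using this)
  · refine lintegral_mono_ae ?_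
    filter_upwards [hD0] with x hx
    exact mul_le_mul_right (ENNReal.ofReal_le_ofReal
      (Real.rpow_le_rpow_of_nonpos hx (hD x) (neg_nonpos.2 hμ))) _

namespace IsSystem

variable (h : IsSystem lam μ α β p q u v)
include h

theorem exists_le_u : ∃ c : ENNReal, c ≠ 0 ∧ ∀ y, y ≠ 0 → ‖y‖ < 1 →
    c ≤ ENNReal.ofReal (‖y‖ ^ α) * u y := by
  have hv := h.measurable_v
  have hopen : IsOpen (halfSpace m) := isOpen_lt continuous_const continuous_lastCoord
  have hne : (halfSpace m).Nonempty := ⟨EuclideanSpace.single (Fin.last m) 1, by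
    simp [halfSpace, lastCoord]⟩
  obtain ⟨c, hc, hc'⟩ := exists_le_lintegral_potential (ν := volume.restrict (halfSpace m))
    (f := interiorDensity lam β q v) (N := fun x => ‖x‖) (μ := μ)
    (by rw [Ne, Measure.restrict_eq_zero]; exact (hopen.measure_pos volume hne).ne')
    (by fun_prop) (by
      refine (ae_restrict_iff' measurableSet_halfSpace).2 (ae_of_all _ fun x hx => ?_)
      have h1 : 0 < lastCoord x := hx
      have h2 := norm_pos_of_mem_halfSpace hx
      refine mul_ne_zero ?_ ?_
      · simp only [ne_eq, ENNReal.ofReal_eq_zero, not_le]; positivity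
      · have := h.one_lt_q
        rw [Ne, ENNReal.rpow_eq_zero_iff_of_pos (by linarith)]
        exact h.v_ne_zero x hx) (by fun_prop) (fun x => norm_nonneg x) h.μ_pos.le
  refine ⟨c, hc, fun y hy hy1 => ?_⟩
  rw [h.u_eq y hy]
  refine hc' _ ?_ fun x => ?_
  · exact (ae_restrict_iff' measurableSet_halfSpace).2
      (ae_of_all _ fun x hx => norm_sub_bdryEmb_pos hx y)
  · have := norm_sub_le x (bdryEmb y)
    rw [norm_bdryEmb] at this
    linarith

theorem exists_le_v : ∃ c : ENNReal, c ≠ 0 ∧ ∀ x ∈ halfSpace m, ‖x‖ < 1 →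
    c ≤ ENNReal.ofReal (‖x‖ ^ β * lastCoord x ^ (-lam)) * v x := by
  have hu := h.measurable_u
  obtain ⟨c, hc, hc'⟩ := exists_le_lintegral_potential (ν := (volume : Measure (Bdry m)))
    (f := bdryDensity α p u) (N := fun x => ‖x‖) (μ := μ) (NeZero.ne _)
    (by fun_prop) (by
      filter_upwards [ae_ne_zero_bdry h.dim_pos] with y hy
      have h2 := norm_pos_iff.2 hy
      refine mul_ne_zero ?_ ?_
      · simp only [ne_eq, ENNReal.ofReal_eq_zero, not_le]; positivity
      · have := h.one_lt_p
        rw [Ne, ENNReal.rpow_eq_zero_iff_of_pos (by linarith)]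
        exact h.u_ne_zero y hy) (by fun_prop) (fun x => norm_nonneg x) h.μ_pos.le
  refine ⟨c, hc, fun x hx hx1 => ?_⟩
  rw [h.v_eq x hx]
  refine hc' _ (ae_of_all _ fun y => norm_sub_bdryEmb_pos hx y) fun y => ?_
  have := norm_sub_le x (bdryEmb y)
  rw [norm_bdryEmb] at this
  linarith

/-- Since u ≥ c|y|^(-α) near 0, membership in L^(p+1) would fail otherwise. This is the positivity
of the exponent a. -/
theorem α_mul_lt : α * (p + 1) < m := by
  by_contra hcon
  obtain ⟨c, hc, hc'⟩ := h.exists_le_u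
  have hp := h.one_lt_p
  have hms : MeasurableSet {y : Bdry m | ‖y‖ < 1} := measurableSet_lt measurable_norm measurable_const
  refine h.u_norm (top_le_iff.1 ?_)
  have htop := setLIntegral_norm_rpow_eq_top h.dim_pos (not_lt.1 hcon)
  calc ⊤ = c ^ (p + 1) * ⊤ := by
        rw [ENNReal.mul_top]
        rw [Ne, ENNReal.rpow_eq_zero_iff_of_pos (by linarith)]; exact hc
    _ = ∫⁻ y in {y : Bdry m | ‖y‖ < 1}, c ^ (p + 1) * ENNReal.ofReal (‖y‖ ^ (-(α * (p + 1)))) := by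
        rw [lintegral_const_mul _ (by fun_prop), htop]
    _ ≤ ∫⁻ y in {y : Bdry m | ‖y‖ < 1}, u y ^ (p + 1) := by
        refine lintegral_mono_ae ?_
        filter_upwards [ae_restrict_mem hms, ae_restrict_of_ae (ae_ne_zero_bdry h.dim_pos)] with y hy1 hy
        have hB := norm_pos_iff.2 hy
        calc _ ≤ (ENNReal.ofReal (‖y‖ ^ α) * u y) ^ (p + 1) *
              ENNReal.ofReal (‖y‖ ^ (-(α * (p + 1)))) := by
              gcongr
              exact hc' y hy hy1
          _ = u y ^ (p + 1) := by
              rw [ofReal_mul_rpow (by positivity) (by linarith), ← Real.rpow_mul hB.le,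
                mul_right_comm, ← ENNReal.ofReal_mul (by positivity), ← Real.rpow_add hB]
              simp
    _ ≤ _ := setLIntegral_le_lintegral _ _

/-- The lower bound for u makes the integrand at least a multiple of |y|^(-α(p+1)-μ) near 0. -/
theorem lintegral_bdryDensity_eq_top (hr : m ≤ α * (p + 1) + μ) :
    ∫⁻ y, bdryDensity α p u y * ENNReal.ofReal (‖y‖ ^ (-μ)) = ⊤ := by
  obtain ⟨c, hc, hc'⟩ := h.exists_le_u
  have hp := h.one_lt_p
  have hms : MeasurableSet {y : Bdry m | ‖y‖ < 1} := measurableSet_lt measurable_norm measurable_const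
  refine top_le_iff.1 ?_
  have htop := setLIntegral_norm_rpow_eq_top h.dim_pos hr
  calc ⊤ = c ^ p * ⊤ := by
        rw [ENNReal.mul_top]
        rw [Ne, ENNReal.rpow_eq_zero_iff_of_pos (by linarith)]; exact hc
    _ = ∫⁻ y in {y : Bdry m | ‖y‖ < 1}, c ^ p * ENNReal.ofReal (‖y‖ ^ (-(α * (p + 1) + μ))) := by
        rw [lintegral_const_mul _ (by fun_prop), htop]
    _ ≤ ∫⁻ y in {y : Bdry m | ‖y‖ < 1}, bdryDensity α p u y * ENNReal.ofReal (‖y‖ ^ (-μ)) := by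
        refine lintegral_mono_ae ?_
        filter_upwards [ae_restrict_mem hms, ae_restrict_of_ae (ae_ne_zero_bdry h.dim_pos)] with y hy1 hy
        have hB := norm_pos_iff.2 hy
        calc _ ≤ (ENNReal.ofReal (‖y‖ ^ α) * u y) ^ p *
              ENNReal.ofReal (‖y‖ ^ (-(α * (p + 1) + μ))) := by
              gcongr
              exact hc' y hy hy1
          _ = ENNReal.ofReal (‖y‖ ^ (α * p) * ‖y‖ ^ (-(α * (p + 1) + μ))) * u y ^ p := by
              rw [ofReal_mul_rpow (by positivity) (by linarith), ← Real.rpow_mul hB.le,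
                mul_right_comm, ← ENNReal.ofReal_mul (by positivity)]
          _ = ENNReal.ofReal (‖y‖ ^ (-α) * ‖y‖ ^ (-μ)) * u y ^ p := by
              rw [← Real.rpow_add hB, ← Real.rpow_add hB]; congr 3; ring
          _ = _ := by
              rw [ENNReal.ofReal_mul (by positivity)]; unfold bdryDensity; ring
    _ ≤ _ := setLIntegral_le_lintegral _ _

/-- The interior counterpart, from v ≥ c x_n^λ |x|^(-β); it is the positivity of b. -/
theorem β_sub_lam_mul_lt : (β - lam) * (q + 1) < m + 1 := by
  by_contra hcon
  obtain ⟨c, hc, hc'⟩ := h.exists_le_v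
  have hq := h.one_lt_q
  have hms : MeasurableSet (halfSpace m ∩ {y : Amb m | ‖y‖ < 1}) :=
    measurableSet_halfSpace.inter (measurableSet_lt measurable_norm measurable_const)
  refine h.v_norm (top_le_iff.1 ?_)
  have htop := setLIntegral_halfSpace_norm_rpow_eq_top (m := m) (r := β * (q + 1))
    (s := lam * (q + 1)) (by linarith)
  calc ⊤ = c ^ (q + 1) * ⊤ := by
        rw [ENNReal.mul_top]
        rw [Ne, ENNReal.rpow_eq_zero_iff_of_pos (by linarith)]; exact hc
    _ = ∫⁻ x in halfSpace m ∩ {y : Amb m | ‖y‖ < 1}, c ^ (q + 1) *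
          ENNReal.ofReal (lastCoord x ^ (lam * (q + 1)) * ‖x‖ ^ (-(β * (q + 1)))) := by
        rw [lintegral_const_mul _ (by fun_prop), htop]
    _ ≤ ∫⁻ x in halfSpace m ∩ {y : Amb m | ‖y‖ < 1}, v x ^ (q + 1) := by
        refine setLIntegral_mono' hms fun x hx => ?_
        have hx0 : 0 < lastCoord x := hx.1
        have hX := norm_pos_of_mem_halfSpace hx.1
        calc _ ≤ (ENNReal.ofReal (‖x‖ ^ β * lastCoord x ^ (-lam)) * v x) ^ (q + 1) *
              ENNReal.ofReal (lastCoord x ^ (lam * (q + 1)) * ‖x‖ ^ (-(β * (q + 1)))) := by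
              gcongr
              exact hc' x hx.1 hx.2
          _ = ENNReal.ofReal ((‖x‖ ^ (β * (q + 1)) * ‖x‖ ^ (-(β * (q + 1)))) *
              (lastCoord x ^ (-lam * (q + 1)) * lastCoord x ^ (lam * (q + 1)))) * v x ^ (q + 1) := by
              rw [ofReal_mul_rpow (by positivity) (by linarith), Real.mul_rpow (by positivity)
                (by positivity), ← Real.rpow_mul hX.le, ← Real.rpow_mul hx0.le,
                mul_right_comm, ← ENNReal.ofReal_mul (by positivity)]
              congr 2; ring
          _ = v x ^ (q + 1) := by
              rw [← Real.rpow_add hX, ← Real.rpow_add hx0]; simp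
    _ ≤ _ := lintegral_mono_set Set.inter_subset_left

theorem lintegral_interiorDensity_eq_top (hr : (m : ℝ) + 1 ≤ (β - lam) * (q + 1) + μ) :
    ∫⁻ x in halfSpace m, interiorDensity lam β q v x * ENNReal.ofReal (‖x‖ ^ (-μ)) = ⊤ := by
  obtain ⟨c, hc, hc'⟩ := h.exists_le_v
  have hq := h.one_lt_q
  have hms : MeasurableSet (halfSpace m ∩ {y : Amb m | ‖y‖ < 1}) :=
    measurableSet_halfSpace.inter (measurableSet_lt measurable_norm measurable_const)
  refine top_le_iff.1 ?_
  have htop := setLIntegral_halfSpace_norm_rpow_eq_top (m := m) (r := β * (q + 1) + μ)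
    (s := lam * (q + 1)) (by linarith)
  calc ⊤ = c ^ q * ⊤ := by
        rw [ENNReal.mul_top]
        rw [Ne, ENNReal.rpow_eq_zero_iff_of_pos (by linarith)]; exact hc
    _ = ∫⁻ x in halfSpace m ∩ {y : Amb m | ‖y‖ < 1}, c ^ q *
          ENNReal.ofReal (lastCoord x ^ (lam * (q + 1)) * ‖x‖ ^ (-(β * (q + 1) + μ))) := by
        rw [lintegral_const_mul _ (by fun_prop), htop]
    _ ≤ ∫⁻ x in halfSpace m ∩ {y : Amb m | ‖y‖ < 1},
          interiorDensity lam β q v x * ENNReal.ofReal (‖x‖ ^ (-μ)) := by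
        refine setLIntegral_mono' hms fun x hx => ?_
        have hx0 : 0 < lastCoord x := hx.1
        have hX := norm_pos_of_mem_halfSpace hx.1
        calc _ ≤ (ENNReal.ofReal (‖x‖ ^ β * lastCoord x ^ (-lam)) * v x) ^ q *
              ENNReal.ofReal (lastCoord x ^ (lam * (q + 1)) * ‖x‖ ^ (-(β * (q + 1) + μ))) := by
              gcongr
              exact hc' x hx.1 hx.2
          _ = ENNReal.ofReal ((‖x‖ ^ (β * q) * ‖x‖ ^ (-(β * (q + 1) + μ))) *
              (lastCoord x ^ (-lam * q) * lastCoord x ^ (lam * (q + 1)))) * v x ^ q := by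
              rw [ofReal_mul_rpow (by positivity) (by linarith), Real.mul_rpow (by positivity)
                (by positivity), ← Real.rpow_mul hX.le, ← Real.rpow_mul hx0.le,
                mul_right_comm, ← ENNReal.ofReal_mul (by positivity)]
              congr 2; ring
          _ = ENNReal.ofReal ((‖x‖ ^ (-β) * ‖x‖ ^ (-μ)) * lastCoord x ^ lam) * v x ^ q := by
              rw [← Real.rpow_add hX, ← Real.rpow_add hx0, ← Real.rpow_add hX]; ring_nf
          _ = _ := by
              unfold interiorDensity
              rw [mul_right_comm (ENNReal.ofReal (‖x‖ ^ (-β) * lastCoord x ^ lam)),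
                ← ENNReal.ofReal_mul (by positivity)]
              congr 2; ring
    _ ≤ _ := lintegral_mono_set Set.inter_subset_left

end IsSystem

end

/-! ### Normalization and reduction to a subcritical pair on the boundary. -/

noncomputable section

/-- The boundary component, normalized with respect to `conicMeasure`. -/
def conicFst {m : ℕ} (p : ℝ) (u : Bdry m → ENNReal) (y : Bdry m) : ENNReal :=
  ENNReal.ofReal (‖y‖ ^ ((m : ℝ) / (p + 1))) * u y

/-- The boundary potential which dominates the interior component. -/
def conicSnd {m : ℕ} (a b κ ρ p : ℝ) (u : Bdry m → ENNReal) (z : Bdry m) : ENNReal :=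
  ∫⁻ y, ENNReal.ofReal (bdryKernel a b κ ρ z y) * conicFst p u y ^ p ∂conicMeasure m

/-- The interior component, normalized with respect to dilations. -/
def conicInterior {m : ℕ} (lam q : ℝ) (v : Amb m → ENNReal) (x : Amb m) : ENNReal :=
  ENNReal.ofReal (‖x‖ ^ (((m : ℝ) + 1) / (q + 1) + lam) * lastCoord x ^ (-lam)) * v x

/-- An integral system together with its homogeneity exponents `a`, `b` and an admissible splitting
`μ = κ + ρ`. -/
structure IsSplitSystem {m : ℕ} (lam μ α β p q a b κ ρ : ℝ) (u : Bdry m → ENNReal)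
    (v : Amb m → ENNReal) : Prop extends IsSystem lam μ α β p q u v where
  a_eq : a = m / (p + 1) - α
  b_eq : b = ((m : ℝ) + 1) / (q + 1) - (β - lam)
  κ_nonneg : 0 ≤ κ
  ρ_nonneg : 0 ≤ ρ
  add_eq : κ + ρ = μ
  κ_lt : κ < lam + 1 / (q + 1)
  ρ_lt : ρ < m / (p + 1) + m / (q + 1)

end

section

variable {m : ℕ} {lam μ α β p q a b κ ρ : ℝ} {u : Bdry m → ENNReal} {v : Amb m → ENNReal}

/-- Let L = μ - λ - 1/(q+1). The condition on κ = μ - ρ reads ρ > L, and by the critical relation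
the condition on ρ reads ρ < L + α + β. If L < 0 then ρ = 0 works; otherwise the midpoint, capped at
μ > L, does. -/
theorem IsSystem.exists_isSplitSystem (h : IsSystem lam μ α β p q u v) :
    ∃ a b κ ρ : ℝ, IsSplitSystem lam μ α β p q a b κ ρ u v := by
  have hp := h.one_lt_p
  have hq := h.one_lt_q
  have hm : (0 : ℝ) < m := Nat.cast_pos.2 h.dim_pos
  have hlam := h.lam_nonneg
  have hα := h.α_pos
  have hβ := h.β_pos
  have hμ := h.μ_pos
  have hc := h.crit
  rw [add_div] at hc
  have h1 : 0 < 1 / (q + 1) := by positivity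
  have h2 : 0 < m / (p + 1) + m / (q + 1) := by positivity
  rcases lt_or_ge (μ - lam - 1 / (q + 1)) 0 with hL | hL
  · exact ⟨_, _, μ, 0, h, rfl, rfl, hμ.le, le_rfl, add_zero _, by linarith, h2⟩
  · refine ⟨_, _, μ - min μ (μ - lam - 1 / (q + 1) + (α + β) / 2),
      min μ (μ - lam - 1 / (q + 1) + (α + β) / 2), h, rfl, rfl, ?_, ?_, by ring, ?_, ?_⟩
    · exact sub_nonneg.2 (min_le_left _ _)
    · exact le_min hμ.le (by positivity)
    · have : μ - lam - 1 / (q + 1) < min μ (μ - lam - 1 / (q + 1) + (α + β) / 2) :=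
        lt_min (by linarith) (by linarith)
      linarith
    · refine (min_le_right _ _).trans_lt ?_
      linarith

@[fun_prop]
theorem measurable_conicFst (hu : Measurable u) : Measurable (conicFst p u) := by
  unfold conicFst; fun_prop

theorem measurable_conicSnd (hu : Measurable u) : Measurable (conicSnd a b κ ρ p u) := by
  unfold conicSnd
  refine Measurable.lintegral_prod_right' (f := fun w : Bdry m × Bdry m =>
    ENNReal.ofReal (bdryKernel a b κ ρ w.1 w.2) * conicFst p u w.2 ^ p) ?_
  fun_prop

namespace IsSplitSystem

variable (h : IsSplitSystem lam μ α β p q a b κ ρ u v)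
include h

theorem a_pos : 0 < a := by
  have := h.one_lt_p
  rw [h.a_eq, sub_pos, lt_div_iff₀ (by linarith)]
  exact h.α_mul_lt

theorem b_pos : 0 < b := by
  have := h.one_lt_q
  rw [h.b_eq, sub_pos, lt_div_iff₀ (by linarith)]
  exact h.β_sub_lam_mul_lt

theorem a_add_b : a + b = μ := by
  have := h.crit
  rw [h.a_eq, h.b_eq]; linarith

/-- This is the total exponent of x_n/|x| in the reduction to the boundary: λ(1+q) from the density,
-κq from the bound of v^q, and -κ from the kernel. -/
theorem neg_one_lt : -1 < (lam - κ) * (1 + q) := by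
  have h1 := h.κ_lt
  have hq := h.one_lt_q
  have h2 : 1 / (q + 1) * (q + 1) = 1 := by field_simp
  nlinarith

theorem ρ_lt_dim : ρ < m := by
  have hp := h.one_lt_p
  have hq := h.one_lt_q
  have hm : (0 : ℝ) < m := Nat.cast_pos.2 h.dim_pos
  have hξ : (m : ℝ) / (p + 1) < m / 2 := by
    apply div_lt_div_of_pos_left hm two_pos; linarith
  have hη : (m : ℝ) / (q + 1) < m / 2 := by
    apply div_lt_div_of_pos_left hm two_pos; linarith
  linarith [h.ρ_lt]

theorem bdryDensity_eq {y : Bdry m} (hy : y ≠ 0) : bdryDensity α p u y =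
    ENNReal.ofReal (‖y‖ ^ (-(m : ℝ))) * (ENNReal.ofReal (‖y‖ ^ a) * conicFst p u y ^ p) := by
  have hp := h.one_lt_p
  have hB := norm_pos_iff.2 hy
  unfold bdryDensity conicFst
  rw [ofReal_mul_rpow (by positivity) (by linarith), ← Real.rpow_mul hB.le, ← mul_assoc,
    ← mul_assoc, ← ENNReal.ofReal_mul (by positivity), ← ENNReal.ofReal_mul (by positivity),
    ← Real.rpow_add hB, ← Real.rpow_add hB]
  congr 3
  rw [h.a_eq]
  field_simp
  ring

theorem interiorDensity_eq {x : Amb m} (hx : x ∈ halfSpace m) : interiorDensity lam β q v x =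
    ENNReal.ofReal (‖x‖ ^ b) * (ENNReal.ofReal (‖x‖ ^ (-((m : ℝ) + 1))) *
      (ENNReal.ofReal ((lastCoord x / ‖x‖) ^ (lam * (1 + q))) * conicInterior lam q v x ^ q)) := by
  have hq := h.one_lt_q
  have hX := norm_pos_of_mem_halfSpace hx
  have hx0 : 0 < lastCoord x := hx
  unfold interiorDensity conicInterior
  rw [ofReal_mul_rpow (by positivity) (by linarith), Real.mul_rpow (by positivity) (by positivity),
    ← Real.rpow_mul hX.le, ← Real.rpow_mul hx0.le, ← mul_assoc, ← mul_assoc, ← mul_assoc,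
    ← ENNReal.ofReal_mul (by positivity), ← ENNReal.ofReal_mul (by positivity),
    ← ENNReal.ofReal_mul (by positivity)]
  congr 2
  rw [Real.div_rpow hx0.le hX.le, div_eq_mul_inv, ← Real.rpow_neg hX.le]
  have e1 : lastCoord x ^ lam = lastCoord x ^ (lam * (1 + q)) * lastCoord x ^ (-lam * q) := by
    rw [← Real.rpow_add hx0]; congr 1; ring
  have e2 : ‖x‖ ^ (-β) = ‖x‖ ^ b * (‖x‖ ^ (-((m : ℝ) + 1)) * (‖x‖ ^ (-(lam * (1 + q))) *
      ‖x‖ ^ ((((m : ℝ) + 1) / (q + 1) + lam) * q))) := by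
    rw [← Real.rpow_add hX, ← Real.rpow_add hX, ← Real.rpow_add hX]
    congr 1
    rw [h.b_eq]; field_simp; ring
  rw [e1, e2]; ring

theorem conicFst_eq {y : Bdry m} (hy : y ≠ 0) : conicFst p u y = ENNReal.ofReal (‖y‖ ^ a) *
    ∫⁻ x in halfSpace m, interiorDensity lam β q v x * ENNReal.ofReal (‖x - bdryEmb y‖ ^ (-μ)) := by
  have hB := norm_pos_iff.2 hy
  rw [← h.u_eq y hy, ← mul_assoc, ← ENNReal.ofReal_mul (by positivity), ← Real.rpow_add hB,
    h.a_eq, sub_add_cancel]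
  rfl

theorem lintegral_bdryDensity_mul {g : Bdry m → ENNReal} (hg : Measurable g) :
    ∫⁻ y, bdryDensity α p u y * g y =
      ∫⁻ y, ENNReal.ofReal (‖y‖ ^ a) * g y * conicFst p u y ^ p ∂conicMeasure m := by
  have hu := h.measurable_u
  rw [lintegral_conicMeasure (by fun_prop)]
  refine lintegral_congr_ae ?_
  filter_upwards [ae_ne_zero_bdry h.dim_pos] with y hy
  rw [h.bdryDensity_eq hy]; ring

theorem conicInterior_eq {x : Amb m} (hx : x ∈ halfSpace m) : conicInterior lam q v x =
    ∫⁻ y, ENNReal.ofReal (‖x‖ ^ b * ‖y‖ ^ a / ‖x - bdryEmb y‖ ^ (κ + ρ)) * conicFst p u y ^ p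
      ∂conicMeasure m := by
  have hX := norm_pos_of_mem_halfSpace hx
  have hx0 : 0 < lastCoord x := hx
  have h1 : conicInterior lam q v x = ENNReal.ofReal (‖x‖ ^ b) *
      (ENNReal.ofReal (‖x‖ ^ β * lastCoord x ^ (-lam)) * v x) := by
    unfold conicInterior
    rw [← mul_assoc, ← ENNReal.ofReal_mul (by positivity), ← mul_assoc, ← Real.rpow_add hX]
    congr 4
    rw [h.b_eq]; ring
  rw [h1, h.v_eq x hx, h.lintegral_bdryDensity_mul (by fun_prop),
    ← lintegral_const_mul' _ _ ENNReal.ofReal_ne_top]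
  refine lintegral_congr fun y => ?_
  rw [← mul_assoc, ← ENNReal.ofReal_mul (by positivity), ← ENNReal.ofReal_mul (by positivity),
    h.add_eq, Real.rpow_neg (norm_nonneg _), div_eq_mul_inv, mul_assoc]

/-- The comparison of kernels is integrated in y; the single point y = z, where the boundary kernel
is not controlled, is null. -/
theorem conicInterior_le {x : Amb m} (hx : x ∈ halfSpace m) {z : Bdry m} (hz : z ∈ shadow x) :
    conicInterior lam q v x ≤ ENNReal.ofReal (4 ^ b * 4 ^ κ * 2 ^ ρ) *
      (ENNReal.ofReal ((lastCoord x / ‖x‖) ^ (-κ)) * conicSnd a b κ ρ p u z) := by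
  have hX := norm_pos_of_mem_halfSpace hx
  have hx0 : 0 < lastCoord x := hx
  rw [h.conicInterior_eq hx, conicSnd, ← lintegral_const_mul' _ _ ENNReal.ofReal_ne_top,
    ← lintegral_const_mul' _ _ ENNReal.ofReal_ne_top]
  refine lintegral_mono_ae ?_
  filter_upwards [conicMeasure_absolutelyContinuous m (ae_ne_bdry h.dim_pos z)] with y hy
  rw [← mul_assoc, ← mul_assoc, ← ENNReal.ofReal_mul (by positivity),
    ← ENNReal.ofReal_mul (by positivity)]
  gcongr
  rw [mul_assoc]
  exact kernel_le_mul_bdryKernel h.b_pos.le h.κ_nonneg h.ρ_nonneg hx hz (Ne.symm hy)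

/-- Integrals against the interior density are controlled by integrals over the boundary. -/
theorem exists_setLIntegral_interiorDensity_le :
    ∃ C : ENNReal, C ≠ ⊤ ∧ ∀ (w : Amb m → ENNReal) (g : Bdry m → ENNReal), Measurable g →
      (∀ x ∈ halfSpace m, ∀ᵐ z, z ∈ shadow x →
        w x ≤ ENNReal.ofReal (‖x‖ ^ (-b) * (lastCoord x / ‖x‖) ^ (-κ)) * g z) →
      ∫⁻ x in halfSpace m, interiorDensity lam β q v x * w x ≤
        C * ∫⁻ z, g z * conicSnd a b κ ρ p u z ^ q ∂conicMeasure m := by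
  have hq := h.one_lt_q
  have hu := h.measurable_u
  have hH : Measurable (conicSnd a b κ ρ p u) := measurable_conicSnd hu
  obtain ⟨C, hC, h1⟩ := exists_setLIntegral_halfSpace_le h.dim_pos h.neg_one_lt
  set k := (4 : ℝ) ^ b * 4 ^ κ * 2 ^ ρ with hk
  have hk0 : 0 < k := by positivity
  refine ⟨C * ENNReal.ofReal (k ^ q), by finiteness, fun w g hg hw => ?_⟩
  rw [mul_assoc, ← lintegral_const_mul' _ _ ENNReal.ofReal_ne_top]
  calc ∫⁻ x in halfSpace m, interiorDensity lam β q v x * w x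
      = ∫⁻ x in halfSpace m, ENNReal.ofReal (‖x‖ ^ (-((m : ℝ) + 1))) *
        (ENNReal.ofReal (‖x‖ ^ b) * (ENNReal.ofReal ((lastCoord x / ‖x‖) ^ (lam * (1 + q))) *
          conicInterior lam q v x ^ q) * w x) := by
        refine setLIntegral_congr_fun measurableSet_halfSpace fun x hx => ?_
        rw [h.interiorDensity_eq hx]; ring
    _ ≤ _ := by
        refine h1 _ _ (by fun_prop) fun x hx => ?_
        filter_upwards [hw x hx] with z hzw hz
        have hX := norm_pos_of_mem_halfSpace hx
        have hx0 : 0 < lastCoord x := hx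
        set τ := lastCoord x / ‖x‖ with hτ
        have hτ0 : 0 < τ := by positivity
        calc _ ≤ ENNReal.ofReal (‖x‖ ^ b) * (ENNReal.ofReal (τ ^ (lam * (1 + q))) *
              (ENNReal.ofReal k * (ENNReal.ofReal (τ ^ (-κ)) * conicSnd a b κ ρ p u z)) ^ q) *
              (ENNReal.ofReal (‖x‖ ^ (-b) * τ ^ (-κ)) * g z) := by
              gcongr
              · exact h.conicInterior_le hx hz
              · exact hzw hz
          _ = ENNReal.ofReal (‖x‖ ^ b * (τ ^ (lam * (1 + q)) * (k ^ q * τ ^ (-κ * q))) *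
                (‖x‖ ^ (-b) * τ ^ (-κ))) * (g z * conicSnd a b κ ρ p u z ^ q) := by
              rw [ofReal_mul_rpow hk0.le (by linarith), ofReal_mul_rpow (by positivity)
                (by linarith), ← Real.rpow_mul hτ0.le, ENNReal.ofReal_mul (p := ‖x‖ ^ b * _) (by positivity),
                ENNReal.ofReal_mul (p := ‖x‖ ^ b) (by positivity),
                ENNReal.ofReal_mul (p := τ ^ (lam * (1 + q))) (by positivity),
                ENNReal.ofReal_mul (p := k ^ q) (by positivity)]
              ring
          _ = ENNReal.ofReal (τ ^ ((lam - κ) * (1 + q)) * k ^ q) *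
                (g z * conicSnd a b κ ρ p u z ^ q) := by
              congr 2
              have e1 : ‖x‖ ^ b * ‖x‖ ^ (-b) = 1 := by rw [← Real.rpow_add hX]; simp
              have e2 : τ ^ ((lam - κ) * (1 + q)) =
                  τ ^ (lam * (1 + q)) * τ ^ (-κ * q) * τ ^ (-κ) := by
                rw [← Real.rpow_add hτ0, ← Real.rpow_add hτ0]; congr 1; ring
              rw [e2]
              linear_combination (τ ^ (lam * (1 + q)) * (k ^ q * τ ^ (-κ * q)) * τ ^ (-κ)) * e1
          _ = _ := by rw [ENNReal.ofReal_mul (by positivity), mul_assoc]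

theorem conicNorm_conicFst_ne_top : conicNorm (conicFst p u) (p + 1) ≠ ⊤ := by
  have hp := h.one_lt_p
  have hu := h.measurable_u
  rw [conicNorm_ne_top (by linarith), lintegral_conicMeasure (by fun_prop)]
  refine ne_top_of_le_ne_top h.u_norm (lintegral_mono_ae ?_)
  filter_upwards [ae_ne_zero_bdry h.dim_pos] with y hy
  have hB := norm_pos_iff.2 hy
  unfold conicFst
  rw [ofReal_mul_rpow (by positivity) (by linarith), ← mul_assoc,
    ← ENNReal.ofReal_mul (by positivity), ← Real.rpow_mul hB.le, ← Real.rpow_add hB,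
    div_mul_cancel₀ _ (by linarith)]
  simp

/-- The potential of the interior density over a set is controlled by the boundary kernel. -/
theorem exists_potential_le :
    ∃ C : ENNReal, C ≠ ⊤ ∧ ∀ (y : Bdry m) (S : Set (Amb m)) (T : Set (Bdry m)),
      MeasurableSet S → MeasurableSet T → (∀ x ∈ halfSpace m, x ∈ S → shadow x ⊆ T) →
      ENNReal.ofReal (‖y‖ ^ a) * ∫⁻ x in S ∩ halfSpace m, interiorDensity lam β q v x *
          ENNReal.ofReal (‖x - bdryEmb y‖ ^ (-μ)) ≤
        C * ∫⁻ z in T, ENNReal.ofReal (bdryKernel a b κ ρ z y) * conicSnd a b κ ρ p u z ^ q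
          ∂conicMeasure m := by
  obtain ⟨C, hC, h1⟩ := h.exists_setLIntegral_interiorDensity_le
  set k := (4 : ℝ) ^ b * 4 ^ κ * 2 ^ ρ with hk
  have hk0 : 0 < k := by positivity
  refine ⟨C * ENNReal.ofReal k, by finiteness, fun y S T hS hT hST => ?_⟩
  have hmk : Measurable fun z => ENNReal.ofReal (bdryKernel a b κ ρ z y) := by
    simp_rw [bdryKernel_swap _ y]
    exact (measurable_bdryKernel_right y).ennreal_ofReal
  calc _ = ∫⁻ x in halfSpace m, interiorDensity lam β q v x * S.indicator
        (fun x => ENNReal.ofReal (‖y‖ ^ a / ‖x - bdryEmb y‖ ^ (κ + ρ))) x := by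
        rw [← Measure.restrict_restrict hS, ← lintegral_const_mul' _ _ ENNReal.ofReal_ne_top,
          ← lintegral_indicator hS]
        refine lintegral_congr fun x => ?_
        by_cases hx : x ∈ S
        · rw [Set.indicator_of_mem hx, Set.indicator_of_mem hx, h.add_eq, div_eq_mul_inv,
            ← Real.rpow_neg (norm_nonneg _), ENNReal.ofReal_mul (by positivity)]
          ring
        · rw [Set.indicator_of_notMem hx, Set.indicator_of_notMem hx, mul_zero]
    _ ≤ C * ∫⁻ z, T.indicator (fun z => ENNReal.ofReal k * ENNReal.ofReal (bdryKernel a b κ ρ z y)) z *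
          conicSnd a b κ ρ p u z ^ q ∂conicMeasure m := by
        refine h1 _ _ ((hmk.const_mul _).indicator hT) fun x hx => ?_
        filter_upwards [ae_ne_bdry h.dim_pos y] with z hzy hz
        by_cases hxS : x ∈ S
        · have hX := norm_pos_of_mem_halfSpace hx
          have hx0 : 0 < lastCoord x := hx
          rw [Set.indicator_of_mem hxS, Set.indicator_of_mem (hST x hx hxS hz),
            ← ENNReal.ofReal_mul hk0.le, ← ENNReal.ofReal_mul (by positivity)]
          apply ENNReal.ofReal_le_ofReal
          have h2 := kernel_le_mul_bdryKernel (a := a) h.b_pos.le h.κ_nonneg h.ρ_nonneg hx hz hzy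
          have e1 : ‖x‖ ^ (-b) * ‖x‖ ^ b = 1 := by rw [← Real.rpow_add hX]; simp
          calc _ = ‖x‖ ^ (-b) * (‖x‖ ^ b * ‖y‖ ^ a / ‖x - bdryEmb y‖ ^ (κ + ρ)) := by
                rw [mul_div_assoc, ← mul_assoc, e1, one_mul]
            _ ≤ ‖x‖ ^ (-b) * _ := mul_le_mul_of_nonneg_left h2 (by positivity)
            _ = _ := by rw [hk]; ring
        · rw [Set.indicator_of_notMem hxS]; exact zero_le
    _ = _ := by
        rw [mul_assoc, ← lintegral_const_mul' _ _ ENNReal.ofReal_ne_top, ← lintegral_indicator hT]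
        congr 1
        refine lintegral_congr fun z => ?_
        by_cases hz : z ∈ T
        · rw [Set.indicator_of_mem hz, Set.indicator_of_mem hz, mul_assoc]
        · rw [Set.indicator_of_notMem hz, Set.indicator_of_notMem hz, zero_mul]

theorem exists_isSubcriticalPair :
    ∃ C, IsSubcriticalPair a b κ ρ p q C (conicFst p u) (conicSnd a b κ ρ p u) := by
  obtain ⟨C, hC, h1⟩ := h.exists_potential_le
  have hu := h.measurable_u
  refine ⟨max 1 C, h.dim_pos, h.a_pos, h.b_pos, h.κ_nonneg, h.ρ_nonneg,
    h.a_add_b.trans h.add_eq.symm, h.one_lt_p, h.one_lt_q, h.ρ_lt,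
    (max_lt ENNReal.one_lt_top hC.lt_top).ne, by fun_prop, measurable_conicSnd hu,
    h.conicNorm_conicFst_ne_top, fun z => ?_, fun y => ?_⟩
  · exact le_mul_of_one_le_left zero_le (le_max_left _ _)
  · rcases eq_or_ne y 0 with rfl | hy
    · have hp := h.one_lt_p
      have : (0 : ℝ) < m / (p + 1) := by
        have : (0 : ℝ) < m := Nat.cast_pos.2 h.dim_pos
        positivity
      simp [conicFst, Real.zero_rpow this.ne']
    · rw [h.conicFst_eq hy]
      have h2 := h1 y Set.univ Set.univ .univ .univ fun x _ _ => Set.subset_univ _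
      rw [Set.univ_inter, setLIntegral_univ] at h2
      exact h2.trans (by gcongr; exact le_max_right _ _)

end IsSplitSystem

end

/-! ### Decay and integrability gained from the weight. -/

section

variable {m : ℕ} {a b κ ρ θ : ℝ}

theorem tendsto_const_mul_ofReal_rpow_zero {ι : Type*} {l : Filter ι} {K : ENNReal} (hK : K ≠ ⊤)
    {e : ℝ} (he : 0 < e) {r : ι → ℝ} (hr : Tendsto r l (𝓝 0)) :
    Tendsto (fun i => K * ENNReal.ofReal (r i ^ e)) l (𝓝 0) := by
  have h1 := hr.rpow_const (p := e) (Or.inr he.le)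
  rw [Real.zero_rpow he.ne'] at h1
  simpa using ENNReal.Tendsto.const_mul (ENNReal.tendsto_ofReal h1) (Or.inr hK)

/-- On the ball of radius R ≤ 1 the weight is at least R^(-θ), so the factor R^(θp) can be extracted
from the uniform bound for the weighted function. -/
theorem exists_setLIntegral_bdryKernel_le (hm : 0 < m) (ha : 0 < a) (hb : 0 < b)
    (hκ : 0 ≤ κ) (hρ : 0 ≤ ρ) (hab : a + b = κ + ρ) (hρm : ρ < m) {p : ℝ} (hp : 1 < p)
    (hθ : 0 ≤ θ) {g : Bdry m → ENNReal} (hg : Measurable g)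
    (hfin : ∀ s : ℝ, 0 < s → s ≤ 1 →
      conicNorm (fun y => ENNReal.ofReal (truncWeight θ 0 y) * g y) ((p + 1) / s) ≠ ⊤) :
    ∃ M : ENNReal, M ≠ ⊤ ∧ ∀ z R, R ≤ 1 → ∫⁻ y in {y : Bdry m | ‖y‖ ≤ R},
      ENNReal.ofReal (bdryKernel a b κ ρ z y) * g y ^ p ∂conicMeasure m ≤
        M * ENNReal.ofReal (R ^ (θ * p)) := by
  obtain ⟨M, hM, h1⟩ := exists_lintegral_bdryKernel_mul_rpow_le hm ha hb hκ hρ hab hρm hp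
    (g := fun y => ENNReal.ofReal (truncWeight θ 0 y) * g y) (by fun_prop) hfin
  refine ⟨M, hM, fun z R hR => ?_⟩
  have hms : MeasurableSet {y : Bdry m | ‖y‖ ≤ R} := measurableSet_le measurable_norm measurable_const
  rw [mul_comm M]
  refine le_trans ?_ (mul_le_mul_right (h1 z) _)
  rw [← lintegral_const_mul' _ _ ENNReal.ofReal_ne_top]
  refine le_trans (setLIntegral_mono' hms fun y hy => ?_) (setLIntegral_le_lintegral _ _)
  have hyR : ‖y‖ ≤ R := hy
  rcases eq_or_ne y 0 with rfl | hy0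
  · simp [bdryKernel_zero_right ha.ne']
  have hB := norm_pos_iff.2 hy0
  have hR0 : 0 < R := hB.trans_le hyR
  rw [truncWeight_zero_of_norm_le_one (hyR.trans hR), ofReal_mul_rpow (by positivity) (by linarith),
    mul_left_comm, ← mul_assoc (ENNReal.ofReal (R ^ _)), ← ENNReal.ofReal_mul (by positivity),
    ← Real.rpow_mul hB.le]
  gcongr
  refine le_mul_of_one_le_left zero_le ?_
  rw [ENNReal.one_le_ofReal, neg_mul, Real.rpow_neg hB.le, ← div_eq_mul_inv,
    one_le_div (by positivity)]
  exact Real.rpow_le_rpow hB.le hyR (by nlinarith)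

/-- Hölder's inequality pairs (weight·g)^q in L^((q+1)/q) with W = |z|^(-c) min(1,|z|)^(θq) in
L^(q+1). The latter converges at 0 because θq > c and at infinity because c > 0. -/
theorem lintegral_norm_rpow_mul_ne_top (hm : 0 < m) {q c : ℝ} (hq : 1 < q) (hc : 0 < c)
    (hcθ : c < θ * q) {g : Bdry m → ENNReal} (hg : Measurable g)
    (hfin : conicNorm (fun y => ENNReal.ofReal (truncWeight θ 0 y) * g y) (q + 1) ≠ ⊤) :
    ∫⁻ z, ENNReal.ofReal (‖z‖ ^ (-c)) * g z ^ q ∂conicMeasure m ≠ ⊤ := by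
  have hne : Nonempty (Fin m) := ⟨⟨0, hm⟩⟩
  have hq0 : 0 < q := by linarith
  have hfr : (Module.finrank ℝ (Bdry m) : ℝ) = m := by simp
  set W : Bdry m → ENNReal := fun z => ENNReal.ofReal (‖z‖ ^ (-c) * min 1 ‖z‖ ^ (θ * q)) with hW
  have hWm : Measurable W := by rw [hW]; fun_prop
  have hWfin : ∫⁻ z, W z ^ (q + 1) ∂conicMeasure m ≠ ⊤ := by
    obtain ⟨C1, hC1, h1⟩ := exists_setLIntegral_ball_norm_rpow_le (volume : Measure (Bdry m))
      (s := m - (θ * q - c) * (q + 1)) (by rw [hfr]; nlinarith)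
    obtain ⟨C2, hC2, h2⟩ := exists_setLIntegral_norm_ge_norm_rpow_le (volume : Measure (Bdry m))
      (s := m + c * (q + 1)) (by rw [hfr]; nlinarith)
    have hms : MeasurableSet {y : Bdry m | ‖y‖ < 1} := measurableSet_lt measurable_norm measurable_const
    rw [lintegral_conicMeasure (by fun_prop), ← lintegral_add_compl _ hms]
    refine ENNReal.add_ne_top.2 ⟨?_, ?_⟩
    · refine ne_top_of_le_ne_top (ENNReal.mul_ne_top hC1 ENNReal.ofReal_ne_top)
        (le_trans (lintegral_mono_ae ?_) (h1 1 one_pos))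
      filter_upwards [ae_restrict_mem hms, ae_restrict_of_ae (ae_ne_zero_bdry hm)] with z hz hz0
      have hB := norm_pos_iff.2 hz0
      have hz1 : ‖z‖ < 1 := hz
      simp only [hW]
      rw [min_eq_right hz1.le, ← Real.rpow_add hB, ENNReal.ofReal_rpow_of_nonneg (by positivity)
        (by linarith), ← Real.rpow_mul hB.le, ← ENNReal.ofReal_mul (by positivity),
        ← Real.rpow_add hB]
      refine le_of_eq ?_
      congr 2; ring
    · refine ne_top_of_le_ne_top (ENNReal.mul_ne_top hC2 ENNReal.ofReal_ne_top)
        (le_trans (le_of_eq ?_) (h2 1 one_pos))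
      have hset : {y : Bdry m | ‖y‖ < 1}ᶜ = {y : Bdry m | 1 ≤ ‖y‖} := by ext; simp
      rw [hset]
      refine setLIntegral_congr_fun (hset ▸ hms.compl) fun z hz => ?_
      have hz1 : 1 ≤ ‖z‖ := hz
      have hB : 0 < ‖z‖ := by linarith
      simp only [hW]
      rw [min_eq_left hz1, Real.one_rpow, mul_one, ENNReal.ofReal_rpow_of_nonneg (by positivity)
        (by linarith), ← Real.rpow_mul hB.le, ← ENNReal.ofReal_mul (by positivity),
        ← Real.rpow_add hB]
      congr 2; ring
  have hconj : Real.HolderConjugate (q + 1) ((q + 1) / q) := by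
    have := Real.HolderConjugate.conjExponent (show (1 : ℝ) < q + 1 by linarith)
    rwa [Real.conjExponent, add_sub_cancel_right] at this
  have hprod : ∫⁻ z, W z * (ENNReal.ofReal (truncWeight θ 0 z) * g z) ^ q ∂conicMeasure m ≠ ⊤ := by
    refine ne_top_of_le_ne_top ?_ (ENNReal.lintegral_mul_le_Lp_mul_Lq _ hconj hWm.aemeasurable
      (by fun_prop))
    refine ENNReal.mul_ne_top (ENNReal.rpow_ne_top_of_nonneg (by positivity) hWfin) ?_
    have h3 : conicNorm (fun z => (ENNReal.ofReal (truncWeight θ 0 z) * g z) ^ q) ((q + 1) / q) ≠ ⊤ := by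
      rw [conicNorm_rpow hq0]
      exact ENNReal.rpow_ne_top_of_nonneg hq0.le hfin
    exact h3
  refine ne_top_of_le_ne_top hprod (lintegral_mono_ae ?_)
  filter_upwards [ae_conicMeasure_ne_zero hm] with z hz0
  have hB := norm_pos_iff.2 hz0
  have hmin : 0 < min 1 ‖z‖ := lt_min one_pos hB
  refine le_of_eq ?_
  simp only [hW, truncWeight]
  rw [max_eq_right hmin.le, ofReal_mul_rpow (by positivity) hq0.le, ← mul_assoc,
    ← ENNReal.ofReal_mul (by positivity), mul_assoc, ← Real.rpow_mul hmin.le, ← Real.rpow_add hmin]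
  simp

end

/-! ### Finiteness criterion, near parts and the two limits. -/

section

variable {m : ℕ} {lam μ α β p q a b κ ρ θ : ℝ} {u : Bdry m → ENNReal} {v : Amb m → ENNReal}

/-- The interval (a/q, min(a, b)) is nonempty exactly because q > 1 and a < qb. -/
theorem exists_weight_exponent (ha : 0 < a) (hq : 1 < q) (hab : a < q * b) :
    ∃ θ : ℝ, 0 ≤ θ ∧ θ < a ∧ θ < b ∧ a < θ * q := by
  have hq0 : 0 < q := by linarith
  have h1 : a / q < min a b := lt_min (div_lt_self ha hq) (by rw [div_lt_iff₀ hq0]; linarith)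
  obtain ⟨θ, h2, h3⟩ := exists_between h1
  refine ⟨θ, (by positivity : 0 ≤ a / q).trans h2.le, h3.trans_le (min_le_left _ _),
    h3.trans_le (min_le_right _ _), (div_lt_iff₀ hq0).1 h2⟩

namespace IsSplitSystem

variable (h : IsSplitSystem lam μ α β p q a b κ ρ u v)
include h

/-- Since b(q+1) = m+1 - (β-λ)(q+1) and a+b = μ, the inequality qb ≤ a is the divergence condition;
the complementary case is shown to be finite below. -/
theorem lintegral_interiorDensity_eq_top_of_le (hba : q * b ≤ a) :
    ∫⁻ x in halfSpace m, interiorDensity lam β q v x * ENNReal.ofReal (‖x‖ ^ (-μ)) = ⊤ := by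
  refine h.lintegral_interiorDensity_eq_top ?_
  have hq := h.one_lt_q
  have h1 : ((m : ℝ) + 1) / (q + 1) * (q + 1) = m + 1 := by field_simp
  have h2 := h.b_eq
  have h3 := h.a_add_b
  have h4 : b * (q + 1) = m + 1 - (β - lam) * (q + 1) := by rw [h2, sub_mul, h1]
  linarith

theorem lintegral_bdryDensity_eq_top_of_le (hba : p * a ≤ b) :
    ∫⁻ y, bdryDensity α p u y * ENNReal.ofReal (‖y‖ ^ (-μ)) = ⊤ := by
  refine h.lintegral_bdryDensity_eq_top ?_
  have hp := h.one_lt_p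
  have h1 : (m : ℝ) / (p + 1) * (p + 1) = m := by field_simp
  have h2 := h.a_eq
  have h3 := h.a_add_b
  have h4 : a * (p + 1) = m - α * (p + 1) := by rw [h2, sub_mul, h1]
  linarith

/-- Split |x|^(-μ) = |x|^(-b)|x|^(-a). The first factor is the one consumed by the reduction to the
boundary, and on the shadow the second is at most 2^a |z|^(-a), which the weighted bound for the
boundary potential integrates. -/
theorem lintegral_interiorDensity_ne_top (hab : a < q * b) :
    ∫⁻ x in halfSpace m, interiorDensity lam β q v x * ENNReal.ofReal (‖x‖ ^ (-μ)) ≠ ⊤ := by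
  have ha := h.a_pos
  have hu := h.measurable_u
  obtain ⟨θ, hθ, hθa, hθb, hθq⟩ := exists_weight_exponent h.a_pos h.one_lt_q hab
  obtain ⟨C', hC'⟩ := h.exists_isSubcriticalPair
  obtain ⟨C, hC, h1⟩ := h.exists_setLIntegral_interiorDensity_le
  have h2 := lintegral_norm_rpow_mul_ne_top h.dim_pos h.one_lt_q h.a_pos hθq
    (measurable_conicSnd hu) (hC'.weighted_norm_ne_top hθ hθa hθb).2
  refine ne_top_of_le_ne_top ?_ (h1 _ (fun z => ENNReal.ofReal (2 ^ a) *
    ENNReal.ofReal (‖z‖ ^ (-a))) (by fun_prop) fun x hx => ae_of_all _ fun z hz => ?_)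
  · refine ENNReal.mul_ne_top hC ?_
    simp_rw [mul_assoc]
    rw [lintegral_const_mul' _ _ ENNReal.ofReal_ne_top]
    exact ENNReal.mul_ne_top ENNReal.ofReal_ne_top h2
  · have hX := norm_pos_of_mem_halfSpace hx
    have hx0 : 0 < lastCoord x := hx
    have hz0 : 0 < ‖z‖ := by have := hz.2; linarith
    rw [← ENNReal.ofReal_mul (by positivity), ← ENNReal.ofReal_mul (by positivity)]
    apply ENNReal.ofReal_le_ofReal
    have hτ : 1 ≤ (lastCoord x / ‖x‖) ^ (-κ) :=
      Real.one_le_rpow_of_pos_of_le_one_of_nonpos (by positivity)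
        ((div_le_one hX).2 (lastCoord_le_norm x)) (by linarith [h.κ_nonneg])
    have h3 : ‖x‖ ^ (-a) ≤ (‖z‖ / 2) ^ (-a) :=
      Real.rpow_le_rpow_of_nonpos (by positivity) (by linarith [norm_le_of_mem_shadow hz])
        (by linarith)
    rw [Real.div_rpow hz0.le two_pos.le, Real.rpow_neg two_pos.le, div_inv_eq_mul, mul_comm] at h3
    calc ‖x‖ ^ (-μ) = ‖x‖ ^ (-b) * 1 * ‖x‖ ^ (-a) := by
          rw [mul_one, ← Real.rpow_add hX, ← h.a_add_b]; congr 1; ring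
      _ ≤ _ := by gcongr

theorem lintegral_bdryDensity_ne_top (hab : b < p * a) :
    ∫⁻ y, bdryDensity α p u y * ENNReal.ofReal (‖y‖ ^ (-μ)) ≠ ⊤ := by
  have hu := h.measurable_u
  obtain ⟨θ, hθ, hθb, hθa, hθp⟩ := exists_weight_exponent h.b_pos h.one_lt_p hab
  obtain ⟨C', hC'⟩ := h.exists_isSubcriticalPair
  have h2 := lintegral_norm_rpow_mul_ne_top h.dim_pos h.one_lt_p h.b_pos hθp
    (measurable_conicFst hu) (hC'.weighted_norm_ne_top hθ hθa hθb).1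
  rw [h.lintegral_bdryDensity_mul (by fun_prop)]
  refine ne_top_of_le_ne_top h2 (lintegral_mono_ae ?_)
  filter_upwards [ae_conicMeasure_ne_zero h.dim_pos] with y hy
  have hB := norm_pos_iff.2 hy
  rw [← ENNReal.ofReal_mul (by positivity), ← Real.rpow_add hB, ← h.a_add_b]
  refine le_of_eq ?_
  congr 3; ring

theorem tendsto_setLIntegral_near_bdry (hab : a < q * b) :
    Tendsto (fun y : Bdry m => ∫⁻ x in {x : Amb m | ‖x - bdryEmb y‖ < ‖x‖ / 2},
      interiorDensity lam β q v x * ENNReal.ofReal (‖x - bdryEmb y‖ ^ (-μ))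
        ∂volume.restrict (halfSpace m)) (𝓝[≠] 0) (𝓝 0) := by
  have hu := h.measurable_u
  obtain ⟨θ, hθ, hθa, hθb, hθq⟩ := exists_weight_exponent h.a_pos h.one_lt_q hab
  obtain ⟨C', hC'⟩ := h.exists_isSubcriticalPair
  obtain ⟨C, hC, h1⟩ := h.exists_potential_le
  obtain ⟨M, hM, h2⟩ := exists_setLIntegral_bdryKernel_le h.dim_pos h.b_pos h.a_pos h.κ_nonneg
    h.ρ_nonneg ((add_comm b a).trans (h.a_add_b.trans h.add_eq.symm)) h.ρ_lt_dim h.one_lt_q hθ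
    (measurable_conicSnd (a := a) (b := b) (κ := κ) (ρ := ρ) (p := p) hu)
    fun s hs hs1 => (hC'.weighted_norm_div_ne_top hθ hθa hθb hs hs1).2
  have hlim : Tendsto (fun y : Bdry m => C * M * ENNReal.ofReal (4 ^ (θ * q)) *
      ENNReal.ofReal (‖y‖ ^ (θ * q - a))) (𝓝[≠] 0) (𝓝 0) := by
    refine tendsto_const_mul_ofReal_rpow_zero (by finiteness) (by linarith) ?_
    exact tendsto_norm_zero.mono_left nhdsWithin_le_nhds
  refine tendsto_of_tendsto_of_tendsto_of_le_of_le' tendsto_const_nhds hlim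
    (Eventually.of_forall fun _ => zero_le) ?_
  have hball : ∀ᶠ y : Bdry m in 𝓝[≠] 0, ‖y‖ < 1 / 4 :=
    (tendsto_norm_zero.mono_left nhdsWithin_le_nhds).eventually (gt_mem_nhds (by norm_num))
  filter_upwards [hball, self_mem_nhdsWithin] with y hy4 hy0
  have hB : 0 < ‖y‖ := norm_pos_iff.2 hy0
  have hms : MeasurableSet {x : Amb m | ‖x - bdryEmb y‖ < ‖x‖ / 2} :=
    measurableSet_lt (by fun_prop) (by fun_prop)
  -- In the near region |x| < 2|y|, so shadows lie in the ball of radius 4|y|. The decay there,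
  -- divided by |y|^a, leaves |y|^(θq-a).
  have h3 := h1 y {x : Amb m | ‖x - bdryEmb y‖ < ‖x‖ / 2} {z | ‖z‖ ≤ 4 * ‖y‖} hms
    (measurableSet_le measurable_norm measurable_const) (fun x _ hxS z hz => by
      have hxS : ‖x - bdryEmb y‖ < ‖x‖ / 2 := hxS
      have h4 := norm_sub_norm_le x (bdryEmb y)
      rw [norm_bdryEmb] at h4
      have h5 := norm_le_of_mem_shadow hz
      show ‖z‖ ≤ 4 * ‖y‖
      linarith)
  simp_rw [bdryKernel_swap _ y] at h3
  have h4 := h3.trans (mul_le_mul_right (h2 y (4 * ‖y‖) (by linarith)) C)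
  rw [← Measure.restrict_restrict hms] at h4
  have h5 : ENNReal.ofReal (‖y‖ ^ (-a)) * ENNReal.ofReal (‖y‖ ^ a) = 1 := by
    rw [← ENNReal.ofReal_mul (by positivity), ← Real.rpow_add hB]; simp
  have h6 := mul_le_mul_right h4 (ENNReal.ofReal (‖y‖ ^ (-a)))
  rw [← mul_assoc, h5, one_mul] at h6
  refine h6.trans (le_of_eq ?_)
  rw [Real.mul_rpow (by norm_num) hB.le, ENNReal.ofReal_mul (by positivity), sub_eq_neg_add,
    Real.rpow_add hB, ENNReal.ofReal_mul (by positivity)]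
  ring

/-- No shadow is needed: in the near region x_n < |y|/2 < |x'|, so |x| ≤ 2|x'| and x can be replaced
by x'. The whole singularity then sits on the boundary diagonal, that is κ = 0 and ρ = μ, which
calls for μ < m. -/
theorem tendsto_setLIntegral_near_interior (hμm : μ < m) (hab : b < p * a) :
    Tendsto (fun x : Amb m => ∫⁻ y in {y : Bdry m | ‖x - bdryEmb y‖ < ‖y‖ / 2},
      bdryDensity α p u y * ENNReal.ofReal (‖x - bdryEmb y‖ ^ (-μ))) (𝓝[halfSpace m] 0) (𝓝 0) := by
  have hu := h.measurable_u
  have hb := h.b_pos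
  obtain ⟨θ, hθ, hθb, hθa, hθp⟩ := exists_weight_exponent h.b_pos h.one_lt_p hab
  obtain ⟨C', hC'⟩ := h.exists_isSubcriticalPair
  obtain ⟨M, hM, h2⟩ := exists_setLIntegral_bdryKernel_le h.dim_pos h.a_pos h.b_pos le_rfl
    h.μ_pos.le (h.a_add_b.trans (zero_add μ).symm) hμm h.one_lt_p hθ
    (measurable_conicFst (p := p) hu)
    fun s hs hs1 => (hC'.weighted_norm_div_ne_top hθ hθa hθb hs hs1).1
  have hlim : Tendsto (fun x : Amb m => ENNReal.ofReal (2 ^ b) * M * ENNReal.ofReal (2 ^ (θ * p)) *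
      ENNReal.ofReal (‖x‖ ^ (θ * p - b))) (𝓝[halfSpace m] 0) (𝓝 0) := by
    refine tendsto_const_mul_ofReal_rpow_zero (by finiteness) (by linarith) ?_
    exact tendsto_norm_zero.mono_left nhdsWithin_le_nhds
  refine tendsto_of_tendsto_of_tendsto_of_le_of_le' tendsto_const_nhds hlim
    (Eventually.of_forall fun _ => zero_le) ?_
  have hball : ∀ᶠ x : Amb m in 𝓝[halfSpace m] 0, ‖x‖ < 1 / 2 :=
    (tendsto_norm_zero.mono_left nhdsWithin_le_nhds).eventually (gt_mem_nhds (by norm_num))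
  filter_upwards [hball, self_mem_nhdsWithin] with x hx2 hx
  have hX := norm_pos_of_mem_halfSpace hx
  have hx0 : 0 < lastCoord x := hx
  have hms : MeasurableSet {y : Bdry m | ‖x - bdryEmb y‖ < ‖y‖ / 2} :=
    measurableSet_lt (by fun_prop) (by fun_prop)
  have hms2 : MeasurableSet {y : Bdry m | ‖y‖ ≤ 2 * ‖x‖} :=
    measurableSet_le measurable_norm measurable_const
  calc ∫⁻ y in {y : Bdry m | ‖x - bdryEmb y‖ < ‖y‖ / 2},
        bdryDensity α p u y * ENNReal.ofReal (‖x - bdryEmb y‖ ^ (-μ))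
      = ∫⁻ y, ENNReal.ofReal (‖y‖ ^ a) * {y : Bdry m | ‖x - bdryEmb y‖ < ‖y‖ / 2}.indicator
          (fun y => ENNReal.ofReal (‖x - bdryEmb y‖ ^ (-μ))) y * conicFst p u y ^ p
            ∂conicMeasure m := by
        rw [← h.lintegral_bdryDensity_mul (Measurable.indicator (by fun_prop) hms),
          ← lintegral_indicator hms]
        refine lintegral_congr fun y => ?_
        rw [Set.indicator_apply, Set.indicator_apply, mul_ite, mul_zero]
    _ ≤ ∫⁻ y in {y : Bdry m | ‖y‖ ≤ 2 * ‖x‖}, ENNReal.ofReal (2 ^ b * ‖x‖ ^ (-b)) *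
          (ENNReal.ofReal (bdryKernel a b 0 μ (tangential x) y) * conicFst p u y ^ p)
            ∂conicMeasure m := by
        rw [← lintegral_indicator hms2]
        refine lintegral_mono_ae ?_
        filter_upwards [conicMeasure_absolutelyContinuous m (ae_ne_bdry h.dim_pos (tangential x))]
          with y hy
        by_cases hyS : ‖x - bdryEmb y‖ < ‖y‖ / 2
        · have h4 := norm_sub_norm_le (bdryEmb y) x
          rw [norm_bdryEmb, norm_sub_rev] at h4
          have h5 := norm_sub_norm_le y (tangential x)
          rw [norm_sub_rev] at h5
          have h6 := norm_tangential_sub_le x y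
          have h7 := lastCoord_le_norm_sub x y
          have h8 := norm_le_tangential_add hx
          have hd : 0 < ‖tangential x - y‖ := norm_pos_iff.2 (sub_ne_zero.2 (Ne.symm hy))
          have ht : 0 < ‖tangential x‖ := by linarith
          have hy2 : y ∈ {y : Bdry m | ‖y‖ ≤ 2 * ‖x‖} := by
            show ‖y‖ ≤ 2 * ‖x‖
            linarith
          rw [Set.indicator_of_mem (show y ∈ {y : Bdry m | ‖x - bdryEmb y‖ < ‖y‖ / 2} from hyS),
            Set.indicator_of_mem hy2, ← mul_assoc, ← ENNReal.ofReal_mul (by positivity),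
            ← ENNReal.ofReal_mul (by positivity)]
          gcongr ENNReal.ofReal ?_ * _
          unfold bdryKernel
          rw [Real.rpow_zero, one_mul, div_eq_mul_inv, ← Real.rpow_neg hd.le]
          have h9 : ‖x - bdryEmb y‖ ^ (-μ) ≤ ‖tangential x - y‖ ^ (-μ) :=
            Real.rpow_le_rpow_of_nonpos hd h6 (by linarith [h.μ_pos])
          have h10 : ‖x‖ ^ b ≤ (2 * ‖tangential x‖) ^ b :=
            Real.rpow_le_rpow hX.le (by linarith) hb.le
          rw [Real.mul_rpow two_pos.le ht.le] at h10
          have e1 : ‖x‖ ^ (-b) * ‖x‖ ^ b = 1 := by rw [← Real.rpow_add hX]; simp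
          calc ‖y‖ ^ a * ‖x - bdryEmb y‖ ^ (-μ)
              = (‖x‖ ^ (-b) * ‖x‖ ^ b) * (‖y‖ ^ a * ‖x - bdryEmb y‖ ^ (-μ)) := by
                rw [e1, one_mul]
            _ ≤ (‖x‖ ^ (-b) * (2 ^ b * ‖tangential x‖ ^ b)) *
                (‖y‖ ^ a * ‖tangential x - y‖ ^ (-μ)) := by gcongr
            _ = _ := by ring
        · rw [Set.indicator_of_notMem (show y ∉ {y : Bdry m | ‖x - bdryEmb y‖ < ‖y‖ / 2} from hyS),
            mul_zero, zero_mul]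
          exact zero_le
    _ ≤ ENNReal.ofReal (2 ^ b * ‖x‖ ^ (-b)) * (M * ENNReal.ofReal ((2 * ‖x‖) ^ (θ * p))) := by
        rw [lintegral_const_mul' _ _ ENNReal.ofReal_ne_top]
        gcongr
        exact h2 _ _ (by linarith)
    _ = _ := by
        rw [Real.mul_rpow two_pos.le hX.le, ENNReal.ofReal_mul (by positivity),
          ENNReal.ofReal_mul (by positivity), sub_eq_neg_add, Real.rpow_add hX,
          ENNReal.ofReal_mul (by positivity)]
        ring

/-- Either the limit integral is infinite and Fatou applies, or it is finite, whence a < qb and the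
near part vanishes in the limit. -/
theorem tendsto_fst : Tendsto (fun y => ENNReal.ofReal (‖y‖ ^ α) * u y) (𝓝[≠] 0)
    (𝓝 (∫⁻ x in halfSpace m, interiorDensity lam β q v x * ENNReal.ofReal (‖x‖ ^ (-μ)))) := by
  have hv := h.measurable_v
  have hN : ∀ᵐ x ∂volume.restrict (halfSpace m), 0 < ‖x‖ :=
    (ae_restrict_iff' measurableSet_halfSpace).2 (ae_of_all _ fun x => norm_pos_of_mem_halfSpace)
  have hDN : ∀ x : Amb m, Tendsto (fun y => ‖x - bdryEmb y‖) (𝓝[≠] (0 : Bdry m)) (𝓝 ‖x‖) := by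
    intro x
    have : Continuous fun y : Bdry m => ‖x - bdryEmb y‖ := by fun_prop
    simpa [bdryEmb_zero] using (this.tendsto 0).mono_left nhdsWithin_le_nhds
  have hlim : Tendsto (fun y => ∫⁻ x in halfSpace m, interiorDensity lam β q v x *
      ENNReal.ofReal (‖x - bdryEmb y‖ ^ (-μ))) (𝓝[≠] 0)
      (𝓝 (∫⁻ x in halfSpace m, interiorDensity lam β q v x * ENNReal.ofReal (‖x‖ ^ (-μ)))) := by
    by_cases htop : ∫⁻ x in halfSpace m, interiorDensity lam β q v x * ENNReal.ofReal (‖x‖ ^ (-μ)) = ⊤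
    · rw [htop]
      exact tendsto_lintegral_potential_top (by fun_prop) (fun y => by fun_prop) hN
        (ae_of_all _ hDN) htop
    · refine tendsto_lintegral_potential (by fun_prop) (fun y => by fun_prop) measurable_norm
        h.μ_pos.le hN (ae_of_all _ hDN) htop (h.tendsto_setLIntegral_near_bdry ?_)
      by_contra hcon
      exact htop (h.lintegral_interiorDensity_eq_top_of_le (not_lt.1 hcon))
  refine hlim.congr' ?_
  filter_upwards [self_mem_nhdsWithin] with y hy
  exact (h.u_eq y hy).symm

theorem tendsto_snd (hμm : μ < m) :
    Tendsto (fun x => ENNReal.ofReal (‖x‖ ^ β * lastCoord x ^ (-lam)) * v x) (𝓝[halfSpace m] 0)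
      (𝓝 (∫⁻ y, bdryDensity α p u y * ENNReal.ofReal (‖y‖ ^ (-μ)))) := by
  have hu := h.measurable_u
  have hN : ∀ᵐ y : Bdry m, 0 < ‖y‖ :=
    (ae_ne_zero_bdry h.dim_pos).mono fun y hy => norm_pos_iff.2 hy
  have hDN : ∀ y : Bdry m, Tendsto (fun x => ‖x - bdryEmb y‖) (𝓝[halfSpace m] (0 : Amb m))
      (𝓝 ‖y‖) := by
    intro y
    have : Continuous fun x : Amb m => ‖x - bdryEmb y‖ := by fun_prop
    simpa [norm_bdryEmb] using (this.tendsto 0).mono_left nhdsWithin_le_nhds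
  have hlim : Tendsto (fun x => ∫⁻ y, bdryDensity α p u y *
      ENNReal.ofReal (‖x - bdryEmb y‖ ^ (-μ))) (𝓝[halfSpace m] 0)
      (𝓝 (∫⁻ y, bdryDensity α p u y * ENNReal.ofReal (‖y‖ ^ (-μ)))) := by
    by_cases htop : ∫⁻ y, bdryDensity α p u y * ENNReal.ofReal (‖y‖ ^ (-μ)) = ⊤
    · rw [htop]
      exact tendsto_lintegral_potential_top (by fun_prop) (fun y => by fun_prop) hN
        (ae_of_all _ hDN) htop
    · refine tendsto_lintegral_potential (by fun_prop) (fun y => by fun_prop) measurable_norm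
        h.μ_pos.le hN (ae_of_all _ hDN) htop (h.tendsto_setLIntegral_near_interior hμm ?_)
      by_contra hcon
      exact htop (h.lintegral_bdryDensity_eq_top_of_le (not_lt.1 hcon))
  refine hlim.congr' ?_
  filter_upwards [self_mem_nhdsWithin] with x hx
  exact (h.v_eq x hx).symm

end IsSplitSystem

end

/-! ### From real-valued solutions to measurable extended ones. -/

section

variable {m : ℕ} {lam μ α β p q : ℝ} {u : Bdry m → ENNReal} {v : Amb m → ENNReal}

theorem measurable_lintegral_interiorDensity_mul (hv : Measurable v) : Measurable fun y : Bdry m =>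
    ∫⁻ x in halfSpace m, interiorDensity lam β q v x *
      ENNReal.ofReal (‖x - bdryEmb y‖ ^ (-μ)) := by
  refine Measurable.lintegral_prod_right' (f := fun w : Bdry m × Amb m =>
    interiorDensity lam β q v w.2 * ENNReal.ofReal (‖w.2 - bdryEmb w.1‖ ^ (-μ))) ?_
  have := measurable_interiorDensity (lam := lam) (β := β) (q := q) hv
  fun_prop

theorem measurable_lintegral_bdryDensity_mul (hu : Measurable u) : Measurable fun x : Amb m =>
    ∫⁻ y, bdryDensity α p u y * ENNReal.ofReal (‖x - bdryEmb y‖ ^ (-μ)) := by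
  refine Measurable.lintegral_prod_right' (f := fun w : Amb m × Bdry m =>
    bdryDensity α p u w.2 * ENNReal.ofReal (‖w.1 - bdryEmb w.2‖ ^ (-μ))) ?_
  have := measurable_bdryDensity (α := α) (p := p) hu
  fun_prop

end

section

variable {m : ℕ} {lam μ α β p q : ℝ} {u : Bdry m → ℝ} {v : Amb m → ℝ}

theorem lintegral_ofReal_rpow_ne_top {X : Type*} [MeasurableSpace X] {ν : Measure X} {f : X → ℝ}
    {s : ℝ} (hs : 0 < s) (hf : MemLp f (ENNReal.ofReal s) ν) :
    ∫⁻ x, ENNReal.ofReal (f x) ^ s ∂ν ≠ ⊤ := by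
  have h := lintegral_rpow_enorm_lt_top_of_eLpNorm_lt_top
    (by simpa using hs) ENNReal.ofReal_ne_top hf.2
  rw [ENNReal.toReal_ofReal hs.le] at h
  refine ne_top_of_le_ne_top h.ne (lintegral_mono fun x => ?_)
  gcongr
  rw [Real.enorm_eq_ofReal_abs]
  exact ENNReal.ofReal_le_ofReal (le_abs_self _)

theorem interiorDensity_ofReal_mul (hq : 0 ≤ q) {x : Amb m} (hx : x ∈ halfSpace m)
    (hvx : 0 ≤ v x) (D : ℝ) : interiorDensity lam β q (fun x => ENNReal.ofReal (v x)) x *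
      ENNReal.ofReal (D ^ (-μ)) =
        ENNReal.ofReal (‖x‖ ^ (-β) * lastCoord x ^ lam * v x ^ q * D ^ (-μ)) := by
  have hX := norm_pos_of_mem_halfSpace hx
  have hx0 : 0 < lastCoord x := hx
  unfold interiorDensity
  rw [ENNReal.ofReal_rpow_of_nonneg hvx hq, ← ENNReal.ofReal_mul (by positivity),
    ← ENNReal.ofReal_mul (by positivity)]

theorem bdryDensity_ofReal_mul (hp : 0 ≤ p) {y : Bdry m} (huy : 0 ≤ u y) (D : ℝ) :
    bdryDensity α p (fun y => ENNReal.ofReal (u y)) y * ENNReal.ofReal (D ^ (-μ)) =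
      ENNReal.ofReal (‖y‖ ^ (-α) * u y ^ p * D ^ (-μ)) := by
  unfold bdryDensity
  rw [ENNReal.ofReal_rpow_of_nonneg huy hp, ← ENNReal.ofReal_mul (by positivity),
    ← ENNReal.ofReal_mul (by positivity)]

namespace IsPositiveSolution

variable (h : IsPositiveSolution lam μ α β p q u v)
include h

theorem ofReal_fst_eq (hq : 0 ≤ q) {y : Bdry m} (hy : y ≠ 0) : ENNReal.ofReal (u y) =
    ENNReal.ofReal (‖y‖ ^ (-α)) * ∫⁻ x in halfSpace m,
      interiorDensity lam β q (fun x => ENNReal.ofReal (v x)) x *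
        ENNReal.ofReal (‖x - bdryEmb y‖ ^ (-μ)) := by
  rw [h.u_eq y hy, ← lintegral_const_mul' _ _ ENNReal.ofReal_ne_top]
  refine setLIntegral_congr_fun measurableSet_halfSpace fun x hx => ?_
  rw [interiorDensity_ofReal_mul hq hx (h.v_pos x hx).le, ← ENNReal.ofReal_mul (by positivity),
    kernelP_eq, Real.rpow_neg (norm_nonneg (x - _))]
  congr 1; ring

theorem ofReal_snd_eq (hm : 0 < m) (hp : 0 ≤ p) {x : Amb m} (hx : x ∈ halfSpace m) :
    ENNReal.ofReal (v x) = ENNReal.ofReal (‖x‖ ^ (-β) * lastCoord x ^ lam) *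
      ∫⁻ y, bdryDensity α p (fun y => ENNReal.ofReal (u y)) y *
        ENNReal.ofReal (‖x - bdryEmb y‖ ^ (-μ)) := by
  have hX := norm_pos_of_mem_halfSpace hx
  have hx0 : 0 < lastCoord x := hx
  rw [h.v_eq x hx, ← lintegral_const_mul' _ _ ENNReal.ofReal_ne_top]
  refine lintegral_congr_ae ?_
  filter_upwards [ae_ne_zero_bdry hm] with y hy
  rw [bdryDensity_ofReal_mul hp (h.u_pos y hy).le, ← ENNReal.ofReal_mul (by positivity),
    kernelP_eq, Real.rpow_neg (norm_nonneg (x - _))]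
  congr 1; ring

/-- Positive solutions agree with measurable `[0, ∞]`-valued ones. -/
theorem exists_isSystem (hm : 0 < m) (hlam : 0 ≤ lam) (hα : 0 < α) (hβ : 0 < β) (hμ : 0 < μ)
    (hp : 1 < p) (hq : 1 < q)
    (hcrit : m / (p + 1) + ((m : ℝ) + 1) / (q + 1) = α + β + μ - lam)
    (hu : MemLp u (ENNReal.ofReal (p + 1)) volume)
    (hv : MemLp v (ENNReal.ofReal (q + 1)) (volume.restrict (halfSpace m))) :
    ∃ (U : Bdry m → ENNReal) (V : Amb m → ENNReal), IsSystem lam μ α β p q U V ∧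
      (∀ y, y ≠ 0 → U y = ENNReal.ofReal (u y)) ∧
      ∀ x ∈ halfSpace m, V x = ENNReal.ofReal (v x) := by
  have hp0 : 0 ≤ p := by linarith
  have hq0 : 0 ≤ q := by linarith
  have hva : AEMeasurable v (volume.restrict (halfSpace m)) := hv.1.aemeasurable
  -- The given functions are only a.e. measurable. U is built from a measurable representative of v
  -- through the first equation, and V from U through the second. The integrals ignore null sets, so
  -- U and V equal the given functions at every y ≠ 0 and every x in the half space.
  set V₀ : Amb m → ENNReal := fun x => ENNReal.ofReal (hva.mk v x) with hV₀
  have hV₀m : Measurable V₀ := hva.measurable_mk.ennreal_ofReal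
  set U : Bdry m → ENNReal := fun y => ENNReal.ofReal (‖y‖ ^ (-α)) * ∫⁻ x in halfSpace m,
    interiorDensity lam β q V₀ x * ENNReal.ofReal (‖x - bdryEmb y‖ ^ (-μ)) with hUdef
  have hUm : Measurable U := by
    have := measurable_lintegral_interiorDensity_mul (lam := lam) (μ := μ) (β := β) (q := q) hV₀m
    fun_prop
  have hU : ∀ y, y ≠ 0 → U y = ENNReal.ofReal (u y) := by
    intro y hy
    rw [h.ofReal_fst_eq hq0 hy]
    simp only [hUdef]
    congr 1
    refine lintegral_congr_ae ?_
    filter_upwards [hva.ae_eq_mk] with x hx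
    simp only [interiorDensity, hV₀, hx]
  have hUae : ∀ᵐ y : Bdry m, U y = ENNReal.ofReal (u y) :=
    (ae_ne_zero_bdry hm).mono hU
  set V : Amb m → ENNReal := fun x => ENNReal.ofReal (‖x‖ ^ (-β) * lastCoord x ^ lam) *
    ∫⁻ y, bdryDensity α p U y * ENNReal.ofReal (‖x - bdryEmb y‖ ^ (-μ)) with hVdef
  have hVm : Measurable V := by
    have := measurable_lintegral_bdryDensity_mul (μ := μ) (α := α) (p := p) hUm
    fun_prop
  have hV : ∀ x ∈ halfSpace m, V x = ENNReal.ofReal (v x) := by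
    intro x hx
    rw [h.ofReal_snd_eq hm hp0 hx]
    simp only [hVdef]
    congr 1
    refine lintegral_congr_ae ?_
    filter_upwards [hUae] with y hy
    simp only [bdryDensity, hy]
  refine ⟨U, V, ⟨hm, hlam, hα, hβ, hμ, hp, hq, hcrit, hUm, hVm, fun y hy => ?_, fun x hx => ?_,
    fun y hy => ?_, fun x hx => ?_, ?_, ?_⟩, hU, hV⟩
  · rw [hU y hy]
    simpa using h.u_pos y hy
  · rw [hV x hx]
    simpa using h.v_pos x hx
  · have hB := norm_pos_iff.2 hy
    rw [hU y hy, h.ofReal_fst_eq hq0 hy, ← mul_assoc, ← ENNReal.ofReal_mul (by positivity),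
      ← Real.rpow_add hB, add_neg_cancel, Real.rpow_zero, ENNReal.ofReal_one, one_mul]
    refine setLIntegral_congr_fun measurableSet_halfSpace fun x hx => ?_
    simp only [interiorDensity, hV x hx]
  · have hX := norm_pos_of_mem_halfSpace hx
    have hx0 : 0 < lastCoord x := hx
    have e1 : ‖x‖ ^ β * lastCoord x ^ (-lam) * (‖x‖ ^ (-β) * lastCoord x ^ lam) = 1 := by
      rw [mul_mul_mul_comm, ← Real.rpow_add hX, ← Real.rpow_add hx0]; simp
    simp only [hVdef]
    rw [← mul_assoc, ← ENNReal.ofReal_mul (by positivity), e1, ENNReal.ofReal_one, one_mul]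
  · rw [lintegral_congr_ae (g := fun y => ENNReal.ofReal (u y) ^ (p + 1))
      (hUae.mono fun y hy => by simp only [hy])]
    exact lintegral_ofReal_rpow_ne_top (by linarith) hu
  · rw [setLIntegral_congr_fun (g := fun x => ENNReal.ofReal (v x) ^ (q + 1))
      measurableSet_halfSpace fun x hx => by simp only [hV x hx]]
    exact lintegral_ofReal_rpow_ne_top (by linarith) hv

end IsPositiveSolution

end

/-! ### Assembly of the main theorem. -/

theorem theorem1p4 (m : ℕ) (hm : 2 ≤ m) (n : ℝ) (hn : n = (m : ℝ) + 1)
    (lam μ α β p₀ q₀ : ℝ) (hlam : 0 ≤ lam)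
    (hα : 0 < α) (hαn : α < n) (hβ : 0 < β) (hβn : β < n)
    (hμ : 0 < μ) (hμn : μ < n - 2 * lam)
    (hp₀ : 1 < p₀) (hq₀ : 1 < q₀)
    (hcrit : (n - 1) / n * (1 / (p₀ + 1)) + 1 / (q₀ + 1) = (α + β + μ - lam) / n)
    (u : Bdry m → ℝ) (v : Amb m → ℝ)
    (hu : MemLp u (ENNReal.ofReal (p₀ + 1)) volume)
    (hv : MemLp v (ENNReal.ofReal (q₀ + 1)) (volume.restrict (halfSpace m)))
    (hsol : IsPositiveSolution lam μ α β p₀ q₀ u v) :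
    (1 / q₀ - (μ + β - lam) / (q₀ * n) > (β - 1) / n →
      Tendsto (fun y : Bdry m => ENNReal.ofReal (u y * ‖y‖ ^ α)) (𝓝[≠] 0)
        (𝓝 (limitU lam μ β q₀ v)) ∧
      (β * (q₀ + 1) < n - μ + lam * (q₀ + 1) → limitU lam μ β q₀ v < ⊤)) ∧
    (1 / p₀ - (μ + α - lam + 1) / (p₀ * (n - 1)) > α / (n - 1) →
      Tendsto (fun x : Amb m => ENNReal.ofReal (v x * ‖x‖ ^ β / lastCoord x ^ lam))
        (𝓝[halfSpace m] 0) (𝓝 (limitV μ α p₀ u)) ∧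
      (α * (p₀ + 1) < n - 1 - μ → limitV μ α p₀ u < ⊤)) := by
  subst hn
  have hm0 : 0 < m := by omega
  have hmR : (0 : ℝ) < m := Nat.cast_pos.2 hm0
  have hcrit' : m / (p₀ + 1) + ((m : ℝ) + 1) / (q₀ + 1) = α + β + μ - lam := by
    field_simp at hcrit ⊢
    linarith
  obtain ⟨U, V, hsys, hU, hV⟩ := hsol.exists_isSystem hm0 hlam hα hβ hμ hp₀ hq₀ hcrit' hu hv
  obtain ⟨a, b, κ, ρ, h⟩ := hsys.exists_isSplitSystem
  have hA : limitU lam μ β q₀ v = ∫⁻ x in halfSpace m, interiorDensity lam β q₀ V x *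
      ENNReal.ofReal (‖x‖ ^ (-μ)) := by
    refine setLIntegral_congr_fun measurableSet_halfSpace fun x hx => ?_
    have hX := norm_pos_of_mem_halfSpace hx
    have e1 : interiorDensity lam β q₀ V x =
        interiorDensity lam β q₀ (fun x => ENNReal.ofReal (v x)) x := by
      simp only [interiorDensity, hV x hx]
    rw [e1, interiorDensity_ofReal_mul (by linarith) hx (hsol.v_pos x hx).le, div_eq_mul_inv,
      ← Real.rpow_neg hX.le, neg_add, Real.rpow_add hX]
    congr 1; ring
  have hB : limitV μ α p₀ u = ∫⁻ y, bdryDensity α p₀ U y * ENNReal.ofReal (‖y‖ ^ (-μ)) := by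
    refine lintegral_congr_ae ?_
    filter_upwards [ae_ne_zero_bdry hm0] with y hy
    have hY := norm_pos_iff.2 hy
    have e1 : bdryDensity α p₀ U y =
        bdryDensity α p₀ (fun y => ENNReal.ofReal (u y)) y := by
      simp only [bdryDensity, hU y hy]
    rw [e1, bdryDensity_ofReal_mul (by linarith) (hsol.u_pos y hy).le, div_eq_mul_inv,
      ← Real.rpow_neg hY.le, neg_add, Real.rpow_add hY]
    congr 1; ring
  have hab := h.a_add_b
  refine ⟨fun _ => ⟨?_, fun hfin => ?_⟩, fun hcond => ⟨?_, fun hfin => ?_⟩⟩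
  · rw [hA]
    refine h.tendsto_fst.congr' ?_
    filter_upwards [self_mem_nhdsWithin] with y hy
    rw [hU y hy, ← ENNReal.ofReal_mul (by positivity), mul_comm]
  · rw [hA]
    refine (h.lintegral_interiorDensity_ne_top ?_).lt_top
    have h1 : ((m : ℝ) + 1) / (q₀ + 1) * (q₀ + 1) = m + 1 := by field_simp
    have h2 : b * (q₀ + 1) = m + 1 - (β - lam) * (q₀ + 1) := by rw [h.b_eq, sub_mul, h1]
    linarith
  · rw [hB]
    -- For λ ≤ 1 the hypothesis of this part unfolds to αp + μ + α + 1 - λ < m. For λ > 1, μ < m + 1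
    -- - 2λ is already enough.
    have hμm : μ < m := by
      rcases le_or_gt lam 1 with hl | hl
      · have h1 : 1 / p₀ - (μ + α - lam + 1) / (p₀ * m) - α / m > 0 := by
          rw [add_sub_cancel_right] at hcond
          linarith
        have h2 : 1 / p₀ - (μ + α - lam + 1) / (p₀ * m) - α / m =
            (m - (μ + α - lam + 1) - α * p₀) / (p₀ * m) := by field_simp
        rw [h2, gt_iff_lt, div_pos_iff_of_pos_right (by positivity)] at h1
        have h3 : 0 < α * p₀ := by positivity
        linarith
      · linarith
    refine (h.tendsto_snd hμm).congr' ?_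
    filter_upwards [self_mem_nhdsWithin] with x hx
    have hx0 : 0 < lastCoord x := hx
    rw [hV x hx, ← ENNReal.ofReal_mul (by positivity), Real.rpow_neg hx0.le]
    congr 1; ring
  · rw [hB]
    -- As a(p+1) = m - α(p+1) and a + b = μ, the finiteness condition α(p+1) < m - μ is equivalent
    -- to b < pa.
    refine (h.lintegral_bdryDensity_ne_top ?_).lt_top
    have h1 : (m : ℝ) / (p₀ + 1) * (p₀ + 1) = m := by field_simp
    have h2 : a * (p₀ + 1) = m - α * (p₀ + 1) := by rw [h.a_eq, sub_mul, h1]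
    linarith
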